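/- Let $\alpha\ge\alpha_0>0$, let $u_0\in L^2(0,1)$ be real with $\|u_0\|_{L^2(0,1)}\le M_0$, $M_0>0$, and put $\lambda_n=\alpha n^2\pi^2$, $C_0=\int_0^1u_0(x)\,dx$, $C_n=2\int_0^1u_0(x)\cos(n\pi x)\,dx$ $(n\ge1)$. The boundary observation at $x=0$ of the uncontrolled heat equation $u_t=\alpha u_{xx}$ on $(0,1)$ with homogeneous Neumann conditions and initial state $u_0$ is $y(t)=\sum_{n\ge0}C_ne^{-\lambda_nt}$, $t>0$. Let $M\ge1$, suppose that at least $M$ of the $C_n$ are nonzero, let $n_0<n_1<\dots<n_{M-1}$ be the indices of the first $M$ nonzero ones (so $n_k=k$ if no $C_n$ vanishes), and let $x(t)=\sum_{k=0}^{M-1}C_{n_k}e^{-\lambda_{n_k}t}$. Let $0<T_1<T_2$, $N>9$, $T_s=\frac{T_2-T_1}{N-1}$, $x_i=x(T_1+iT_s)$ and $y_i=y(T_1+iT_s)$ for $0\le i\le N-1$. Let $L=\lceil N/3\rceil$ and suppose $M\le L$. With ${\bf x}_t=[x_t,\dots,x_{N-L+t-1}]^\top$ and ${\bf y}_t=[y_t,\dots,y_{N-L+t-1}]^\top$,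 let $X_0=[{\bf x}_{L-1},\dots,{\bf x}_0]$, $X_1=[{\bf x}_L,\dots,{\bf x}_1]$, $Y_0=[{\bf y}_{L-1},\dots,{\bf y}_0]$, $Y_1=[{\bf y}_L,\dots,{\bf y}_1]$, which are $(N-L)\times L$ matrices. Let $Y_0=U\Sigma V^\top$ be a singular value decomposition with singular values $\sigma_1\ge\sigma_2\ge\cdots$, where $\sigma_M>0$, and with columns $u_i$ of $U$ and $v_i$ of $V$; put $Y_{0,M}=\sum_{i=1}^M\sigma_iu_iv_i^\top$ and $Y_{0,M}^\dagger=\sum_{i=1}^M\sigma_i^{-1}v_iu_i^\top$. Assume that $Y_{0,M}^\dagger Y_1=X_M\,\mathrm{diag}(\tilde z_1,\dots,\tilde z_M,0,\dots,0)\,X_M^{-1}$ with an invertible (real or complex) matrix $X_M$ and real numbers $\tilde z_1\ge\dots\ge\tilde z_M$. Let $z_1\ge\dots\ge z_M$ be the nonzero eigenvalues of $X_0^\dagger X_1$, where $X_0^\dagger$ is the Moore–Penrose inverse. Write $\|\cdot\|_2$ for the spectral norm, $\kappa(X_M)=\|X_M\|_2\|X_M^{-1}\|_2$, $\theta=2\alpha_0M^2\pi^2T_s$,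 $$c=\Big(\sqrt2+\frac1{4M\pi^2\alpha_0T_1}\Big)M_0e^{-\alpha_0M^2\pi^2T_1},\qquad M_{\theta,L}=\begin{cases}e^{-\theta},&\theta\ge1,\\ \frac2\theta e^{-1},&\frac1{L-1}<\theta<1,\\ (L-1)e^{-(L-1)\theta},&0<\theta\le\frac1{L-1},\end{cases}$$ $$\rho=\frac1{\sigma_M}\Big(\|Y_{0,M}-Y_0\|_2+c\sqrt{M_{\theta,L}+(1+\tfrac1\theta)^2}\Big).$$ If $\rho<1$, then for every $n=1,\dots,M$ $$|\tilde z_n-z_n|<\frac{\kappa(X_M)}{\sigma_M(1-\rho)}\Big[\frac{1+\sqrt5}2\,\rho\,\|Y_1\|_2+c\sqrt{M_{\theta,L+1}+\tfrac1\theta\big(1+\tfrac1\theta\big)e^{-\theta}}\Big].$$ If moreover $\theta>\frac1{L-1}$, then for every $n=1,\dots,M$ $$|\tilde z_n-z_n|<\frac{\kappa(X_M)\,\rho}{\sigma_M(1-\rho)}\Big[\frac{1+\sqrt5}2\|Y_1\|_2+\sigma_M\Big].$$ -/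

import Mathlib

open MeasureTheory

namespace HeatPencil

noncomputable section

/-! ### Matrices -/

/-- The four Penrose equations: `B` is the Moore–Penrose inverse of the real matrix `A`. -/
structure IsMoorePenrose {m n : ℕ} (A : Matrix (Fin m) (Fin n) ℝ)
    (B : Matrix (Fin n) (Fin m) ℝ) : Prop where
  mul_mul_self : A * B * A = A
  self_mul_mul : B * A * B = B
  transpose_left : (A * B).transpose = A * B
  transpose_right : (B * A).transpose = B * A

/-- Every real matrix has a Moore–Penrose inverse. -/
theorem exists_isMoorePenrose {m n : ℕ} (A : Matrix (Fin m) (Fin n) ℝ) :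
    ∃ B, IsMoorePenrose A B := by
  have hS : (A.transpose * A).IsHermitian := by
    simp [Matrix.IsHermitian, Matrix.conjTranspose_eq_transpose_of_trivial]
  set Q : Matrix (Fin n) (Fin n) ℝ := hS.eigenvectorUnitary.1 with hQ
  set d : Fin n → ℝ := hS.eigenvalues with hd
  have hQQ : Q.transpose * Q = 1 := by
    have := Unitary.coe_star_mul_self hS.eigenvectorUnitary
    rwa [Matrix.star_eq_conjTranspose, Matrix.conjTranspose_eq_transpose_of_trivial] at this
  have hspec : A.transpose * A = Q * Matrix.diagonal d * Q.transpose := by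
    have h := hS.spectral_theorem
    rw [Unitary.conjStarAlgAut_apply, Matrix.star_eq_conjTranspose,
      Matrix.conjTranspose_eq_transpose_of_trivial] at h
    simpa using h
  set S := A.transpose * A with hSdef
  set P : Matrix (Fin n) (Fin n) ℝ :=
    Q * Matrix.diagonal (fun i => (d i)⁻¹) * Q.transpose with hP
  have cancel : ∀ a b : Fin n → ℝ,
      (Q * Matrix.diagonal a * Q.transpose) * (Q * Matrix.diagonal b * Q.transpose)
        = Q * Matrix.diagonal (fun i => a i * b i) * Q.transpose := by
    intro a b
    calc _ = Q * Matrix.diagonal a * (Q.transpose * Q) * Matrix.diagonal b * Q.transpose := by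
          simp only [Matrix.mul_assoc]
      _ = _ := by rw [hQQ, Matrix.mul_one, Matrix.mul_assoc Q, Matrix.diagonal_mul_diagonal]
  have symm : ∀ a : Fin n → ℝ, (Q * Matrix.diagonal a * Q.transpose).transpose
      = Q * Matrix.diagonal a * Q.transpose := by
    intro a
    simp [Matrix.transpose_mul, Matrix.mul_assoc]
  have hPt : P.transpose = P := symm _
  have hSt : S.transpose = S := by simp [hSdef]
  have hPSt : (P * S).transpose = P * S := by rw [hspec, hP, cancel]; exact symm _
  have hSPS : S * (P * S) = S := by
    rw [hspec, hP, cancel, cancel]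
    congr 2
    ext i j
    by_cases h : d i = 0 <;> simp [h, Matrix.diagonal_apply]
  have hPSP : P * S * P = P := by
    rw [hspec, hP, cancel, cancel]
    congr 2
    ext i j
    by_cases h : d i = 0 <;> simp [h, Matrix.diagonal_apply]
  have key : A * (P * S) = A := by
    have h0 : (A * (P * S) - A).transpose * (A * (P * S) - A) = 0 := by
      have e1 : (A * (P * S) - A).transpose = (P * S) * A.transpose - A.transpose := by
        rw [Matrix.transpose_sub, Matrix.transpose_mul, hPSt]
      have e2 : A.transpose * (A * (P * S) - A) = 0 := by
        rw [Matrix.mul_sub, ← Matrix.mul_assoc, ← hSdef, hSPS, sub_self]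
      rw [e1, Matrix.sub_mul, Matrix.mul_assoc, e2]
      simp
    rw [← Matrix.conjTranspose_eq_transpose_of_trivial,
      Matrix.conjTranspose_mul_self_eq_zero] at h0
    exact sub_eq_zero.mp h0
  refine ⟨P * A.transpose, ?_, ?_, ?_, ?_⟩
  · rw [Matrix.mul_assoc, Matrix.mul_assoc P, ← hSdef, key]
  · rw [Matrix.mul_assoc P, ← hSdef, ← Matrix.mul_assoc, hPSP]
  · rw [Matrix.transpose_mul, Matrix.transpose_mul, Matrix.transpose_transpose, hPt,
      Matrix.mul_assoc]
  · rw [Matrix.mul_assoc, ← hSdef, hPSt]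

/-- The Moore–Penrose inverse `A†` of a real matrix. -/
def pinv {m n : ℕ} (A : Matrix (Fin m) (Fin n) ℝ) : Matrix (Fin n) (Fin m) ℝ :=
  (exists_isMoorePenrose A).choose

theorem isMoorePenrose_pinv {m n : ℕ} (A : Matrix (Fin m) (Fin n) ℝ) :
    IsMoorePenrose A (pinv A) :=
  (exists_isMoorePenrose A).choose_spec

open scoped Matrix.Norms.L2Operator in
/-- The spectral norm `‖A‖₂`, i.e. the operator norm for the Euclidean norms. -/
def specNorm {𝕜 : Type*} [RCLike 𝕜] {m n : ℕ} (A : Matrix (Fin m) (Fin n) 𝕜) : ℝ := ‖A‖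

/-- The spectral condition number `κ(X) = ‖X‖₂ ‖X⁻¹‖₂` (of an invertible matrix). -/
def condNumber {𝕜 : Type*} [RCLike 𝕜] {n : ℕ} (X : Matrix (Fin n) (Fin n) 𝕜) : ℝ :=
  specNorm X * specNorm X⁻¹

/-- The `(i+1)`-st largest singular value of `A` (indices start at `0`). -/
def singVal {m n : ℕ} (A : Matrix (Fin m) (Fin n) ℝ) (i : ℕ) : ℝ :=
  (Matrix.toEuclideanLin A).singularValues i

/-- The `m × n` matrix with main diagonal `d 0, d 1, …` and zeros elsewhere. -/
def rectDiag (m n : ℕ) (d : ℕ → ℝ) : Matrix (Fin m) (Fin n) ℝ :=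
  Matrix.of fun i j => if (i : ℕ) = (j : ℕ) then d i else 0

/-- `A = U Σ Vᵀ` is a singular value decomposition of `A`: `U`, `V` are orthogonal and the main
diagonal of `Σ` consists of the singular values of `A` in decreasing order. -/
structure IsSVD {m n : ℕ} (A : Matrix (Fin m) (Fin n) ℝ) (U : Matrix (Fin m) (Fin m) ℝ)
    (V : Matrix (Fin n) (Fin n) ℝ) : Prop where
  left_orthogonal : U ∈ Matrix.orthogonalGroup (Fin m) ℝ
  right_orthogonal : V ∈ Matrix.orthogonalGroup (Fin n) ℝ
  eq_mul : A = U * rectDiag m n (singVal A) * V.transpose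

/-- The rank-`M` truncation `∑_{i ≤ M} σ_i u_i v_iᵀ` of `A` along the decomposition `U`, `V`. -/
def svdTrunc {m n : ℕ} (A : Matrix (Fin m) (Fin n) ℝ) (U : Matrix (Fin m) (Fin m) ℝ)
    (V : Matrix (Fin n) (Fin n) ℝ) (M : ℕ) : Matrix (Fin m) (Fin n) ℝ :=
  U * rectDiag m n (fun i => if i < M then singVal A i else 0) * V.transpose

/-- The rank-`M` truncated pseudoinverse `∑_{i ≤ M} σ_i⁻¹ v_i u_iᵀ` of `A` along the
decomposition `U`, `V`. -/
def svdTruncPinv {m n : ℕ} (A : Matrix (Fin m) (Fin n) ℝ) (U : Matrix (Fin m) (Fin m) ℝ)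
    (V : Matrix (Fin n) (Fin n) ℝ) (M : ℕ) : Matrix (Fin n) (Fin m) ℝ :=
  V * rectDiag n m (fun i => if i < M then (singVal A i)⁻¹ else 0) * U.transpose

/-! ### The observation of the heat equation without control -/

/-- `λ_n = α n² π²`. -/
def eigval (α : ℝ) (n : ℕ) : ℝ := α * (n : ℝ) ^ 2 * Real.pi ^ 2

/-- `C_0 = ∫₀¹ u₀` and `C_n = 2 ∫₀¹ u₀(y) cos(nπy) dy` for `n ≥ 1`. -/
def coeff (u₀ : ℝ → ℝ) (n : ℕ) : ℝ :=
  if n = 0 then ∫ x in (0 : ℝ)..1, u₀ x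
  else 2 * ∫ x in (0 : ℝ)..1, u₀ x * Real.cos (n * Real.pi * x)

/-- The boundary observation `y(t) = u(0,t) = ∑_{n ≥ 0} C_n e^{-λ_n t}`; the series converges
absolutely for `t > 0` and square integrable `u₀`. -/
def obs (α : ℝ) (u₀ : ℝ → ℝ) (t : ℝ) : ℝ :=
  ∑' n : ℕ, coeff u₀ n * Real.exp (-(eigval α n * t))

/-- The index `n_k` of the `(k+1)`-st nonzero coefficient (`n_k = k` if no coefficient is zero). -/
def modeIndex (u₀ : ℝ → ℝ) (k : ℕ) : ℕ := Nat.nth (fun n => coeff u₀ n ≠ 0) k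

/-- `x(t)`, the sum of the first `M` nonzero terms of the series of the observation. -/
def signal (α : ℝ) (u₀ : ℝ → ℝ) (M : ℕ) (t : ℝ) : ℝ :=
  ∑ k ∈ Finset.range M,
    coeff u₀ (modeIndex u₀ k) * Real.exp (-(eigval α (modeIndex u₀ k) * t))

/-! ### The matrix pencil method -/

/-- The pencil parameter: `N/3` if this is an integer, and `⌊N/3⌋ + 1` otherwise. -/
def pencilParam (N : ℕ) : ℕ := if 3 ∣ N then N / 3 else N / 3 + 1

/-- The sampling period `T_s = (T₂ - T₁)/(N - 1)`. -/
def samplingPeriod (T₁ T₂ : ℝ) (N : ℕ) : ℝ := (T₂ - T₁) / ((N : ℝ) - 1)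

/-- The `(N-L) × L` matrix `[w_{L-1+s}, w_{L-2+s}, …, w_s]` (`s = 0, 1`) whose columns are
`w_t = (w t, w (t+1), …, w (N-L+t-1))ᵀ`. -/
def pencilMatrix (w : ℕ → ℝ) (N L s : ℕ) : Matrix (Fin (N - L)) (Fin L) ℝ :=
  Matrix.of fun r k => w ((L - 1 - (k : ℕ) + s) + (r : ℕ))

/-! ### The quantities in the error bound -/

/-- `(√2 + 1/(4Mπ²α₀T₁)) M₀ e^{-α₀M²π²T₁}`. -/
def tailConst (α₀ M₀ T₁ : ℝ) (M : ℕ) : ℝ :=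
  (Real.sqrt 2 + 1 / (4 * (M : ℝ) * Real.pi ^ 2 * α₀ * T₁)) * M₀
    * Real.exp (-(α₀ * (M : ℝ) ^ 2 * Real.pi ^ 2 * T₁))

/-- `M_{θ,L}`, for `θ > 0` and `L ≥ 2`. -/
def Mtheta (θ : ℝ) (L : ℕ) : ℝ :=
  if 1 ≤ θ then Real.exp (-θ)
  else if 1 / ((L : ℝ) - 1) < θ then 2 / θ * Real.exp (-1)
  else ((L : ℝ) - 1) * Real.exp (-(((L : ℝ) - 1) * θ))

/-- The bound for `‖Y₀ - X₀‖_F`. -/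
def frobBound₀ (α₀ M₀ T₁ : ℝ) (M : ℕ) (θ : ℝ) (L : ℕ) : ℝ :=
  tailConst α₀ M₀ T₁ M * Real.sqrt (Mtheta θ L + (1 + 1 / θ) ^ 2)

/-- The bound for `‖Y₁ - X₁‖_F`. -/
def frobBound₁ (α₀ M₀ T₁ : ℝ) (M : ℕ) (θ : ℝ) (L : ℕ) : ℝ :=
  tailConst α₀ M₀ T₁ M
    * Real.sqrt (Mtheta θ (L + 1) + 1 / θ * (1 + 1 / θ) * Real.exp (-θ))

end

end HeatPencil

open HeatPencil

/-!
The computed values `zt` and the exact values `z` are compared after compression to the leading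
singular subspaces of `Y₀`. Let `u`, `v` be the first `M` columns of `U`, `V`, let `Σ = uᵀ Y₀ v` be
the diagonal matrix of the leading singular values, and let `E₀ = Y₀ - X₀`, `E₁ = Y₁ - X₁`.

* The matrix `P = Σ⁻¹ uᵀ Y₁ v` has the eigenvalues `zt`. A real basis `S` that diagonalizes it, with
  condition number at most `κ(XM)`, comes from the real part of the Gram matrix of `XM⁻¹`
  (`exists_real_diagonalization`).
* The exact signal is a sum of `M` exponentials, so `X₀ = G R` and `X₁ = G Z R` with Vandermonde
  factors and `Z = diagonal z` (`eq_nodes_of_pinv`). With `K = uᵀ X₀ v = Σ - uᵀ E₀ v`, which is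
  invertible because `‖E₀‖ ≤ ρ σM < σM`, the matrix `K⁻¹ uᵀ X₁ v` has the eigenvalues `z`.
* Hence, in the basis `S`, the exact pencil is a matrix `B` with
  `diagonal zt - B = G₁ - G₀ (diagonal zt)`, where `G_s = S⁻¹ K⁻¹ uᵀ E_s v S` has Frobenius norm at
  most `κ(XM) / (σM (1 - ρ)) ‖E_s‖` (`exists_normalized_pencil`).
* The error `y - x` is the part of the series with the indices `n > n_{M-1}`. Bessel's inequality
  bounds the sum of its amplitudes by `tailConst`, and geometric sums bound `E₀`, `E₁` and
  `E₁ - w E₀`, where `w` separates the ratios of these modes from the values `z`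
  (`exists_pencilBounds_obs`).

It remains to bound the distance of ordered eigenvalues (`abs_sub_lt_of_pencil`). For a symmetric and
a diagonalizable matrix with real spectra it is at most `√2` times the Frobenius norm of the
difference: Kahan's inequality, `abs_eigenvalue_sub_le`. As `√2` is smaller than the golden ratio,
this suffices except when the modes decay slowly and some `zt` is negative and far from the exact
eigenvalues. In this case a trace inequality that exploits the factor `diagonal zt` to the right of
`G₀` gives a better constant (`le_of_negative_entry`).
-/

namespace HeatPencil

open Matrix
open scoped Matrix.Norms.Frobenius

/-! ### Frobenius norm -/

theorem frob_sq {m n : ℕ} (A : Matrix (Fin m) (Fin n) ℝ) : ‖A‖ ^ 2 = ∑ i, ∑ j, A i j ^ 2 := by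
  have h0 : 0 ≤ ∑ i, ∑ j, ‖A i j‖ ^ (2 : ℝ) :=
    Finset.sum_nonneg fun i _ => Finset.sum_nonneg fun j _ => by positivity
  rw [frobenius_norm_def, ← Real.rpow_natCast, ← Real.rpow_mul h0]
  norm_num

theorem frob_sq_eq_trace {m n : ℕ} (A : Matrix (Fin m) (Fin n) ℝ) :
    ‖A‖ ^ 2 = (Aᵀ * A).trace := by
  rw [frob_sq, Finset.sum_comm]
  simp [Matrix.trace, Matrix.mul_apply, sq]

theorem frob_sq_cols {m n : ℕ} (A : Matrix (Fin m) (Fin n) ℝ) :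
    ‖A‖ ^ 2 = ∑ j, ‖WithLp.toLp 2 (fun i => A i j)‖ ^ 2 := by
  rw [frob_sq, Finset.sum_comm]
  simp [EuclideanSpace.norm_sq_eq]

theorem trace_mul_le_frob {m n : ℕ} (A : Matrix (Fin m) (Fin n) ℝ) (B : Matrix (Fin n) (Fin m) ℝ) :
    (A * B).trace ≤ ‖A‖ * ‖B‖ := by
  have h : (A * B).trace = ∑ p : Fin m × Fin n, A p.1 p.2 * B p.2 p.1 := by
    simp [Matrix.trace, Matrix.mul_apply, Fintype.sum_prod_type]
  have hA : ‖A‖ ^ 2 = ∑ p : Fin m × Fin n, A p.1 p.2 ^ 2 := by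
    rw [frob_sq, Fintype.sum_prod_type]
  have hB : ‖B‖ ^ 2 = ∑ p : Fin m × Fin n, B p.2 p.1 ^ 2 := by
    rw [frob_sq, Fintype.sum_prod_type, Finset.sum_comm]
  have := Finset.sum_mul_sq_le_sq_mul_sq Finset.univ
    (fun p : Fin m × Fin n => A p.1 p.2) (fun p => B p.2 p.1)
  rw [← h, ← hA, ← hB, ← mul_pow] at this
  exact le_of_sq_le_sq this (by positivity)

theorem frob_conj_orthogonal {n : ℕ} {Q : Matrix (Fin n) (Fin n) ℝ} (h : Q * Qᵀ = 1)
    (A : Matrix (Fin n) (Fin n) ℝ) : ‖Qᵀ * A * Q‖ = ‖A‖ := by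
  rw [← sq_eq_sq₀ (norm_nonneg _) (norm_nonneg _), frob_sq_eq_trace, frob_sq_eq_trace]
  have : (Qᵀ * A * Q)ᵀ * (Qᵀ * A * Q) = Qᵀ * (Aᵀ * (Q * Qᵀ) * A * Q) := by
    simp [Matrix.transpose_mul, Matrix.mul_assoc]
  rw [this, Matrix.trace_mul_comm, h, Matrix.mul_one, Matrix.mul_assoc, h, Matrix.mul_one]

/-! ### Spectral norm -/

theorem norm_mulVec_le_specNorm {𝕜 : Type*} [RCLike 𝕜] {m n : ℕ} (A : Matrix (Fin m) (Fin n) 𝕜)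
    (v : Fin n → 𝕜) : ‖WithLp.toLp 2 (A *ᵥ v)‖ ≤ specNorm A * ‖WithLp.toLp 2 v‖ :=
  Matrix.l2_opNorm_mulVec A (WithLp.toLp 2 v)

theorem specNorm_nonneg {𝕜 : Type*} [RCLike 𝕜] {m n : ℕ} (A : Matrix (Fin m) (Fin n) 𝕜) :
    0 ≤ specNorm A := by
  unfold specNorm
  rw [Matrix.l2_opNorm_def]
  exact norm_nonneg _

theorem specNorm_le_of_forall {𝕜 : Type*} [RCLike 𝕜] {m n : ℕ} (A : Matrix (Fin m) (Fin n) 𝕜)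
    {c : ℝ} (hc : 0 ≤ c)
    (h : ∀ v, ‖WithLp.toLp 2 (A *ᵥ v)‖ ≤ c * ‖WithLp.toLp 2 v‖) : specNorm A ≤ c := by
  unfold specNorm
  rw [Matrix.l2_opNorm_def]
  refine ContinuousLinearMap.opNorm_le_bound _ hc fun v => ?_
  exact h v.ofLp

theorem specNorm_mul_le {𝕜 : Type*} [RCLike 𝕜] {m n l : ℕ} (A : Matrix (Fin m) (Fin n) 𝕜)
    (B : Matrix (Fin n) (Fin l) 𝕜) : specNorm (A * B) ≤ specNorm A * specNorm B :=
  Matrix.l2_opNorm_mul A B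

theorem specNorm_transpose {m n : ℕ} (A : Matrix (Fin m) (Fin n) ℝ) :
    specNorm Aᵀ = specNorm A := by
  rw [← Matrix.conjTranspose_eq_transpose_of_trivial]
  exact Matrix.l2_opNorm_conjTranspose A

theorem frob_mul_le_specNorm_mul {m n l : ℕ} (A : Matrix (Fin m) (Fin n) ℝ)
    (B : Matrix (Fin n) (Fin l) ℝ) : ‖A * B‖ ≤ specNorm A * ‖B‖ := by
  refine le_of_sq_le_sq ?_ (mul_nonneg (specNorm_nonneg A) (norm_nonneg _))
  rw [mul_pow, frob_sq_cols, frob_sq_cols B, Finset.mul_sum]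
  refine Finset.sum_le_sum fun j _ => ?_
  rw [← mul_pow]
  exact pow_le_pow_left₀ (norm_nonneg _) (norm_mulVec_le_specNorm A (fun i => B i j)) 2

theorem frob_mul_le_mul_specNorm {m n l : ℕ} (A : Matrix (Fin m) (Fin n) ℝ)
    (B : Matrix (Fin n) (Fin l) ℝ) : ‖A * B‖ ≤ ‖A‖ * specNorm B := by
  rw [← frobenius_norm_transpose, Matrix.transpose_mul, mul_comm, ← specNorm_transpose,
    ← frobenius_norm_transpose A]
  exact frob_mul_le_specNorm_mul _ _

theorem norm_mulVec_le_frob {m n : ℕ} (A : Matrix (Fin m) (Fin n) ℝ)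
    (v : Fin n → ℝ) : ‖WithLp.toLp 2 (A *ᵥ v)‖ ≤ ‖A‖ * ‖WithLp.toLp 2 v‖ := by
  have h := frobenius_norm_mul A (Matrix.replicateCol (Fin 1) v)
  have hc : ∀ {l : ℕ} (u : Fin l → ℝ), ‖Matrix.replicateCol (Fin 1) u‖ = ‖WithLp.toLp 2 u‖ := by
    intro l u
    rw [← sq_eq_sq₀ (norm_nonneg _) (norm_nonneg _), frob_sq_cols]
    simp
  rwa [← Matrix.replicateCol_mulVec, hc, hc] at h

/-! ### Triangularization -/

/-- The `Q` factor of a `QR` decomposition. -/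
theorem exists_orthogonal_mul_upper {n : ℕ} (T : Matrix (Fin n) (Fin n) ℝ) :
    ∃ Q : Matrix (Fin n) (Fin n) ℝ, Q * Qᵀ = 1 ∧ Qᵀ * Q = 1 ∧
      ∀ i j, j < i → (Qᵀ * T) i j = 0 := by
  have hfr : Module.finrank ℝ (EuclideanSpace ℝ (Fin n)) = Fintype.card (Fin n) := by simp
  let f : Fin n → EuclideanSpace ℝ (Fin n) := fun j => WithLp.toLp 2 fun i => T i j
  let b := InnerProductSpace.gramSchmidtOrthonormalBasis hfr f
  let Q : Matrix (Fin n) (Fin n) ℝ := Matrix.of fun i j => b j i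
  have h1 : Qᵀ * Q = 1 := by
    ext i j
    have := b.inner_eq_ite i j
    simp only [PiLp.inner_apply, RCLike.inner_apply, conj_trivial] at this
    simp only [Matrix.mul_apply, Matrix.transpose_apply, Q, Matrix.of_apply, Matrix.one_apply]
    rw [← this]
    exact Finset.sum_congr rfl fun k _ => mul_comm _ _
  refine ⟨Q, mul_eq_one_comm.mp h1, h1, fun i j hij => ?_⟩
  have := InnerProductSpace.gramSchmidtOrthonormalBasis_inv_triangular hfr f hij
  simp only [PiLp.inner_apply, RCLike.inner_apply, conj_trivial] at this
  simp only [Matrix.mul_apply, Matrix.transpose_apply, Q, Matrix.of_apply]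
  rw [← this]
  exact Finset.sum_congr rfl fun k _ => mul_comm _ _

theorem upper_of_mul_diagonal {n : ℕ} {A R : Matrix (Fin n) (Fin n) ℝ} {b : Fin n → ℝ}
    (hR : IsUnit R.det) (hup : ∀ i j, j < i → R i j = 0) (h : A * R = R * Matrix.diagonal b) :
    (∀ i j, j < i → A i j = 0) ∧ ∀ i, A i i = b i := by
  have hRt : R.BlockTriangular id := fun i j hij => hup i j hij
  have := Matrix.invertibleOfIsUnitDet R hR
  have hA : A = R * Matrix.diagonal b * R⁻¹ := by
    rw [← h, Matrix.mul_assoc, Matrix.mul_nonsing_inv _ hR, Matrix.mul_one]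
  have hAt : A.BlockTriangular id := by
    rw [hA]
    exact (hRt.mul (Matrix.blockTriangular_diagonal b)).mul
      (Matrix.blockTriangular_inv_of_blockTriangular hRt)
  refine ⟨fun i j hij => hAt hij, fun i => ?_⟩
  have hd : R i i ≠ 0 := by
    have := Matrix.det_of_isUpperTriangular hRt
    rw [this] at hR
    exact Finset.prod_ne_zero_iff.mp hR.ne_zero i (Finset.mem_univ _)
  have e := congrFun (congrFun h i) i
  rw [Matrix.mul_diagonal, Matrix.mul_apply, Finset.sum_eq_single i] at e
  · exact mul_right_cancel₀ hd (by rw [e, mul_comm])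
  · intro j _ hj
    rcases lt_or_gt_of_ne hj with hlt | hgt
    · rw [show A i j = 0 from hAt hlt, zero_mul]
    · rw [hup j i hgt, mul_zero]
  · simp

theorem frob_add_transpose_eq {n : ℕ} {N : Matrix (Fin n) (Fin n) ℝ}
    (h : ∀ i j, j ≤ i → N i j = 0) : ‖N + Nᵀ‖ = ‖N - Nᵀ‖ := by
  rw [← sq_eq_sq₀ (norm_nonneg _) (norm_nonneg _), frob_sq, frob_sq]
  refine Finset.sum_congr rfl fun i _ => Finset.sum_congr rfl fun j _ => ?_
  rcases le_total i j with hij | hij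
  · simp [h j i hij]
  · simp [h i j hij]

theorem trace_conj {n : ℕ} {Q : Matrix (Fin n) (Fin n) ℝ} (h : Q * Qᵀ = 1)
    (A : Matrix (Fin n) (Fin n) ℝ) : (Qᵀ * A * Q).trace = A.trace := by
  rw [Matrix.mul_assoc, Matrix.trace_mul_comm, Matrix.mul_assoc, h, Matrix.mul_one]

/-- If `B` is diagonalizable with real eigenvalues, a weighted trace of `B` is controlled by the
eigenvalues up to the skew-symmetric part of `B`: in a triangular form `Λ + N` of `B`, the
symmetric and the skew-symmetric part of `N` have the same Frobenius norm. -/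
theorem trace_mul_le_of_eigenvalues_le {n l : ℕ} {T B : Matrix (Fin n) (Fin n) ℝ} {b : Fin n → ℝ}
    (hT : IsUnit T.det) (hB : B * T = T * Matrix.diagonal b) (p : Fin n → Prop)
    (hp : ∀ i j, i ≤ j → p j → p i) {β : ℝ} (hβ : ∀ j, p j → b j ≤ β)
    (Y : Matrix (Fin n) (Fin l) ℝ) (hY : ∀ j m, ¬ p j → Y j m = 0)
    (C : Matrix (Fin n) (Fin n) ℝ) (hC : C = (T * Y) * (T * Y)ᵀ) :
    (C * B).trace ≤ β * C.trace + ‖C‖ * (‖B - Bᵀ‖ / 2) := by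
  obtain ⟨Q, hQ1, hQ2, hQ3⟩ := exists_orthogonal_mul_upper T
  set R := Qᵀ * T with hR
  set A := Qᵀ * B * Q with hA
  have hRdet : IsUnit R.det := by
    rw [hR, Matrix.det_mul]
    refine IsUnit.mul ?_ hT
    have := congrArg Matrix.det hQ2
    rw [Matrix.det_mul, Matrix.det_one] at this
    exact IsUnit.of_mul_eq_one _ this
  have hAR : A * R = R * Matrix.diagonal b := by
    rw [hA, hR, Matrix.mul_assoc, ← Matrix.mul_assoc Q, hQ1, Matrix.one_mul, Matrix.mul_assoc, hB,
      Matrix.mul_assoc]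
  obtain ⟨hAup, hAdiag⟩ := upper_of_mul_diagonal hRdet hQ3 hAR
  set C' := Qᵀ * C * Q with hC'
  have hC'2 : C' = (R * Y) * (R * Y)ᵀ := by
    rw [hC', hC, hR]; simp [Matrix.transpose_mul, Matrix.mul_assoc]
  have hCA : (C * B).trace = (C' * A).trace := by
    rw [← trace_conj hQ1 (C * B), hC', hA]
    congr 1
    have : Qᵀ * C * Q * (Qᵀ * B * Q) = Qᵀ * C * (Q * Qᵀ) * B * Q := by
      simp only [Matrix.mul_assoc]
    rw [this, hQ1, Matrix.mul_one, Matrix.mul_assoc Qᵀ C B]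
  set N := A - Matrix.diagonal b with hN
  have hNz : ∀ i j, j ≤ i → N i j = 0 := by
    intro i j hij
    rcases hij.eq_or_lt with rfl | hlt
    · simp [hN, hAdiag]
    · simp [hN, hAup i j hlt, hlt.ne']
  have hC's : C'ᵀ = C' := by rw [hC'2]; simp
  have hCN : (C' * N).trace ≤ ‖C‖ * (‖B - Bᵀ‖ / 2) := by
    have e1 : (C' * N).trace = (C' * ((1 / 2 : ℝ) • (N + Nᵀ))).trace := by
      have : (C' * Nᵀ).trace = (C' * N).trace := by
        rw [← Matrix.trace_transpose, Matrix.transpose_mul, Matrix.transpose_transpose, hC's,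
          Matrix.trace_mul_comm]
      rw [Matrix.mul_smul, Matrix.trace_smul, Matrix.mul_add, Matrix.trace_add, this, smul_eq_mul]
      ring
    rw [e1]
    refine (trace_mul_le_frob _ _).trans (le_of_eq ?_)
    rw [hC', frob_conj_orthogonal hQ1, norm_smul, frob_add_transpose_eq hNz]
    have : N - Nᵀ = Qᵀ * (B - Bᵀ) * Q := by
      rw [hN, hA, Matrix.transpose_sub, Matrix.diagonal_transpose, Matrix.transpose_mul,
        Matrix.transpose_mul, Matrix.transpose_transpose, Matrix.mul_sub, Matrix.sub_mul]
      simp only [Matrix.mul_assoc]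
      abel
    rw [this, frob_conj_orthogonal hQ1, Real.norm_eq_abs, abs_of_pos (by norm_num)]
    ring
  have hCd : (C' * Matrix.diagonal b).trace ≤ β * C.trace := by
    rw [← trace_conj hQ1 C, ← hC', Matrix.trace, Matrix.trace, Finset.mul_sum]
    refine Finset.sum_le_sum fun i _ => ?_
    rw [Matrix.diag_apply, Matrix.diag_apply, Matrix.mul_diagonal]
    have hii : C' i i = ∑ m, (R * Y) i m ^ 2 := by
      rw [hC'2, Matrix.mul_apply]; simp [sq]
    by_cases hpi : p i
    · rw [mul_comm]
      refine mul_le_mul_of_nonneg_right (hβ i hpi) ?_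
      rw [hii]; positivity
    · have : C' i i = 0 := by
        rw [hii]
        refine Finset.sum_eq_zero fun m _ => ?_
        rw [Matrix.mul_apply, Finset.sum_eq_zero, zero_pow two_ne_zero]
        intro j _
        by_cases hpj : p j
        · have : j < i := by
            by_contra hle
            exact hpi (hp i j (not_lt.mp hle) hpj)
          rw [hQ3 i j this, zero_mul]
        · rw [hY j m hpj, mul_zero]
      rw [this]; simp
  have : C' * A = C' * Matrix.diagonal b + C' * N := by rw [hN]; simp [Matrix.mul_sub]
  rw [hCA, this, Matrix.trace_add]
  linarith

/-- The symmetric and the skew-symmetric part of `X` are orthogonal, and only the former contributes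
to the trace against a symmetric matrix; this is where the constant `√2` of Kahan's inequality comes
from. -/
theorem abs_trace_add_skew_le {n : ℕ} (C X : Matrix (Fin n) (Fin n) ℝ) (hC : Cᵀ = C) :
    |(C * X).trace| + ‖C‖ * (‖X - Xᵀ‖ / 2) ≤ Real.sqrt 2 * (‖C‖ * ‖X‖) := by
  have e1 : (C * X).trace = (C * ((1 / 2 : ℝ) • (X + Xᵀ))).trace := by
    have : (C * Xᵀ).trace = (C * X).trace := by
      rw [← Matrix.trace_transpose, Matrix.transpose_mul, Matrix.transpose_transpose, hC,
        Matrix.trace_mul_comm]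
    rw [Matrix.mul_smul, Matrix.trace_smul, Matrix.mul_add, Matrix.trace_add, this, smul_eq_mul]
    ring
  have hn : ‖(1 / 2 : ℝ) • (X + Xᵀ)‖ = ‖X + Xᵀ‖ / 2 := by
    rw [norm_smul, Real.norm_eq_abs, abs_of_pos (by norm_num)]; ring
  have h1 : |(C * X).trace| ≤ ‖C‖ * (‖X + Xᵀ‖ / 2) := by
    rw [abs_le']
    constructor
    · rw [e1, ← hn]; exact trace_mul_le_frob _ _
    · rw [e1, ← hn, ← Matrix.trace_neg, ← Matrix.mul_neg, ← norm_neg ((1 / 2 : ℝ) • (X + Xᵀ))]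
      exact trace_mul_le_frob _ _
  have hpar : (‖X + Xᵀ‖ / 2) ^ 2 + (‖X - Xᵀ‖ / 2) ^ 2 = ‖X‖ ^ 2 := by
    have ht : ∑ i, ∑ j, X j i ^ 2 = ∑ i, ∑ j, X i j ^ 2 := Finset.sum_comm
    have hs : ‖X + Xᵀ‖ ^ 2 + ‖X - Xᵀ‖ ^ 2 = 4 * ‖X‖ ^ 2 := by
      have : 4 * ‖X‖ ^ 2 = 2 * ∑ i, ∑ j, X i j ^ 2 + 2 * ∑ i, ∑ j, X j i ^ 2 := by
        rw [ht, frob_sq]; ring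
      rw [this, frob_sq, frob_sq, Finset.mul_sum, Finset.mul_sum, ← Finset.sum_add_distrib,
        ← Finset.sum_add_distrib]
      refine Finset.sum_congr rfl fun i _ => ?_
      rw [Finset.mul_sum, Finset.mul_sum, ← Finset.sum_add_distrib, ← Finset.sum_add_distrib]
      refine Finset.sum_congr rfl fun j _ => ?_
      simp only [Matrix.add_apply, Matrix.sub_apply, Matrix.transpose_apply]
      ring
    linarith
  have h2 : ‖X + Xᵀ‖ / 2 + ‖X - Xᵀ‖ / 2 ≤ Real.sqrt 2 * ‖X‖ := by
    refine le_of_sq_le_sq ?_ (by positivity)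
    rw [mul_pow, Real.sq_sqrt (by norm_num), ← hpar]
    nlinarith [sq_nonneg (‖X + Xᵀ‖ / 2 - ‖X - Xᵀ‖ / 2)]
  calc _ ≤ ‖C‖ * (‖X + Xᵀ‖ / 2) + ‖C‖ * (‖X - Xᵀ‖ / 2) := by linarith
    _ = ‖C‖ * (‖X + Xᵀ‖ / 2 + ‖X - Xᵀ‖ / 2) := by ring
    _ ≤ ‖C‖ * (Real.sqrt 2 * ‖X‖) := by gcongr
    _ = _ := by ring

/-! ### Perturbation of real spectra -/

theorem abs_apply_le_frob {m n : ℕ} (A : Matrix (Fin m) (Fin n) ℝ) (i : Fin m) (j : Fin n) :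
    |A i j| ≤ ‖A‖ := by
  refine abs_le_of_sq_le_sq ?_ (norm_nonneg _)
  rw [frob_sq]
  calc A i j ^ 2 ≤ ∑ j, A i j ^ 2 :=
        Finset.single_le_sum (f := fun j => A i j ^ 2) (fun _ _ => sq_nonneg _) (Finset.mem_univ j)
    _ ≤ _ := Finset.single_le_sum (f := fun i => ∑ j, A i j ^ 2)
        (fun _ _ => Finset.sum_nonneg fun _ _ => sq_nonneg _) (Finset.mem_univ i)

theorem exists_ne_zero_of_card_lt {n : ℕ} (T : Matrix (Fin n) (Fin n) ℝ) (I J : Finset (Fin n))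
    (h : n < I.card + J.card) :
    ∃ y : Fin n → ℝ, y ≠ 0 ∧ (∀ j, j ∉ J → y j = 0) ∧ ∀ i, i ∉ I → (T *ᵥ y) i = 0 := by
  let Φ : (Fin n → ℝ) →ₗ[ℝ] ({i // i ∉ I} → ℝ) × ({j // j ∉ J} → ℝ) :=
    LinearMap.prod ((LinearMap.funLeft ℝ ℝ (Subtype.val : {i // i ∉ I} → Fin n)) ∘ₗ T.mulVecLin)
      (LinearMap.funLeft ℝ ℝ (Subtype.val : {j // j ∉ J} → Fin n))
  have hlt : Module.finrank ℝ (({i // i ∉ I} → ℝ) × ({j // j ∉ J} → ℝ))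
      < Module.finrank ℝ (Fin n → ℝ) := by
    have hI := I.card_le_univ
    have hJ := J.card_le_univ
    simp only [Fintype.card_fin] at hI hJ
    simp only [Module.finrank_prod, Module.finrank_fintype_fun_eq_card, Fintype.card_fin,
      Fintype.card_subtype_compl, Fintype.card_coe]
    omega
  obtain ⟨y, hy, hy0⟩ := Submodule.exists_mem_ne_zero_of_ne_bot
    (LinearMap.ker_ne_bot_of_finrank_lt (f := Φ) hlt)
  have hy' : Φ y = 0 := hy
  refine ⟨y, hy0, fun j hj => ?_, fun i hi => ?_⟩
  · exact congrFun (congrArg Prod.snd hy') ⟨j, hj⟩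
  · exact congrFun (congrArg Prod.fst hy') ⟨i, hi⟩

/-- The two hypotheses on `I` and `p` say that a spectral subspace of `diagonal a` and an invariant
subspace of `B` meet; on a common vector the quadratic forms of the two matrices are compared. -/
theorem sub_le_frob_of_card_lt {n : ℕ} {a b : Fin n → ℝ} {T B : Matrix (Fin n) (Fin n) ℝ}
    (hT : IsUnit T.det) (hB : B * T = T * Matrix.diagonal b) (I : Finset (Fin n))
    (p : Fin n → Prop) [DecidablePred p] (hp : ∀ i j, i ≤ j → p j → p i)
    (hcard : n < I.card + (Finset.univ.filter p).card) {α β : ℝ} (hα : ∀ i ∈ I, α ≤ a i)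
    (hβ : ∀ j, p j → b j ≤ β) : α - β ≤ Real.sqrt 2 * ‖Matrix.diagonal a - B‖ := by
  obtain ⟨y, hy0, hyJ, hyI⟩ := exists_ne_zero_of_card_lt T I _ hcard
  set x := T *ᵥ y with hx
  have hx0 : x ≠ 0 := by
    intro h0
    apply hy0
    have hdet : IsUnit T := (Matrix.isUnit_iff_isUnit_det T).mpr hT
    exact Matrix.mulVec_injective_of_isUnit hdet (by rw [← hx, h0, Matrix.mulVec_zero])
  set C := Matrix.vecMulVec x x with hC
  have hCY : C = (T * Matrix.replicateCol (Fin 1) y) * (T * Matrix.replicateCol (Fin 1) y)ᵀ := by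
    rw [← Matrix.replicateCol_mulVec, ← hx, hC]
    ext i j
    simp [Matrix.vecMulVec_apply, Matrix.mul_apply]
  set s := ∑ i, x i ^ 2 with hs
  have hspos : 0 < s := by
    obtain ⟨i, hi⟩ := Function.ne_iff.mp hx0
    exact Finset.sum_pos' (fun _ _ => sq_nonneg _) ⟨i, Finset.mem_univ _, sq_pos_of_ne_zero hi⟩
  have htr : C.trace = s := by simp [hC, Matrix.trace, Matrix.vecMulVec_apply, hs, sq]
  have hnorm : ‖C‖ = s := by
    rw [← sq_eq_sq₀ (norm_nonneg _) hspos.le, frob_sq, hs, sq (∑ i, x i ^ 2), Finset.sum_mul_sum]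
    simp [hC, Matrix.vecMulVec_apply, mul_pow]
  have h1 := trace_mul_le_of_eigenvalues_le hT hB p hp hβ (Matrix.replicateCol (Fin 1) y)
    (fun j m hj => by simpa using hyJ j (by simpa using hj)) C hCY
  rw [htr, hnorm] at h1
  have h2 : α * s ≤ (C * Matrix.diagonal a).trace := by
    rw [Matrix.trace, hs, Finset.mul_sum]
    refine Finset.sum_le_sum fun i _ => ?_
    rw [Matrix.diag_apply, Matrix.mul_diagonal, hC, Matrix.vecMulVec_apply]
    by_cases hi : i ∈ I
    · nlinarith [hα i hi, sq_nonneg (x i)]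
    · rw [hyI i hi]; simp
  have h3 := abs_trace_add_skew_le C (Matrix.diagonal a - B)
    (by rw [hC]; ext i j; simp [Matrix.vecMulVec_apply, mul_comm])
  have h4 : ‖(Matrix.diagonal a - B) - (Matrix.diagonal a - B)ᵀ‖ = ‖B - Bᵀ‖ := by
    rw [← norm_neg]
    congr 1
    rw [Matrix.transpose_sub, Matrix.diagonal_transpose]
    abel
  rw [h4, hnorm] at h3
  have h5 : (C * (Matrix.diagonal a - B)).trace ≤ |(C * (Matrix.diagonal a - B)).trace| :=
    le_abs_self _
  rw [Matrix.mul_sub, Matrix.trace_sub] at h5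
  rw [Matrix.mul_sub] at h3
  have h6 : s * (α - β) ≤ s * (Real.sqrt 2 * ‖Matrix.diagonal a - B‖) := by
    have : (C * Matrix.diagonal a - C * B).trace
      = (C * Matrix.diagonal a).trace - (C * B).trace := Matrix.trace_sub _ _
    rw [this] at h3
    nlinarith
  exact le_of_mul_le_mul_left h6 hspos

/-- **Kahan's inequality.** A real symmetric matrix and a diagonalizable matrix with real
eigenvalues: the ordered eigenvalues differ by at most `√2` times the Frobenius norm of the
difference. -/
theorem abs_eigenvalue_sub_le {n : ℕ} {a b : Fin n → ℝ} (ha : Antitone a) (hb : Antitone b)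
    {T B : Matrix (Fin n) (Fin n) ℝ} (hT : IsUnit T.det) (hB : B * T = T * Matrix.diagonal b)
    (k : Fin n) : |a k - b k| ≤ Real.sqrt 2 * ‖Matrix.diagonal a - B‖ := by
  rw [abs_sub_le_iff]
  constructor
  · -- the eigenvalues are listed in increasing order, so that the relevant ones come first
    have hT' : IsUnit (T.submatrix id Fin.revPerm).det := by
      rw [Matrix.det_permute']
      exact IsUnit.mul (by simp) hT
    have hB' : B * T.submatrix id Fin.revPerm
        = T.submatrix id Fin.revPerm * Matrix.diagonal (b ∘ Fin.rev) := by
      ext i j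
      have := congrFun (congrFun hB i) (Fin.rev j)
      rw [Matrix.mul_diagonal] at this ⊢
      simpa [Matrix.mul_apply] using this
    refine sub_le_frob_of_card_lt hT' hB' (Finset.Iic k) (fun j => k ≤ Fin.rev j)
      (fun i j hij hj => hj.trans (Fin.rev_le_rev.mpr hij)) ?_
      (fun i hi => ha (Finset.mem_Iic.mp hi)) (fun j hj => hb hj)
    have : (Finset.univ.filter fun j => k ≤ Fin.rev j) = Finset.Iic (Fin.rev k) := by
      ext j; simp [Fin.le_rev_iff]
    rw [this, Fin.card_Iic, Fin.card_Iic, Fin.val_rev]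
    omega
  · have hB' : (-B) * T = T * Matrix.diagonal (-b) := by
      rw [Matrix.neg_mul, hB, ← Matrix.mul_neg]
      congr 1
      ext i j; simp [Matrix.diagonal_apply]; split_ifs <;> simp
    have h := sub_le_frob_of_card_lt (a := -a) hT hB' (Finset.Ici k) (fun j => j ≤ k)
      (fun i j hij hj => hij.trans hj) (α := -a k) (β := -b k) ?_
      (fun i hi => neg_le_neg (ha (Finset.mem_Ici.mp hi))) (fun j hj => neg_le_neg (hb hj))
    · have e : Matrix.diagonal (-a) - -B = -(Matrix.diagonal a - B) := by
        have : Matrix.diagonal (-a) = -Matrix.diagonal a := by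
          ext i j; simp [Matrix.diagonal_apply]; split_ifs <;> simp
        rw [this]; abel
      rw [e, norm_neg] at h
      linarith
    · have : (Finset.univ.filter fun j => j ≤ k) = Finset.Iic k := by ext; simp
      rw [this, Fin.card_Iic, Fin.card_Ici]
      omega

theorem abs_eigenvalue_sub_le_one {a b : Fin 1 → ℝ} {T B : Matrix (Fin 1) (Fin 1) ℝ}
    (hT : IsUnit T.det) (hB : B * T = T * Matrix.diagonal b)
    (k : Fin 1) : |a k - b k| ≤ ‖Matrix.diagonal a - B‖ := by
  have h := congrFun (congrFun hB 0) 0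
  rw [Matrix.mul_diagonal] at h
  simp only [Matrix.mul_apply, Fin.sum_univ_one] at h
  rw [Matrix.det_fin_one] at hT
  have hb : B 0 0 = b 0 := mul_right_cancel₀ hT.ne_zero (by rw [h, mul_comm])
  rw [Subsingleton.elim k 0]
  have := abs_apply_le_frob (Matrix.diagonal a - B) 0 0
  simpa [hb] using this

theorem frob_sq_eq_diag_add_off {n : ℕ} (G : Matrix (Fin n) (Fin n) ℝ) :
    ‖G‖ ^ 2 = ∑ j, G j j ^ 2 + ∑ i, ∑ j, (if i = j then 0 else G i j ^ 2) := by
  rw [frob_sq, ← Finset.sum_add_distrib]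
  refine Finset.sum_congr rfl fun i _ => ?_
  have h1 := Finset.add_sum_erase Finset.univ (fun j => G i j ^ 2) (Finset.mem_univ i)
  have h2 := Finset.add_sum_erase Finset.univ (fun j => if i = j then 0 else G i j ^ 2)
    (Finset.mem_univ i)
  rw [← h1, ← h2, if_pos rfl, zero_add]
  congr 1
  refine Finset.sum_congr rfl fun j hj => ?_
  rw [if_neg (Finset.ne_of_mem_erase hj).symm]

/-- The diagonal of `G` drops out of the skew-symmetric part of `G * diagonal d`, and the entries of
a pair `i ≠ j` are weighted with `d i` and `d j` only. -/
theorem frob_sq_skew_mul_diagonal_le {n : ℕ} (G : Matrix (Fin n) (Fin n) ℝ) {d : Fin n → ℝ} {m : ℝ}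
    (h : ∀ i j, i ≠ j → d i ^ 2 + d j ^ 2 ≤ m) :
    ‖G * Matrix.diagonal d - (G * Matrix.diagonal d)ᵀ‖ ^ 2
      ≤ 2 * (∑ i, ∑ j, (if i = j then 0 else G i j ^ 2)) * m := by
  have hterm : ∀ i j, (G * Matrix.diagonal d - (G * Matrix.diagonal d)ᵀ) i j ^ 2
      ≤ ((if i = j then 0 else G i j ^ 2) + (if j = i then 0 else G j i ^ 2)) * m := by
    intro i j
    rw [Matrix.sub_apply, Matrix.transpose_apply, Matrix.mul_diagonal, Matrix.mul_diagonal]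
    by_cases hij : i = j
    · subst hij; simp
    · rw [if_neg hij, if_neg (Ne.symm hij)]
      have h1 := h i j hij
      have h2 : 0 ≤ G i j ^ 2 + G j i ^ 2 := by positivity
      have h3 := mul_le_mul_of_nonneg_left h1 h2
      have h4 := sq_nonneg (G i j * d i + G j i * d j)
      linarith
  have hsum := Finset.sum_le_sum fun i (_ : i ∈ Finset.univ) =>
    Finset.sum_le_sum fun j (_ : j ∈ Finset.univ) => hterm i j
  have hoff' : ∑ i, ∑ j, (if j = i then 0 else G j i ^ 2)
      = ∑ i, ∑ j, (if i = j then 0 else G i j ^ 2) := Finset.sum_comm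
  simp only [← Finset.sum_mul, Finset.sum_add_distrib] at hsum
  rw [hoff'] at hsum
  rw [frob_sq]
  linarith

/-- The Cauchy–Schwarz inequality for the diagonal and the off-diagonal part of a matrix with
Frobenius norm `g`. With `x = u / δ`, the constants come from
`√(3 / 2 + x² / 2) ≤ 1.2248 + 0.2042 x` on `[0, 1]`. -/
theorem weighted_cauchy_le {δ u s g dg off : ℝ} (hδ : 0 < δ) (hu0 : 0 ≤ u) (huδ : u ≤ δ)
    (hδs : δ ≤ s) (hdg0 : 0 ≤ dg) (hoff0 : 0 ≤ off) (hg : g ^ 2 = dg + off) (hg0 : 0 ≤ g) :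
    δ * Real.sqrt dg + Real.sqrt off * Real.sqrt ((s ^ 2 + u ^ 2) / 2)
      ≤ g * (s * (1.2248 + 0.2042 * (u / δ))) := by
  have hs0 : 0 ≤ s := hδ.le.trans hδs
  set x := u / δ with hx
  have hx0 : 0 ≤ x := div_nonneg hu0 hδ.le
  have hx1 : x ≤ 1 := (div_le_one hδ).mpr huδ
  have hus : u ≤ x * s := by
    rw [hx, div_mul_eq_mul_div, le_div_iff₀ hδ]
    exact mul_le_mul_of_nonneg_left hδs hu0
  have hu2 : u ^ 2 ≤ x ^ 2 * s ^ 2 := by rw [← mul_pow]; exact pow_le_pow_left₀ hu0 hus 2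
  have hδ2 : δ ^ 2 ≤ s ^ 2 := pow_le_pow_left₀ hδ.le hδs 2
  have hpu : 0 ≤ (s ^ 2 + u ^ 2) / 2 := by positivity
  refine le_of_sq_le_sq ?_ (by positivity)
  have hcs : (δ * Real.sqrt dg + Real.sqrt off * Real.sqrt ((s ^ 2 + u ^ 2) / 2)) ^ 2
      ≤ (dg + off) * (δ ^ 2 + (s ^ 2 + u ^ 2) / 2) := by
    have e1 := Real.sq_sqrt hdg0
    have e2 := Real.sq_sqrt hoff0
    have e3 := Real.sq_sqrt hpu
    set r1 := Real.sqrt dg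
    set r2 := Real.sqrt off
    set r3 := Real.sqrt ((s ^ 2 + u ^ 2) / 2)
    rw [← e1, ← e2, ← e3]
    have h := sq_nonneg (δ * r2 - r1 * r3)
    linarith
  refine hcs.trans ?_
  rw [← hg, mul_pow]
  refine mul_le_mul_of_nonneg_left ?_ (sq_nonneg _)
  rw [mul_pow]
  have : δ ^ 2 + (s ^ 2 + u ^ 2) / 2 ≤ s ^ 2 * (1.5 + 0.5 * x ^ 2) := by linarith
  refine this.trans (mul_le_mul_of_nonneg_left ?_ (sq_nonneg s))
  nlinarith

/-- A multiplicative perturbation cannot carry an eigenvalue far below `w` into `[w, ∞)`: if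
`B - w = (1 + G) (diagonal zt - w) - R` has all its eigenvalues in `[0, ∞)` and
`diagonal zt - w` has smallest entry `-δ`, then `G` or `R` is large. With `G` small, the weight
`diagonal (zt - w)` to the right of `G` gives a better constant than Kahan's inequality. -/
theorem le_of_negative_entry {n : ℕ} {z zt : Fin n → ℝ} {w δ u : ℝ}
    {T B G R : Matrix (Fin n) (Fin n) ℝ}
    (hT : IsUnit T.det) (hB : B * T = T * Matrix.diagonal z) (hz : ∀ i, w ≤ z i)
    (hBG : Matrix.diagonal zt - B = R - G * Matrix.diagonal (fun i => zt i - w))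
    (hδ : 0 < δ) (hδex : ∃ j, w - zt j = δ) (hδle : ∀ j, w - zt j ≤ δ)
    (hu0 : 0 ≤ u) (hu : ∀ j, zt j - w ≤ u) (huδ : u ≤ δ) :
    δ ≤ ‖G‖ * (1.2248 * δ + 0.2042 * u) + Real.sqrt 2 * ‖R‖ := by
  set d : Fin n → ℝ := fun i => zt i - w with hd
  set D := Matrix.diagonal d with hD
  set a : Fin n → ℝ := fun j => max 0 (w - zt j) with ha
  have ha0 : ∀ j, 0 ≤ a j := fun j => le_max_left _ _
  have haδ : ∀ j, a j ≤ δ := fun j => max_le hδ.le (hδle j)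
  set C := Matrix.diagonal a with hC
  set p := ∑ j, a j ^ 2 with hp
  set s := ‖C‖ with hs
  have hsp : s ^ 2 = p := by
    rw [hs, frob_sq, hp]
    refine Finset.sum_congr rfl fun i _ => ?_
    rw [Finset.sum_eq_single i]
    · simp [hC]
    · intro j _ hj; simp [hC, Matrix.diagonal_apply_ne _ hj.symm]
    · simp
  have hs0 : 0 ≤ s := norm_nonneg _
  have hδs : δ ≤ s := by
    obtain ⟨j, hj⟩ := hδex
    have hj' : a j = δ := by simp only [ha]; rw [hj, max_eq_right hδ.le]
    refine le_of_sq_le_sq ?_ hs0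
    rw [hsp, hp, ← hj']
    exact Finset.single_le_sum (f := fun j => a j ^ 2) (fun _ _ => sq_nonneg _) (Finset.mem_univ j)
  have hBd : B = Matrix.diagonal zt - R + G * D := by rw [sub_eq_iff_eq_add] at hBG; rw [hBG]; abel
  set B' := -(B - Matrix.diagonal (fun _ => w)) with hB'
  have hB'e : B' = -D + R - G * D := by
    rw [hB', hBd]
    have : D = Matrix.diagonal zt - Matrix.diagonal (fun _ => w) := by
      rw [Matrix.diagonal_sub]
    rw [this]; abel
  have hB'T : B' * T = T * Matrix.diagonal (fun i => w - z i) := by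
    have h1 : Matrix.diagonal (fun _ : Fin n => w) * T = T * Matrix.diagonal (fun _ => w) := by
      ext i j; rw [Matrix.diagonal_mul, Matrix.mul_diagonal, mul_comm]
    rw [hB', Matrix.neg_mul, Matrix.sub_mul, hB, h1, ← Matrix.mul_sub, ← Matrix.mul_neg,
      Matrix.diagonal_sub]
    congr 1
    ext i j
    by_cases hij : i = j <;> simp [hij]
  have hCY : C = (T * (T⁻¹ * Matrix.diagonal fun j => Real.sqrt (a j)))
      * (T * (T⁻¹ * Matrix.diagonal fun j => Real.sqrt (a j)))ᵀ := by
    rw [← Matrix.mul_assoc, Matrix.mul_nonsing_inv _ hT, Matrix.one_mul,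
      Matrix.diagonal_transpose, Matrix.diagonal_mul_diagonal, hC]
    congr 1
    ext j
    rw [Real.mul_self_sqrt (ha0 j)]
  have h1 := trace_mul_le_of_eigenvalues_le hT hB'T (fun _ => True) (fun _ _ _ _ => trivial)
    (β := 0) (fun j _ => by linarith [hz j]) _ (fun _ _ h => absurd trivial h) C hCY
  have hskew : ‖B' - B'ᵀ‖ ≤ ‖R - Rᵀ‖ + ‖G * D - (G * D)ᵀ‖ := by
    have : B' - B'ᵀ = (R - Rᵀ) - (G * D - (G * D)ᵀ) := by
      rw [hB'e, Matrix.transpose_sub, Matrix.transpose_add, Matrix.transpose_neg, hD,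
        Matrix.diagonal_transpose]
      abel
    rw [this]; exact norm_sub_le _ _
  have hR := abs_trace_add_skew_le C R (by rw [hC, Matrix.diagonal_transpose])
  have htrB : (C * B').trace = p + (C * R).trace - (C * (G * D)).trace := by
    rw [hB'e, Matrix.mul_sub, Matrix.mul_add, Matrix.trace_sub, Matrix.trace_add]
    congr 2
    rw [Matrix.mul_neg, hC, hD, Matrix.diagonal_mul_diagonal, Matrix.trace_neg,
      Matrix.trace_diagonal, hp, ← Finset.sum_neg_distrib]
    refine Finset.sum_congr rfl fun j _ => ?_
    simp only [ha, hd]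
    rcases le_total 0 (w - zt j) with h | h
    · rw [max_eq_right h]; ring
    · rw [max_eq_left h]; ring
  -- the diagonal and the off-diagonal part of `G`
  set dg := ∑ j, G j j ^ 2 with hdg
  set off := ∑ i, ∑ j, (if i = j then 0 else G i j ^ 2) with hoff
  have hdg0 : 0 ≤ dg := Finset.sum_nonneg fun _ _ => sq_nonneg _
  have hoff0 : 0 ≤ off := Finset.sum_nonneg fun _ _ => Finset.sum_nonneg fun _ _ => by
    split_ifs <;> positivity
  have hGsq : ‖G‖ ^ 2 = dg + off := frob_sq_eq_diag_add_off G
  have htrG : (C * (G * D)).trace ≤ s * (δ * Real.sqrt dg) := by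
    have e : (C * (G * D)).trace = ∑ j, (a j * d j) * G j j := by
      rw [Matrix.trace]
      refine Finset.sum_congr rfl fun j _ => ?_
      rw [Matrix.diag_apply, hC, Matrix.diagonal_mul, hD, Matrix.mul_diagonal]; ring
    rw [e]
    refine (Real.sum_mul_le_sqrt_mul_sqrt _ _ _).trans ?_
    rw [← mul_assoc, ← hdg]
    refine mul_le_mul_of_nonneg_right ?_ (Real.sqrt_nonneg _)
    rw [Real.sqrt_le_left (by positivity), mul_pow, hsp, hp, Finset.sum_mul]
    refine Finset.sum_le_sum fun j _ => ?_
    have e1 : (a j * d j) ^ 2 = a j ^ 2 * a j ^ 2 := by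
      simp only [ha, hd]
      rcases le_total 0 (w - zt j) with h | h
      · rw [max_eq_right h]; ring
      · rw [max_eq_left h]; ring
    rw [e1]
    exact mul_le_mul_of_nonneg_left (pow_le_pow_left₀ (ha0 j) (haδ j) 2) (sq_nonneg (a j))
  have hpair : ∀ i j, i ≠ j → d i ^ 2 + d j ^ 2 ≤ p + u ^ 2 := by
    have hδp : δ ^ 2 ≤ p := by rw [← hsp]; exact pow_le_pow_left₀ hδ.le hδs 2
    have hone : ∀ i, a i ^ 2 ≤ p := fun i =>
      Finset.single_le_sum (f := fun j => a j ^ 2) (fun _ _ => sq_nonneg _) (Finset.mem_univ i)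
    have hcase : ∀ i, d i ^ 2 = a i ^ 2 ∨ d i ^ 2 ≤ u ^ 2 := by
      intro i
      simp only [ha, hd]
      rcases le_total 0 (w - zt i) with h | h
      · left; rw [max_eq_right h]; ring
      · right
        have := hu i
        exact pow_le_pow_left₀ (by linarith) this 2
    have hu2 : u ^ 2 ≤ δ ^ 2 := pow_le_pow_left₀ hu0 huδ 2
    intro i j hij
    rcases hcase i with hi | hi <;> rcases hcase j with hj | hj
    · rw [hi, hj, hp]
      have : a i ^ 2 + a j ^ 2 ≤ ∑ j, a j ^ 2 := by
        rw [← Finset.sum_pair hij (f := fun j => a j ^ 2)]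
        exact Finset.sum_le_sum_of_subset_of_nonneg (Finset.subset_univ _)
          fun _ _ _ => sq_nonneg _
      nlinarith [sq_nonneg u]
    · rw [hi]; linarith [hone i]
    · rw [hj]; linarith [hone j]
    · linarith
  have hskG : ‖G * D - (G * D)ᵀ‖ / 2 ≤ Real.sqrt off * Real.sqrt ((p + u ^ 2) / 2) := by
    have hpu : 0 ≤ (p + u ^ 2) / 2 := by rw [← hsp]; positivity
    refine le_of_sq_le_sq ?_ (by positivity)
    rw [mul_pow, Real.sq_sqrt hoff0, Real.sq_sqrt hpu, div_pow]
    have := frob_sq_skew_mul_diagonal_le G hpair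
    rw [← hoff, ← hD] at this
    linarith
  have hspos : 0 < s := hδ.trans_le hδs
  have hmain : s ≤ δ * Real.sqrt dg + Real.sqrt off * Real.sqrt ((p + u ^ 2) / 2)
      + Real.sqrt 2 * ‖R‖ := by
    have h2 : -(C * R).trace ≤ |(C * R).trace| := neg_le_abs _
    have h3 : s * (‖B' - B'ᵀ‖ / 2) ≤ s * (‖R - Rᵀ‖ / 2)
        + s * (Real.sqrt off * Real.sqrt ((p + u ^ 2) / 2)) := by
      rw [← mul_add]
      refine mul_le_mul_of_nonneg_left ?_ hs0
      linarith
    have h4 : s * s ≤ s * (δ * Real.sqrt dg + Real.sqrt off * Real.sqrt ((p + u ^ 2) / 2)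
      + Real.sqrt 2 * ‖R‖) := by
      rw [← sq, hsp]
      rw [htrB, zero_mul, zero_add] at h1
      nlinarith
    exact le_of_mul_le_mul_left h4 hspos
  have hx : δ * Real.sqrt dg + Real.sqrt off * Real.sqrt ((p + u ^ 2) / 2)
      ≤ ‖G‖ * (s * (1.2248 + 0.2042 * (u / δ))) := by
    rw [← hsp]
    exact weighted_cauchy_le hδ hu0 huδ hδs hdg0 hoff0 hGsq (norm_nonneg _)
  have hfin : s ≤ s * (‖G‖ * (1.2248 + 0.2042 * (u / δ))) + Real.sqrt 2 * ‖R‖ := by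
    calc s ≤ _ := hmain
      _ ≤ ‖G‖ * (s * (1.2248 + 0.2042 * (u / δ))) + Real.sqrt 2 * ‖R‖ := by linarith
      _ = _ := by ring
  have e : ‖G‖ * (1.2248 * δ + 0.2042 * u) = δ * (‖G‖ * (1.2248 + 0.2042 * (u / δ))) := by
    field_simp
  rw [e]
  set q := ‖G‖ * (1.2248 + 0.2042 * (u / δ)) with hq
  have hr0 : 0 ≤ Real.sqrt 2 * ‖R‖ := by positivity
  rcases le_total 1 q with hq1 | hq1
  · have := mul_le_mul_of_nonneg_left hq1 hδ.le
    linarith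
  · have := mul_le_mul_of_nonneg_right hδs (sub_nonneg.mpr hq1)
    linarith

/-! ### Elementary estimates -/

/-- The sum `1 / (1 - e^{-x})` of the geometric series with ratio `e^{-x}`. -/
noncomputable def geomSum (x : ℝ) : ℝ := (1 - Real.exp (-x))⁻¹

theorem one_sub_exp_neg_pos {x : ℝ} (hx : 0 < x) : 0 < 1 - Real.exp (-x) := by
  have : Real.exp (-x) < 1 := by
    rw [← Real.exp_zero]; exact Real.exp_lt_exp.mpr (by linarith)
  linarith

theorem geomSum_pos {x : ℝ} (hx : 0 < x) : 0 < geomSum x := inv_pos.mpr (one_sub_exp_neg_pos hx)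

theorem geomSum_anti {x y : ℝ} (hx : 0 < x) (hxy : x ≤ y) : geomSum y ≤ geomSum x := by
  refine inv_anti₀ (one_sub_exp_neg_pos hx) ?_
  have : Real.exp (-y) ≤ Real.exp (-x) := Real.exp_le_exp.mpr (by linarith)
  linarith

theorem geomSum_le_one_add {x : ℝ} (hx : 0 < x) : geomSum x ≤ 1 + 1 / x := by
  have h1 : Real.exp (-x) * (1 + x) ≤ 1 := by
    have := mul_le_mul_of_nonneg_left (Real.add_one_le_exp x) (Real.exp_pos (-x)).le
    rw [← Real.exp_add, neg_add_cancel, Real.exp_zero] at this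
    linarith
  rw [geomSum, inv_le_iff_one_le_mul₀ (one_sub_exp_neg_pos hx)]
  have : (1 + 1 / x) * (1 - Real.exp (-x)) = 1 + (1 - Real.exp (-x) * (1 + x)) / x := by
    field_simp
    ring
  rw [this]
  have : 0 ≤ (1 - Real.exp (-x) * (1 + x)) / x := div_nonneg (by linarith) hx.le
  linarith

/-- The left side is `1 / (2 sinh (x / 2))`. -/
theorem exp_mul_geomSum_le {x : ℝ} (hx : 0 < x) : Real.exp (-(x / 2)) * geomSum x ≤ 1 / x := by
  have hs := Real.self_le_sinh_iff.mpr (by linarith : 0 ≤ x / 2)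
  rw [Real.sinh_eq] at hs
  have e1 : Real.exp (-(x / 2)) * Real.exp (x / 2) = 1 := by rw [← Real.exp_add]; simp
  have e2 : Real.exp (-(x / 2)) * Real.exp (-(x / 2)) = Real.exp (-x) := by
    rw [← Real.exp_add]; congr 1; ring
  have h := mul_le_mul_of_nonneg_left hs (Real.exp_pos (-(x / 2))).le
  rw [geomSum, ← div_eq_mul_inv, div_le_div_iff₀ (one_sub_exp_neg_pos hx) hx]
  nlinarith

theorem exp_mul_geomSum_anti {x y : ℝ} (hx : 0 < x) (hxy : x ≤ y) :
    Real.exp (-(y / 2)) * geomSum y ≤ Real.exp (-(x / 2)) * geomSum x :=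
  mul_le_mul (Real.exp_le_exp.mpr (by linarith)) (geomSum_anti hx hxy)
    (geomSum_pos (hx.trans_le hxy)).le (Real.exp_pos _).le

/-- The expansion of `1 / (1 - e^{-x})` at `0` up to first order, with `x / 12` replaced by
`x / 8`. -/
theorem geomSum_le_quadratic {x : ℝ} (hx : 0 < x) : geomSum x ≤ 1 / x + 1 / 2 + x / 8 := by
  have ht : 1 + x + x ^ 2 / 2 + x ^ 3 / 6 + x ^ 4 / 24 ≤ Real.exp x := by
    have := Real.sum_le_exp_of_nonneg hx.le 5
    simp only [Finset.sum_range_succ, Finset.sum_range_zero, Nat.factorial] at this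
    norm_num at this
    linarith
  have hq : 0 < 1 - x / 2 + x ^ 2 / 8 := by nlinarith [sq_nonneg (x - 2)]
  have h1 : 1 + x / 2 + x ^ 2 / 8 ≤ Real.exp x * (1 - x / 2 + x ^ 2 / 8) := by
    have h2 := mul_le_mul_of_nonneg_right ht hq.le
    have h3 : 1 + x / 2 + x ^ 2 / 8 ≤
        (1 + x + x ^ 2 / 2 + x ^ 3 / 6 + x ^ 4 / 24) * (1 - x / 2 + x ^ 2 / 8) := by
      have h4 : 0 ≤ x ^ 3 / 24 + x ^ 4 / 48 + x ^ 6 / 192 := by positivity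
      nlinarith
    linarith
  have h5 : Real.exp (-x) * (1 + x / 2 + x ^ 2 / 8) ≤ 1 - x / 2 + x ^ 2 / 8 := by
    have := mul_le_mul_of_nonneg_left h1 (Real.exp_pos (-x)).le
    rwa [← mul_assoc, ← Real.exp_add, neg_add_cancel, Real.exp_zero, one_mul] at this
  rw [geomSum, inv_le_iff_one_le_mul₀ (one_sub_exp_neg_pos hx)]
  have : (1 / x + 1 / 2 + x / 8) * (1 - Real.exp (-x))
      = (1 + x / 2 + x ^ 2 / 8 - Real.exp (-x) * (1 + x / 2 + x ^ 2 / 8)) / x := by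
    field_simp
  rw [this, le_div_iff₀ hx]
  linarith

theorem geomSum_sq_le {x : ℝ} (hx : 0 < x) : geomSum x ^ 2 ≤ 1 + 1 / x + 1 / x ^ 2 := by
  have h0 := one_sub_exp_neg_pos hx
  -- `1 = (1 - e^{-x}) + e^{-x}`
  have h1 : geomSum x ^ 2 = geomSum x + (Real.exp (-(x / 2)) * geomSum x) ^ 2 := by
    have e2 : Real.exp (-(x / 2)) ^ 2 = Real.exp (-x) := by
      rw [sq, ← Real.exp_add]; congr 1; ring
    rw [mul_pow, e2, geomSum]
    field_simp
    ring
  have h2 : (Real.exp (-(x / 2)) * geomSum x) ^ 2 ≤ (1 / x) ^ 2 :=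
    pow_le_pow_left₀ (mul_nonneg (Real.exp_pos _).le (geomSum_pos hx).le) (exp_mul_geomSum_le hx) 2
  rw [_root_.one_div_pow] at h2
  rw [h1]
  linarith [geomSum_le_one_add hx]

theorem mul_exp_neg_mul_le {x : ℝ} : x * Real.exp (-x) ≤ Real.exp (-1) := by
  have h := Real.add_one_le_exp (x - 1)
  have h2 := mul_le_mul_of_nonneg_right h (Real.exp_pos (-x)).le
  rw [← Real.exp_add] at h2
  have e : x - 1 + -x = -1 := by ring
  rw [e] at h2
  linarith

theorem exp_neg_le_Mtheta {θ : ℝ} (hθ : 0 < θ) {L : ℕ} (hL : 2 ≤ L) :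
    Real.exp (-θ) ≤ Mtheta θ L := by
  have hL' : (1 : ℝ) ≤ (L : ℝ) - 1 := by
    have : (2 : ℝ) ≤ L := by exact_mod_cast hL
    linarith
  unfold Mtheta
  split_ifs with h1 h2
  · exact le_rfl
  · have := mul_exp_neg_mul_le (x := θ)
    rw [div_mul_eq_mul_div, le_div_iff₀ hθ]
    nlinarith [Real.exp_pos (-1)]
  · set j := (L : ℝ) - 1 with hj
    have hjθ : j * θ ≤ 1 := by
      have := not_lt.mp h2
      rw [le_div_iff₀ (by linarith)] at this
      linarith
    -- `e^{(j-1)θ} ≤ j` since `(j-1)θ ≤ 1 - 1/j ≤ log j`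
    have h3 : (j - 1) * θ ≤ 1 - 1 / j := by
      have : θ ≤ 1 / j := not_lt.mp h2
      have h4 := mul_le_mul_of_nonneg_left this (by linarith : 0 ≤ j - 1)
      have : (j - 1) * (1 / j) = 1 - 1 / j := by field_simp
      linarith
    have h4 : 1 - 1 / j ≤ Real.log j := by
      have := Real.one_sub_inv_le_log_of_pos (by linarith : 0 < j)
      rwa [← one_div] at this
    have h5 : Real.exp ((j - 1) * θ) ≤ j := by
      rw [← Real.le_log_iff_exp_le (by linarith)]
      linarith
    have h6 := mul_le_mul_of_nonneg_right h5 (Real.exp_pos (-(j * θ))).le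
    rw [← Real.exp_add] at h6
    have e : (j - 1) * θ + -(j * θ) = -θ := by ring
    rwa [e] at h6

theorem Mtheta_pos {θ : ℝ} (hθ : 0 < θ) {L : ℕ} (hL : 2 ≤ L) : 0 < Mtheta θ L :=
  (Real.exp_pos _).trans_le (exp_neg_le_Mtheta hθ hL)

/-- The square root in the bound for `‖Y₀ - X₀‖_F`. -/
noncomputable def bound₀ (θ : ℝ) (L : ℕ) : ℝ := Real.sqrt (Mtheta θ L + (1 + 1 / θ) ^ 2)

/-- The square root in the bound for `‖Y₁ - X₁‖_F`. -/
noncomputable def bound₁ (θ : ℝ) (L : ℕ) : ℝ :=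
  Real.sqrt (Mtheta θ (L + 1) + 1 / θ * (1 + 1 / θ) * Real.exp (-θ))

theorem one_add_inv_le_bound₀ {θ : ℝ} (hθ : 0 < θ) {L : ℕ} (hL : 2 ≤ L) :
    1 + 1 / θ ≤ bound₀ θ L := by
  refine Real.le_sqrt_of_sq_le ?_
  linarith [Mtheta_pos hθ hL]

theorem Mtheta_eq {θ : ℝ} {L : ℕ} (h1 : θ < 1) (h2 : 1 / ((L : ℝ) - 1) < θ) :
    Mtheta θ L = 2 / θ * Real.exp (-1) := by
  unfold Mtheta
  rw [if_neg (not_le.mpr h1), if_pos h2]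

theorem exp_neg_one_gt : 0.3678 < Real.exp (-1) := by
  have h := Real.exp_one_lt_d9
  rw [Real.exp_neg, lt_inv_comm₀ (by norm_num) (Real.exp_pos 1)]
  exact h.trans (by norm_num)

/-- For moderate `θ` the term `Mtheta` in `bound₀` gains a constant over `1 + 1 / θ`. -/
theorem le_bound₀_of_le {θ a : ℝ} (hθ : 0 < θ) {L : ℕ} (h1 : θ < 1) (h2 : 1 / ((L : ℝ) - 1) < θ)
    (ha : 2 * (a - 1) + (a ^ 2 - 1) * θ ≤ 0.7356) :
    1 / θ + a ≤ bound₀ θ L := by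
  refine Real.le_sqrt_of_sq_le ?_
  rw [Mtheta_eq h1 h2]
  have h3 : 0.7356 / θ ≤ 2 / θ * Real.exp (-1) := by
    rw [div_mul_eq_mul_div]
    gcongr
    linarith [exp_neg_one_gt]
  have h4 := div_le_div_of_nonneg_right ha hθ.le
  have h5 : (2 * (a - 1) + (a ^ 2 - 1) * θ) / θ = (1 / θ + a) ^ 2 - (1 + 1 / θ) ^ 2 := by
    field_simp
    ring
  linarith

theorem exp_mul_geomSum_le_bound₁ {θ : ℝ} (hθ : 0 < θ) {L : ℕ} (hL : 2 ≤ L) :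
    Real.exp (-(θ / 2)) * geomSum θ ≤ bound₁ θ L := by
  refine Real.le_sqrt_of_sq_le ?_
  have e2 : Real.exp (-(θ / 2)) ^ 2 = Real.exp (-θ) := by
    rw [sq, ← Real.exp_add]; congr 1; ring
  have h1 := exp_neg_le_Mtheta hθ (by omega : 2 ≤ L + 1)
  have h2 := mul_le_mul_of_nonneg_left (geomSum_sq_le hθ) (Real.exp_pos (-θ)).le
  have h3 : 1 / θ * (1 + 1 / θ) = 1 / θ + 1 / θ ^ 2 := by field_simp
  rw [mul_pow, e2, h3]
  linarith

theorem le_bound₁_of_le_inv {θ : ℝ} (hθ : 0 < θ) {L : ℕ} (hL : 2 ≤ L) (h : θ ≤ 1 / 3) :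
    0.98 / θ ≤ bound₁ θ L := by
  refine Real.le_sqrt_of_sq_le ?_
  have h1 := exp_neg_le_Mtheta hθ (by omega : 2 ≤ L + 1)
  have h2 := Real.one_sub_le_exp_neg θ
  have h3 : (0.98 / θ) ^ 2 ≤ (1 + 1 / θ * (1 + 1 / θ)) * (1 - θ) := by
    have e : (1 + 1 / θ * (1 + 1 / θ)) * (1 - θ) = (1 - θ ^ 3) / θ ^ 2 := by
      field_simp
      ring
    rw [e, div_pow]
    gcongr
    have : θ ^ 3 ≤ (1 / 3) ^ 3 := pow_le_pow_left₀ hθ.le h 3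
    norm_num at this ⊢
    linarith
  have h4 := mul_le_mul_of_nonneg_left h2 (by positivity : 0 ≤ 1 + 1 / θ * (1 + 1 / θ))
  linarith

theorem add_le_bound₁ {θ : ℝ} (hθ : 0 < θ) {L : ℕ} (h1 : θ ≤ 1 / 6) (hL : 2 ≤ L)
    (h2 : 1 / ((L : ℝ) - 1) < θ) : 1 / θ + 1 / 4 ≤ bound₁ θ L := by
  refine Real.le_sqrt_of_sq_le ?_
  have hL' : (2 : ℝ) ≤ L := by exact_mod_cast hL
  have h2' : 1 / (((L + 1 : ℕ) : ℝ) - 1) < θ := by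
    refine lt_of_le_of_lt ?_ h2
    push_cast
    apply one_div_le_one_div_of_le <;> linarith
  rw [Mtheta_eq (by linarith) h2']
  have h3 : 0.7356 / θ ≤ 2 / θ * Real.exp (-1) := by
    rw [div_mul_eq_mul_div]
    gcongr
    linarith [exp_neg_one_gt]
  have h4 := mul_le_mul_of_nonneg_left (Real.one_sub_le_exp_neg θ)
    (by positivity : 0 ≤ 1 / θ * (1 + 1 / θ))
  have e : 0.7356 / θ + 1 / θ * (1 + 1 / θ) * (1 - θ) - (1 / θ + 1 / 4) ^ 2
      = (0.2356 - 1.0625 * θ) / θ := by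
    field_simp
    ring
  have h5 : 0 ≤ (0.2356 - 1.0625 * θ) / θ := div_nonneg (by linarith) hθ.le
  linarith

theorem bound₁_le_bound₀ {θ : ℝ} (hθ : 0 < θ) {L : ℕ} (hL : 2 ≤ L)
    (h2 : 1 / ((L : ℝ) - 1) < θ) : bound₁ θ L ≤ bound₀ θ L := by
  have hL' : (2 : ℝ) ≤ L := by exact_mod_cast hL
  have h2' : 1 / (((L + 1 : ℕ) : ℝ) - 1) < θ := by
    refine lt_of_le_of_lt ?_ h2
    push_cast
    apply one_div_le_one_div_of_le <;> linarith
  refine Real.sqrt_le_sqrt ?_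
  have h3 : Mtheta θ (L + 1) = Mtheta θ L := by
    unfold Mtheta
    rw [if_pos h2, if_pos h2']
  rw [h3]
  have h4 : Real.exp (-θ) ≤ 1 := Real.exp_le_one_iff.mpr (by linarith)
  have h5 := mul_le_mul_of_nonneg_left h4 (by positivity : 0 ≤ 1 / θ * (1 + 1 / θ))
  have h6 : 0 < 1 / θ := by positivity
  nlinarith

theorem golden_gt : 1.618 < (1 + Real.sqrt 5) / 2 := by
  have : (2.236 : ℝ) < Real.sqrt 5 := Real.lt_sqrt_of_sq_lt (by norm_num)
  linarith

theorem sqrt_two_lt : Real.sqrt 2 < 1.41422 := by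
  rw [Real.sqrt_lt' (by norm_num)]; norm_num

/-- The estimate for short observation windows, `(L - 1) θ ≤ 1`, where the finite geometric sum
is noticeably smaller than the infinite one. -/
theorem short_window_le {θ Q : ℝ} {L : ℕ} (hθ : 0 < θ) (hL : 4 ≤ L) (h : θ ≤ 1 / ((L : ℝ) - 1))
    (hQ : 1 ≤ Q) :
    Real.sqrt 2 * (Real.sqrt (1 - Real.exp (-(L * θ))) * (Real.exp (-(θ / 2)) * geomSum θ)
      + Real.sqrt (1 - Real.exp (-(L * θ))) * geomSum θ * Q)
      ≤ 0.98 / θ + 1.618 * (1 + 1 / θ) * Q := by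
  have hL' : (4 : ℝ) ≤ L := by exact_mod_cast hL
  have hLθ : L * θ ≤ 4 / 3 := by
    rw [le_div_iff₀ (by linarith)] at h
    nlinarith
  have hexp : 0.26 ≤ Real.exp (-(L * θ)) := by
    have h1 : Real.exp (-(4 / 3)) ≤ Real.exp (-(L * θ)) := Real.exp_le_exp.mpr (by linarith)
    refine le_trans ?_ h1
    have h2 : Real.exp (-(4 / 3) : ℝ) = Real.exp (-1) * Real.exp (-(1 / 3)) := by
      rw [← Real.exp_add]; norm_num
    have h3 : (0.714 : ℝ) ≤ Real.exp (-(1 / 3)) := by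
      have hb := Real.exp_bound (x := -(1 / 3)) (by norm_num [abs_le]) (n := 4) (by norm_num)
      simp only [Finset.sum_range_succ, Finset.sum_range_zero, Nat.factorial] at hb
      norm_num [abs_le] at hb ⊢
      linarith [hb.1]
    rw [h2]
    have := exp_neg_one_gt
    nlinarith
  set k := Real.sqrt 2 * Real.sqrt (1 - Real.exp (-(L * θ))) with hk
  have hk0 : 0 ≤ k := by positivity
  have hk1 : k ≤ 1.2167 := by
    rw [hk, ← Real.sqrt_mul (by norm_num), Real.sqrt_le_left (by norm_num)]
    linarith
  have h1 := exp_mul_geomSum_le hθ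
  have h2 := geomSum_le_one_add hθ
  have h3 : 0 < 1 / θ := by positivity
  have h4 := geomSum_pos hθ
  have h5 : k * (Real.exp (-(θ / 2)) * geomSum θ) ≤ 1.2167 * (1 / θ) := by
    apply mul_le_mul hk1 h1 _ (by norm_num)
    positivity
  have h6 : k * geomSum θ * Q ≤ 1.2167 * (1 + 1 / θ) * Q := by
    refine mul_le_mul_of_nonneg_right ?_ (by linarith)
    exact mul_le_mul hk1 h2 h4.le (by norm_num)
  have h7 : 0.98 / θ = 0.98 * (1 / θ) := by ring
  calc _ = k * (Real.exp (-(θ / 2)) * geomSum θ) + k * geomSum θ * Q := by rw [hk]; ring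
    _ ≤ _ := by rw [h7]; nlinarith

/-- The estimate when the tail decays at least at the rate `x ≥ 1/6`. In the application, `a` is
`bound₀ θ L`, and it exceeds `1 + 1 / x` by the hypothesis `ha'` when `x` is small. -/
theorem fast_decay_le {x Q a : ℝ} (hx : 1 / 6 ≤ x) (hQ : 1 ≤ Q) (ha : 1 + 1 / x ≤ a)
    (ha' : x ≤ 1 / 4 → 1 / x + 1.27 ≤ a) :
    Real.sqrt 2 * (Real.exp (-(x / 2)) * geomSum x + geomSum x * Q)
      ≤ Real.exp (-(x / 2)) * geomSum x + 1.618 * a * Q := by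
  have hx0 : 0 < x := by linarith
  have hg := geomSum_pos hx0
  have hs := sqrt_two_lt
  have hg1 := geomSum_le_one_add hx0
  set E := Real.exp (-(x / 2)) * geomSum x with hE
  have hE0 : 0 ≤ E := by positivity
  suffices h : 0.41422 * E + 1.41422 * geomSum x ≤ 1.618 * a by
    have h1 : 1.41422 * geomSum x ≤ 1.618 * a := by
      linarith [mul_nonneg (by norm_num : (0 : ℝ) ≤ 0.41422) hE0]
    have h2 : Real.sqrt 2 * (E + geomSum x * Q) ≤ 1.41422 * (E + geomSum x * Q) := by
      refine mul_le_mul_of_nonneg_right hs.le ?_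
      have := mul_nonneg hg.le (by linarith : 0 ≤ Q)
      linarith
    have h3 := mul_le_mul_of_nonneg_right h1 (by linarith : 0 ≤ Q - 1)
    linarith
  rcases le_total x (8 / 5) with h | h
  · have h1 := exp_mul_geomSum_le hx0
    have h2 := geomSum_le_quadratic hx0
    have h3 : 0.41422 * (1 / x) + 1.41422 * (1 / x + 1 / 2 + x / 8) ≤ 1.618 * a := by
      have hxx : x * (1 / x) = 1 := by field_simp
      rcases le_total x (1 / 4) with h4 | h4
      · refine le_trans ?_ (mul_le_mul_of_nonneg_left (ha' h4) (by norm_num))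
        have : 0 ≤ 1.618 * (1 / x + 1.27) - (0.41422 * (1 / x) + 1.41422 * (1 / x + 1 / 2 + x / 8)) := by
          have e : 1.618 * (1 / x + 1.27) - (0.41422 * (1 / x) + 1.41422 * (1 / x + 1 / 2 + x / 8))
            = (1.618 * (1 + 1.27 * x) - 0.41422 - 1.41422 * (1 + x / 2 + x ^ 2 / 8)) / x := by
            field_simp
            ring
          rw [e]
          refine div_nonneg ?_ hx0.le
          nlinarith
        linarith
      · refine le_trans ?_ (mul_le_mul_of_nonneg_left ha (by norm_num))
        have : 0 ≤ 1.618 * (1 + 1 / x) - (0.41422 * (1 / x) + 1.41422 * (1 / x + 1 / 2 + x / 8)) := by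
          have e : 1.618 * (1 + 1 / x) - (0.41422 * (1 / x) + 1.41422 * (1 / x + 1 / 2 + x / 8))
            = (1.618 * (1 + x) - 0.41422 - 1.41422 * (1 + x / 2 + x ^ 2 / 8)) / x := by
            field_simp
            ring
          rw [e]
          refine div_nonneg ?_ hx0.le
          nlinarith
        linarith
    linarith
  · have h1 : Real.exp (-(x / 2)) ≤ 0.49 := by
      have h2 : Real.exp (-(x / 2)) * (1 + x / 2 + (x / 2) ^ 2 / 2) ≤ 1 := by
        have := mul_le_mul_of_nonneg_left (Real.quadratic_le_exp_of_nonneg (by linarith : 0 ≤ x / 2))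
          (Real.exp_pos (-(x / 2))).le
        rwa [← Real.exp_add, neg_add_cancel, Real.exp_zero] at this
      have h3 : (2.12 : ℝ) ≤ 1 + x / 2 + (x / 2) ^ 2 / 2 := by nlinarith
      have h4 := mul_le_mul_of_nonneg_left h3 (Real.exp_pos (-(x / 2))).le
      by_contra hcon
      push Not at hcon
      nlinarith
    have h2 : E ≤ 0.49 * geomSum x := by
      rw [hE]; exact mul_le_mul_of_nonneg_right h1 hg.le
    linarith

/-! ### The eigenvalue estimate -/

/-- The scalar inequality for the case where Kahan's inequality suffices. -/
theorem slow_decay_scalar_le {x Q : ℝ} (hx : 0 < x) (hx6 : x ≤ 1 / 6) (hQ : 1 ≤ Q) :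
    1.41422 * (1 + geomSum x * max 1.42 (Q - 11 / 12))
      ≤ 1 / x + 1 / 4 + 1.618 * (1 / x + 1.3) * Q := by
  have hg := geomSum_le_quadratic hx
  have hs : 6 ≤ 1 / x := by rw [le_div_iff₀ hx]; linarith
  have hg' : geomSum x ≤ 1 / x + 0.5209 := by linarith
  have hm : 0 ≤ max 1.42 (Q - 11 / 12) := le_trans (by norm_num) (le_max_left _ _)
  have h1 := mul_le_mul_of_nonneg_right hg' hm
  set s := 1 / x
  rcases max_cases (1.42 : ℝ) (Q - 11 / 12) with ⟨h, h'⟩ | ⟨h, h'⟩ <;> rw [h] at h1 ⊢ <;> nlinarith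

/-- The scalar inequality for the case of an entry far below the exact eigenvalues. After
multiplication by `x` it is affine in `Q - 1` with coefficients that are polynomials in `x`. -/
theorem slow_decay_scalar_le_of_negative_entry {x Q : ℝ} (hx : 0 < x) (hx6 : x ≤ 1 / 6) (hQ : 1 ≤ Q) :
    1.2248 * geomSum x * (1 + Q)
        + (1 + 0.3522 * x) * (0.2042 * geomSum x * (Q - 1 + x / 2) + 1.41422)
      ≤ 1 / x + 1 / 4 + 1.618 * (1 / x + 1.3) * Q := by
  have hg := geomSum_le_quadratic hx
  have hg' : geomSum x ≤ (1 + 0.521 * x) / x := by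
    have : (1 + 0.521 * x) / x = 1 / x + 0.521 := by field_simp
    rw [this]; linarith
  set q := Q - 1 with hq
  have hq0 : 0 ≤ q := by linarith
  have hQq : Q = q + 1 := by rw [hq]; ring
  have h1 : 1.2248 * geomSum x * (1 + Q)
        + (1 + 0.3522 * x) * (0.2042 * geomSum x * (q + x / 2) + 1.41422)
      ≤ 1.2248 * ((1 + 0.521 * x) / x) * (1 + Q)
        + (1 + 0.3522 * x) * (0.2042 * ((1 + 0.521 * x) / x) * (q + x / 2) + 1.41422) := by
    gcongr
  refine h1.trans ?_
  rw [← sub_nonneg, hQq]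
  have e : 1 / x + 1 / 4 + 1.618 * (1 / x + 1.3) * (q + 1) -
      (1.2248 * ((1 + 0.521 * x) / x) * (1 + (q + 1))
        + (1 + 0.3522 * x) * (0.2042 * ((1 + 0.521 * x) / x) * (q + x / 2) + 1.41422))
      = (q * (1.618 * (1 + 1.3 * x) - 1.2248 * (1 + 0.521 * x)
          - 0.2042 * (1 + 0.3522 * x) * (1 + 0.521 * x))
        + (1 + x / 4 + 1.618 * (1 + 1.3 * x) - 2.4496 * (1 + 0.521 * x)
          - (1 + 0.3522 * x) * (0.1021 * x * (1 + 0.521 * x) + 1.41422 * x))) / x := by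
    field_simp
    ring
  rw [e]
  refine div_nonneg (add_nonneg (mul_nonneg hq0 ?_) ?_) hx.le
  · nlinarith
  · nlinarith [mul_nonneg hx.le hx.le, mul_nonneg hx.le (mul_nonneg hx.le hx.le)]

theorem norm_mul_diagonal_le {n : ℕ} (G : Matrix (Fin n) (Fin n) ℝ) {v : Fin n → ℝ} {m : ℝ}
    (hm : 0 ≤ m) (hv : ∀ j, |v j| ≤ m) : ‖G * diagonal v‖ ≤ ‖G‖ * m := by
  refine abs_le_of_sq_le_sq' ?_ (by positivity) |>.2
  rw [frob_sq, mul_pow, frob_sq, Finset.sum_mul]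
  refine Finset.sum_le_sum fun i _ => ?_
  rw [Finset.sum_mul]
  refine Finset.sum_le_sum fun j _ => ?_
  rw [mul_diagonal, mul_pow]
  exact mul_le_mul_of_nonneg_left (sq_le_sq' (by linarith [neg_abs_le (v j), hv j])
    ((le_abs_self _).trans (hv j))) (sq_nonneg _)

/-- The eigenvalue estimate when the tail decays slowly, `x < 1/6`. If all `zt j` are close to the
interval `[0, 1]`, the `√2`-bound for the ordered eigenvalues suffices. Otherwise some `zt j` is
far to the left of all `z i`, and `le_of_negative_entry` gives a better constant. -/
theorem abs_sub_le_of_slow_decay {n : ℕ} {zt z : Fin n → ℝ} (hzt : Antitone zt) (hz : Antitone z)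
    {T B G₀ G₁ : Matrix (Fin n) (Fin n) ℝ} (hT : IsUnit T.det) (hB : B * T = T * diagonal z)
    (hBG : diagonal zt - B = G₁ - G₀ * diagonal zt) {x t Q : ℝ} (hx : 0 < x) (hx6 : x ≤ 1 / 6)
    (hzw : ∀ i, Real.exp (-(x / 2)) ≤ z i) (hz1 : ∀ i, z i ≤ 1) (hQ : 1 ≤ Q)
    (hztQ : ∀ j, |zt j| ≤ Q) (ht : 0 ≤ t) (hG₀ : ‖G₀‖ ≤ t * geomSum x)
    (hR : ‖G₁ - Real.exp (-(x / 2)) • G₀‖ ≤ t) (k : Fin n) :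
    |zt k - z k| ≤ t * (1 / x + 1 / 4 + 1.618 * (1 / x + 1.3) * Q) := by
  set w := Real.exp (-(x / 2)) with hw
  have hw1 : 1 - x / 2 ≤ w := Real.one_sub_le_exp_neg _
  have hw2 : w ≤ 1 := Real.exp_le_one_iff.mpr (by linarith)
  have hg := geomSum_pos hx
  have hs2 := sqrt_two_lt
  have hs0 : 0 ≤ Real.sqrt 2 := Real.sqrt_nonneg _
  set R := G₁ - w • G₀ with hRdef
  have hBR : diagonal zt - B = R - G₀ * diagonal (fun i => zt i - w) := by
    have : diagonal (fun i => zt i - w) = diagonal zt - w • (1 : Matrix (Fin n) (Fin n) ℝ) := by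
      rw [smul_one_eq_diagonal, diagonal_sub]
    rw [hBG, this, hRdef, Matrix.mul_sub, Matrix.mul_smul, Matrix.mul_one]
    abel
  -- the last index, which carries the smallest entry
  have hn : 0 < n := k.pos
  let l : Fin n := ⟨n - 1, by omega⟩
  have hl : ∀ j, zt l ≤ zt j := fun j => hzt (Fin.le_def.mpr (by simp [l]; omega))
  set δ := w - zt l with hδ
  set u := max 0 (Q - w) with hu
  have hu0 : 0 ≤ u := le_max_left _ _
  have huj : ∀ j, zt j - w ≤ u := fun j =>
    le_trans (by linarith [le_abs_self (zt j), hztQ j]) (le_max_right _ _)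
  have hδj : ∀ j, w - zt j ≤ δ := fun j => by rw [hδ]; linarith [hl j]
  -- the plain `√2`-bound
  have plain : ∀ m : ℝ, 0 ≤ m → δ ≤ m → u ≤ m →
      |zt k - z k| ≤ t * (1.41422 * (1 + geomSum x * m)) := by
    intro m hm hδm hum
    have h1 := abs_eigenvalue_sub_le hzt hz hT hB k
    have h2 : ‖diagonal zt - B‖ ≤ t + t * geomSum x * m := by
      rw [hBR]
      refine (norm_sub_le _ _).trans (add_le_add hR ?_)
      refine (norm_mul_diagonal_le G₀ hm fun j => ?_).trans (mul_le_mul_of_nonneg_right hG₀ hm)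
      rw [abs_le]
      constructor <;> linarith [huj j, hδj j]
    have h3 : 0 ≤ t + t * geomSum x * m := by positivity
    calc |zt k - z k| ≤ Real.sqrt 2 * (t + t * geomSum x * m) :=
          h1.trans (mul_le_mul_of_nonneg_left h2 hs0)
      _ ≤ 1.41422 * (t + t * geomSum x * m) := mul_le_mul_of_nonneg_right hs2.le h3
      _ = _ := by ring
  by_cases hcase : u < δ ∧ 1.42 < δ
  · obtain ⟨huδ, hδ1⟩ := hcase
    have h1 := le_of_negative_entry hT hB (w := w) (fun i => hzw i) hBR (by linarith : 0 < δ)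
      ⟨l, rfl⟩ hδj hu0 huj huδ.le
    have h2 : δ ≤ t * (geomSum x * (1.2248 * δ + 0.2042 * u) + 1.41422) := by
      refine h1.trans ?_
      have : ‖G₀‖ * (1.2248 * δ + 0.2042 * u) ≤ t * geomSum x * (1.2248 * δ + 0.2042 * u) :=
        mul_le_mul_of_nonneg_right hG₀ (by linarith)
      have h3 : Real.sqrt 2 * ‖R‖ ≤ 1.41422 * t :=
        mul_le_mul hs2.le hR (norm_nonneg _) (by norm_num)
      linarith
    have hd : |zt k - z k| ≤ δ + (1 - w) := by
      rw [abs_le]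
      constructor <;> linarith [huj k, hδj k, hzw k, hz1 k]
    have hδQ : δ + (1 - w) ≤ 1 + Q := by
      have := (abs_le.mp (hztQ l)).1
      rw [hδ]; linarith
    -- `1 - w ≤ x / 2 ≤ (δ / 1.42) (x / 2)`
    have hδη : δ + (1 - w) ≤ δ * (1 + 0.3522 * x) := by nlinarith
    have huQ : u ≤ Q - 1 + x / 2 := max_le (by linarith) (by linarith)
    set S := geomSum x * (1.2248 * δ + 0.2042 * u) + 1.41422 with hS
    have hS0 : 0 < S := by positivity
    have hscalar := slow_decay_scalar_le_of_negative_entry hx hx6 hQ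
    set Y := 1 / x + 1 / 4 + 1.618 * (1 / x + 1.3) * Q
    have hbr : (δ + (1 - w)) * S ≤ δ * Y := by
      have e1 : (δ + (1 - w)) * (1.2248 * geomSum x * δ) ≤ (1 + Q) * (1.2248 * geomSum x * δ) :=
        mul_le_mul_of_nonneg_right hδQ (by positivity)
      have e2 : (δ + (1 - w)) * (0.2042 * geomSum x * u + 1.41422)
          ≤ δ * (1 + 0.3522 * x) * (0.2042 * geomSum x * (Q - 1 + x / 2) + 1.41422) := by
        apply mul_le_mul hδη _ (by positivity) (by positivity)
        gcongr
      have e3 := mul_le_mul_of_nonneg_left hscalar (by linarith : 0 ≤ δ)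
      calc (δ + (1 - w)) * S = (δ + (1 - w)) * (1.2248 * geomSum x * δ)
            + (δ + (1 - w)) * (0.2042 * geomSum x * u + 1.41422) := by rw [hS]; ring
        _ ≤ _ := by linarith
    -- `d S ≤ (δ + 1 - w) S ≤ δ Y ≤ t S Y`
    have h4 : |zt k - z k| * S ≤ t * Y * S := by
      have hY : 0 ≤ Y := by positivity
      calc |zt k - z k| * S ≤ (δ + (1 - w)) * S := mul_le_mul_of_nonneg_right hd hS0.le
        _ ≤ δ * Y := hbr
        _ ≤ t * S * Y := mul_le_mul_of_nonneg_right h2 hY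
        _ = t * Y * S := by ring
    exact le_of_mul_le_mul_right h4 hS0
  · refine (plain (max 1.42 (Q - 11 / 12)) (le_trans (by norm_num) (le_max_left _ _)) ?_ ?_).trans
      (mul_le_mul_of_nonneg_left (slow_decay_scalar_le hx hx6 hQ) ht)
    all_goals
      have hu' : u ≤ max 1.42 (Q - 11 / 12) := by
        refine max_le (le_trans (by norm_num) (le_max_left _ _)) (le_trans ?_ (le_max_right _ _))
        linarith
    · by_cases h : u < δ
      · exact (not_lt.mp fun h' => hcase ⟨h, h'⟩).trans (le_max_left _ _)
      · exact (not_lt.mp h).trans hu'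
    · exact hu'

/-- The square root of `1 - e^{-Lθ}`. The sum of the squares over one side of length `L` of a pencil
matrix falls short of the full geometric series by the factor `1 - e^{-Lθ}`. -/
noncomputable def windowFactor (θ : ℝ) (L : ℕ) : ℝ := Real.sqrt (1 - Real.exp (-(L * θ)))

/-- The eigenvalue estimate in normalized form. Here `B = D - G₁ + G₀ D` with `D = diag zt` has the
eigenvalues `z i ∈ [e^{-θ'/2}, 1]`, and the perturbations `G₀`, `G₁` come from two consecutive
windows of a signal with modes that decay at least as fast as `e^{-θ'/2}` per step. There are three
regimes: a window that is short compared with `1 / θ`, where its finite length matters; fast decay,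
where Kahan's inequality suffices; slow decay, which is `abs_sub_le_of_slow_decay`. -/
theorem abs_sub_lt_of_pencil {n : ℕ} {zt z : Fin n → ℝ} (hzt : Antitone zt) (hz : Antitone z)
    {T B G₀ G₁ : Matrix (Fin n) (Fin n) ℝ} (hT : IsUnit T.det) (hB : B * T = T * diagonal z)
    (hBG : diagonal zt - B = G₁ - G₀ * diagonal zt) {θ θ' t s Q : ℝ} {L : ℕ} (hθ : 0 < θ)
    (hθθ' : θ ≤ θ') (hL : 4 ≤ L)
    (hzw : ∀ i, Real.exp (-(θ' / 2)) ≤ z i) (hz1 : ∀ i, z i ≤ 1) (hQ : 2 ≤ n → 1 ≤ Q)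
    (hztQ : ∀ j, |zt j| ≤ Q) (ht : 0 ≤ t) (hts : t < s)
    (hG₀ : ‖G₀‖ ≤ t * geomSum θ') (hG₁ : ‖G₁‖ ≤ t * (Real.exp (-(θ' / 2)) * geomSum θ'))
    (hR : ‖G₁ - Real.exp (-(θ' / 2)) • G₀‖ ≤ t)
    (hG₀' : ‖G₀‖ ≤ t * (windowFactor θ L * geomSum θ))
    (hG₁' : ‖G₁‖ ≤ t * (windowFactor θ L * (Real.exp (-(θ / 2)) * geomSum θ))) (k : Fin n) :
    |zt k - z k| < s * ((1 + Real.sqrt 5) / 2 * bound₀ θ L * Q + bound₁ θ L) := by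
  have hQ0 : 0 ≤ Q := (abs_nonneg _).trans (hztQ k)
  have hθ'0 : 0 < θ' := hθ.trans_le hθθ'
  have hb₀ := one_add_inv_le_bound₀ hθ (by omega : 2 ≤ L)
  have hb₁ := exp_mul_geomSum_le_bound₁ hθ (by omega : 2 ≤ L)
  have hb₁0 : 0 < bound₁ θ L := (mul_pos (Real.exp_pos _) (geomSum_pos hθ)).trans_le hb₁
  have hb₀0 : 0 < bound₀ θ L := lt_of_lt_of_le (by positivity) hb₀
  suffices h : |zt k - z k| ≤ t * (1.618 * bound₀ θ L * Q + bound₁ θ L) by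
    have h1 : 1.618 * bound₀ θ L * Q ≤ (1 + Real.sqrt 5) / 2 * bound₀ θ L * Q := by
      have := golden_gt
      gcongr
    have h2 : 0 < 1.618 * bound₀ θ L * Q + bound₁ θ L := by positivity
    calc |zt k - z k| ≤ t * (1.618 * bound₀ θ L * Q + bound₁ θ L) := h
      _ < s * (1.618 * bound₀ θ L * Q + bound₁ θ L) := mul_lt_mul_of_pos_right hts h2
      _ ≤ _ := mul_le_mul_of_nonneg_left (by linarith) (ht.trans hts.le)
  have hF : ∀ a b : ℝ, ‖G₀‖ ≤ t * a → ‖G₁‖ ≤ t * b → ‖diagonal zt - B‖ ≤ t * (b + a * Q) := by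
    intro a b ha hb
    rw [hBG]
    refine (norm_sub_le _ _).trans ?_
    have := (norm_mul_diagonal_le G₀ hQ0 hztQ).trans (mul_le_mul_of_nonneg_right ha hQ0)
    linarith
  rcases Nat.lt_or_ge n 2 with hn | hn
  · obtain rfl : n = 1 := by have := k.pos; omega
    refine (abs_eigenvalue_sub_le_one hT hB k).trans ((hF _ _ hG₀ hG₁).trans ?_)
    refine mul_le_mul_of_nonneg_left ?_ ht
    have h1 := (exp_mul_geomSum_anti hθ hθθ').trans hb₁
    have h2 := ((geomSum_anti hθ hθθ').trans (geomSum_le_one_add hθ)).trans hb₀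
    have h3 := mul_le_mul_of_nonneg_right h2 hQ0
    have h4 : 0 ≤ bound₀ θ L * Q := by positivity
    linarith
  have hQ1 := hQ hn
  have hK := abs_eigenvalue_sub_le hzt hz hT hB k
  have hK' : ∀ a b : ℝ, ‖G₀‖ ≤ t * a → ‖G₁‖ ≤ t * b →
      |zt k - z k| ≤ t * (Real.sqrt 2 * (b + a * Q)) := by
    intro a b ha hb
    refine hK.trans ((mul_le_mul_of_nonneg_left (hF a b ha hb) (Real.sqrt_nonneg 2)).trans ?_)
    exact le_of_eq (by ring)
  rcases le_or_gt θ (1 / ((L : ℝ) - 1)) with hA | hA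
  · refine (hK' _ _ hG₀' hG₁').trans (mul_le_mul_of_nonneg_left ?_ ht)
    have h1 := short_window_le hθ hL hA hQ1
    have hL' : (4 : ℝ) ≤ L := by exact_mod_cast hL
    have h3 : θ ≤ 1 / 3 := hA.trans (one_div_le_one_div_of_le (by norm_num) (by linarith))
    have h4 := le_bound₁_of_le_inv hθ (by omega : 2 ≤ L) h3
    have h5 := mul_le_mul_of_nonneg_right hb₀ hQ0
    unfold windowFactor
    linarith
  rcases le_or_gt (1 / 6) θ' with hB' | hC
  · have hxθ : θ ≤ max θ (1 / 6) := le_max_left _ _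
    have hx6 : 1 / 6 ≤ max θ (1 / 6) := le_max_right _ _
    have hxθ' : max θ (1 / 6) ≤ θ' := max_le hθθ' hB'
    set x := max θ (1 / 6)
    have hx0 : 0 < x := by linarith
    have hinv : 1 / x ≤ 1 / θ := one_div_le_one_div_of_le hθ hxθ
    refine (hK' _ _ hG₀ hG₁).trans (mul_le_mul_of_nonneg_left ?_ ht)
    have h1 := fast_decay_le (Q := Q) (a := bound₀ θ L) hx6 hQ1 (by linarith) (fun hx4 => by
      have := le_bound₀_of_le (a := 1.27) hθ (by linarith) hA (by norm_num; linarith)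
      linarith)
    have h2 := (exp_mul_geomSum_anti hθ hxθ).trans hb₁
    have h3 : Real.sqrt 2 * (Real.exp (-(θ' / 2)) * geomSum θ' + geomSum θ' * Q) ≤
        Real.sqrt 2 * (Real.exp (-(x / 2)) * geomSum x + geomSum x * Q) := by
      have e1 := exp_mul_geomSum_anti hx0 hxθ'
      have e2 := geomSum_anti hx0 hxθ'
      gcongr
    linarith
  · refine (abs_sub_le_of_slow_decay hzt hz hT hB hBG hθ'0 hC.le hzw hz1 hQ1 hztQ ht hG₀ hR
      k).trans (mul_le_mul_of_nonneg_left ?_ ht)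
    have hinv : 1 / θ' ≤ 1 / θ := one_div_le_one_div_of_le hθ hθθ'
    have h1 := le_bound₀_of_le (a := 1.3) hθ (by linarith) hA (by norm_num; linarith)
    have h2 := add_le_bound₁ hθ (by linarith) (by omega : 2 ≤ L) hA
    have h3 : 1 / θ' + 1.3 ≤ bound₀ θ L := by linarith
    have h4 := mul_le_mul_of_nonneg_right h3 hQ0
    linarith

/-! ### Pencil matrices of rapidly decaying signals -/

theorem frob_le_of_hasSum {m n : ℕ} {A : ℕ → Matrix (Fin m) (Fin n) ℝ}
    {E : Matrix (Fin m) (Fin n) ℝ} (h : ∀ i j, HasSum (fun l => A l i j) (E i j)) {K : ℝ}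
    (hK : ∀ s : Finset ℕ, ∑ l ∈ s, ‖A l‖ ≤ K) : ‖E‖ ≤ K := by
  have hK0 : 0 ≤ K := by simpa using hK ∅
  refine abs_le_of_sq_le_sq' ?_ hK0 |>.2
  rw [frob_sq]
  have ht : Filter.Tendsto (fun s : Finset ℕ => ∑ i, ∑ j, (∑ l ∈ s, A l i j) ^ 2) Filter.atTop
      (nhds (∑ i, ∑ j, E i j ^ 2)) :=
    tendsto_finsetSum _ fun i _ => tendsto_finsetSum _ fun j _ => (h i j).pow 2
  refine le_of_tendsto ht (Filter.Eventually.of_forall fun s => ?_)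
  have h1 : ∑ i, ∑ j, (∑ l ∈ s, A l i j) ^ 2 = ‖∑ l ∈ s, A l‖ ^ 2 := by
    rw [frob_sq]
    simp only [Matrix.sum_apply]
  rw [h1]
  exact pow_le_pow_left₀ (norm_nonneg _) ((norm_sum_le _ _).trans (hK s)) 2

theorem pencilMatrix_pow_succ (ω : ℝ) (N L : ℕ) :
    pencilMatrix (fun i => ω ^ i) N L 1 = ω • pencilMatrix (fun i => ω ^ i) N L 0 := by
  ext r k
  simp only [pencilMatrix, Matrix.of_apply, Matrix.smul_apply, smul_eq_mul]
  rw [← pow_succ']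
  congr 1
  omega

/-- The pencil matrix of a pure power has rank one, and its Frobenius norm factors. -/
theorem frob_sq_pencilMatrix_pow (ω : ℝ) (N L : ℕ) :
    ‖pencilMatrix (fun i => ω ^ i) N L 0‖ ^ 2
      = (∑ i ∈ Finset.range (N - L), (ω ^ 2) ^ i) * ∑ i ∈ Finset.range L, (ω ^ 2) ^ i := by
  rw [frob_sq, ← Finset.sum_range_reflect (fun i => (ω ^ 2) ^ i) L, Finset.sum_range,
    Finset.sum_range, Finset.sum_mul_sum]
  refine Finset.sum_congr rfl fun r _ => Finset.sum_congr rfl fun k _ => ?_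
  simp only [pencilMatrix, Matrix.of_apply]
  ring

theorem geom_sum_le_inv {q : ℝ} (h0 : 0 ≤ q) (h1 : q < 1) (n : ℕ) :
    ∑ i ∈ Finset.range n, q ^ i ≤ (1 - q)⁻¹ := by
  rw [← tsum_geometric_of_lt_one h0 h1]
  exact (summable_geometric_of_lt_one h0 h1).sum_le_tsum _ fun i _ => pow_nonneg h0 i

theorem frob_pencilMatrix_pow_le_inv {ω : ℝ} (h0 : 0 ≤ ω) (h1 : ω < 1) (N L : ℕ) :
    ‖pencilMatrix (fun i => ω ^ i) N L 0‖ ≤ (1 - ω ^ 2)⁻¹ := by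
  have hq : ω ^ 2 < 1 := pow_lt_one₀ h0 h1 two_ne_zero
  have hi : 0 ≤ (1 - ω ^ 2)⁻¹ := inv_nonneg.mpr (by linarith)
  refine abs_le_of_sq_le_sq' ?_ hi |>.2
  rw [frob_sq_pencilMatrix_pow, sq (1 - ω ^ 2)⁻¹]
  exact mul_le_mul (geom_sum_le_inv (sq_nonneg _) hq _) (geom_sum_le_inv (sq_nonneg _) hq _)
    (Finset.sum_nonneg fun i _ => pow_nonneg (sq_nonneg _) i) hi

theorem exp_neg_half_sq (x : ℝ) : Real.exp (-(x / 2)) ^ 2 = Real.exp (-x) := by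
  rw [sq, ← Real.exp_add]; congr 1; ring

theorem frob_pencilMatrix_pow_le_geomSum {ω x : ℝ} (hx : 0 < x) (h0 : 0 ≤ ω)
    (h1 : ω ≤ Real.exp (-(x / 2))) (N L : ℕ) :
    ‖pencilMatrix (fun i => ω ^ i) N L 0‖ ≤ geomSum x := by
  have hlt : ω < 1 := h1.trans_lt (Real.exp_lt_one_iff.mpr (by linarith))
  refine (frob_pencilMatrix_pow_le_inv h0 hlt N L).trans ?_
  refine inv_anti₀ (one_sub_exp_neg_pos hx) ?_
  have := pow_le_pow_left₀ h0 h1 2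
  rw [exp_neg_half_sq] at this
  linarith

theorem frob_pencilMatrix_pow_le_window {ω x : ℝ} (hx : 0 < x) (h0 : 0 ≤ ω)
    (h1 : ω ≤ Real.exp (-(x / 2))) (N L : ℕ) :
    ‖pencilMatrix (fun i => ω ^ i) N L 0‖ ≤ windowFactor x L * geomSum x := by
  have hq := pow_le_pow_left₀ h0 h1 2
  rw [exp_neg_half_sq] at hq
  have hp := one_sub_exp_neg_pos hx
  have hg := geomSum_pos hx
  have he : Real.exp (-(L * x)) ≤ 1 := Real.exp_le_one_iff.mpr (by
    have : 0 ≤ L * x := by positivity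
    linarith)
  have hw : 0 ≤ windowFactor x L * geomSum x := mul_nonneg (Real.sqrt_nonneg _) hg.le
  refine abs_le_of_sq_le_sq' ?_ hw |>.2
  rw [frob_sq_pencilMatrix_pow, mul_pow, windowFactor, Real.sq_sqrt (by linarith)]
  have hS : ∀ n : ℕ, ∑ i ∈ Finset.range n, (ω ^ 2) ^ i ≤ ∑ i ∈ Finset.range n,
      Real.exp (-x) ^ i := fun n =>
    Finset.sum_le_sum fun i _ => pow_le_pow_left₀ (sq_nonneg _) hq i
  have hA := (hS (N - L)).trans (geom_sum_le_inv (Real.exp_pos _).le (by linarith) _)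
  have hB : ∑ i ∈ Finset.range L, (ω ^ 2) ^ i ≤ (1 - Real.exp (-(L * x))) * geomSum x := by
    refine (hS L).trans (le_of_eq ?_)
    rw [geom_sum_eq (by linarith), ← Real.exp_nat_mul, geomSum, ← neg_div_neg_eq, div_eq_mul_inv]
    congr 2
    · rw [mul_neg]; ring
    · ring
  calc _ ≤ geomSum x * ((1 - Real.exp (-(L * x))) * geomSum x) :=
        mul_le_mul hA hB (Finset.sum_nonneg fun i _ => pow_nonneg (sq_nonneg _) i) hg.le
    _ = _ := by ring

/-- The combination `E₁ - w E₀` does not grow as the decay gets slow: the factor `w - ω` compensates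
the geometric sum. -/
theorem abs_sub_mul_frob_pencilMatrix_pow_le {ω w : ℝ} (h0 : 0 ≤ ω) (h1 : ω ≤ w) (hw : w < 1)
    (N L : ℕ) : |ω - w| * ‖pencilMatrix (fun i => ω ^ i) N L 0‖ ≤ 1 := by
  have hlt := h1.trans_lt hw
  have hq : ω ^ 2 < 1 := pow_lt_one₀ h0 hlt two_ne_zero
  refine (mul_le_mul_of_nonneg_left (frob_pencilMatrix_pow_le_inv h0 hlt N L)
    (abs_nonneg _)).trans ?_
  rw [← div_eq_mul_inv, div_le_one (by linarith), abs_of_nonpos (by linarith)]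
  nlinarith

/-- The signal `∑_j a_j ω_jⁱ`. -/
noncomputable def expSum (a ω : ℕ → ℝ) (i : ℕ) : ℝ := ∑' j, a j * ω j ^ i

/-- The norm of a superposition of pencil matrices of pure powers is controlled mode by mode. -/
theorem frob_expSum_le {a ω : ℕ → ℝ} {t b : ℝ} (ha : ∀ s : Finset ℕ, ∑ j ∈ s, |a j| ≤ t)
    {N L : ℕ} {E : Matrix (Fin (N - L)) (Fin L) ℝ} {μ : ℕ → ℝ}
    (hE : ∀ r k, HasSum (fun j => a j * (μ j * pencilMatrix (fun i => ω j ^ i) N L 0 r k)) (E r k))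
    (hb0 : 0 ≤ b) (hb : ∀ j, |μ j| * ‖pencilMatrix (fun i => ω j ^ i) N L 0‖ ≤ b) :
    ‖E‖ ≤ t * b := by
  refine frob_le_of_hasSum (A := fun j => (a j * μ j) • pencilMatrix (fun i => ω j ^ i) N L 0)
    (fun r k => ?_) fun s => ?_
  · simpa [mul_assoc] using hE r k
  · refine le_trans ?_ (mul_le_mul_of_nonneg_right (ha s) hb0)
    rw [Finset.sum_mul]
    refine Finset.sum_le_sum fun j _ => ?_
    rw [norm_smul, Real.norm_eq_abs, abs_mul, mul_assoc]
    exact mul_le_mul_of_nonneg_left (hb j) (abs_nonneg _)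

theorem hasSum_expSum {a ω : ℕ → ℝ} {t : ℝ} (ha : ∀ s : Finset ℕ, ∑ j ∈ s, |a j| ≤ t)
    (h0 : ∀ j, 0 ≤ ω j) (h1 : ∀ j, ω j ≤ 1) (i : ℕ) :
    HasSum (fun j => a j * ω j ^ i) (expSum a ω i) := by
  refine Summable.hasSum (Summable.of_norm_bounded
    (summable_of_sum_le (fun j => abs_nonneg (a j)) ha) fun j => ?_)
  rw [Real.norm_eq_abs, abs_mul, abs_of_nonneg (pow_nonneg (h0 j) i)]
  exact mul_le_of_le_one_right (abs_nonneg _) (pow_le_one₀ (h0 j) (h1 j))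

/-- The bounds for two consecutive pencil matrices `E₀`, `E₁` (with `L` columns) of a signal whose
modes have amplitudes with sum at most `t` and ratios at most `e^{-θ'/2}`. The last two use the
finite length of the window and only the weaker rate `θ ≤ θ'`. -/
structure PencilBounds {m n : ℕ} (E₀ E₁ : Matrix (Fin m) (Fin n) ℝ) (θ θ' t : ℝ) (L : ℕ) :
    Prop where
  zero : ‖E₀‖ ≤ t * geomSum θ'
  one : ‖E₁‖ ≤ t * (Real.exp (-(θ' / 2)) * geomSum θ')
  sub : ‖E₁ - Real.exp (-(θ' / 2)) • E₀‖ ≤ t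
  zero_window : ‖E₀‖ ≤ t * (windowFactor θ L * geomSum θ)
  one_window : ‖E₁‖ ≤ t * (windowFactor θ L * (Real.exp (-(θ / 2)) * geomSum θ))

theorem pencilBounds_expSum {a ω : ℕ → ℝ} {t θ θ' : ℝ}
    (ha : ∀ s : Finset ℕ, ∑ j ∈ s, |a j| ≤ t) (hθ : 0 < θ) (hθθ' : θ ≤ θ')
    (h0 : ∀ j, 0 ≤ ω j) (h1 : ∀ j, ω j ≤ Real.exp (-(θ' / 2))) (N L : ℕ) :
    PencilBounds (pencilMatrix (expSum a ω) N L 0) (pencilMatrix (expSum a ω) N L 1) θ θ' t L := by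
  have hθ' : 0 < θ' := hθ.trans_le hθθ'
  have hw : Real.exp (-(θ' / 2)) < 1 := Real.exp_lt_one_iff.mpr (by linarith)
  have hle : ∀ j, ω j ≤ Real.exp (-(θ / 2)) := fun j =>
    (h1 j).trans (Real.exp_le_exp.mpr (by linarith))
  have hS := hasSum_expSum ha h0 fun j => (h1 j).trans hw.le
  have hE₀ : ∀ r k, HasSum (fun j => a j * (1 * pencilMatrix (fun i => ω j ^ i) N L 0 r k))
      (pencilMatrix (expSum a ω) N L 0 r k) := fun r k => by
    simp only [one_mul, pencilMatrix, Matrix.of_apply]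
    exact hS _
  have hE₁ : ∀ r k, HasSum (fun j => a j * (ω j * pencilMatrix (fun i => ω j ^ i) N L 0 r k))
      (pencilMatrix (expSum a ω) N L 1 r k) := fun r k => by
    have h : ∀ j, ω j * pencilMatrix (fun i => ω j ^ i) N L 0 r k
        = ω j ^ ((L - 1 - (k : ℕ) + 1) + (r : ℕ)) := fun j => by
      have := congrFun (congrFun (pencilMatrix_pow_succ (ω j) N L) r) k
      rw [Matrix.smul_apply, smul_eq_mul] at this
      exact this.symm
    simp only [h]
    exact hS _
  have hE : ∀ r k, HasSum (fun j => a j * ((ω j - Real.exp (-(θ' / 2))) *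
      pencilMatrix (fun i => ω j ^ i) N L 0 r k))
      ((pencilMatrix (expSum a ω) N L 1 -
        Real.exp (-(θ' / 2)) • pencilMatrix (expSum a ω) N L 0) r k) := fun r k => by
    rw [Matrix.sub_apply, Matrix.smul_apply, smul_eq_mul]
    have h : ∀ j, a j * ((ω j - Real.exp (-(θ' / 2))) *
        pencilMatrix (fun i => ω j ^ i) N L 0 r k)
        = a j * (ω j * pencilMatrix (fun i => ω j ^ i) N L 0 r k) - Real.exp (-(θ' / 2)) *
          (a j * (1 * pencilMatrix (fun i => ω j ^ i) N L 0 r k)) := fun j => by ring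
    simp only [h]
    exact (hE₁ r k).sub ((hE₀ r k).mul_left (Real.exp (-(θ' / 2))))
  have hg := geomSum_pos hθ
  have hg' := geomSum_pos hθ'
  have hwin : 0 ≤ windowFactor θ L := Real.sqrt_nonneg _
  refine ⟨frob_expSum_le ha hE₀ hg'.le fun j => ?_, frob_expSum_le ha hE₁ (by positivity)
    fun j => ?_, ?_, frob_expSum_le ha hE₀ (by positivity) fun j => ?_,
    frob_expSum_le ha hE₁ (by positivity) fun j => ?_⟩
  · rw [abs_one, one_mul]
    exact frob_pencilMatrix_pow_le_geomSum hθ' (h0 j) (h1 j) N L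
  · rw [abs_of_nonneg (h0 j)]
    exact mul_le_mul (h1 j) (frob_pencilMatrix_pow_le_geomSum hθ' (h0 j) (h1 j) N L)
      (norm_nonneg _) (Real.exp_pos _).le
  · rw [← mul_one t]
    exact frob_expSum_le ha hE zero_le_one fun j =>
      abs_sub_mul_frob_pencilMatrix_pow_le (h0 j) (h1 j) hw N L
  · rw [abs_one, one_mul]
    exact frob_pencilMatrix_pow_le_window hθ (h0 j) (hle j) N L
  · rw [abs_of_nonneg (h0 j), mul_left_comm]
    exact mul_le_mul (hle j) (frob_pencilMatrix_pow_le_window hθ (h0 j) (hle j) N L)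
      (norm_nonneg _) (Real.exp_pos _).le

/-! ### The tail of the heat observation -/

theorem integral_cos_int_mul_pi {k : ℤ} (hk : k ≠ 0) :
    ∫ x in (0 : ℝ)..1, Real.cos (k * Real.pi * x) = 0 := by
  have hc : (k : ℝ) * Real.pi ≠ 0 := mul_ne_zero (by exact_mod_cast hk) Real.pi_ne_zero
  rw [intervalIntegral.integral_comp_mul_left (fun x => Real.cos x) hc, integral_cos]
  simp [Real.sin_int_mul_pi]

theorem integral_cos_mul_cos {m n : ℕ} (hm : m ≠ 0) :
    ∫ x in (0 : ℝ)..1, Real.cos (m * Real.pi * x) * Real.cos (n * Real.pi * x)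
      = if m = n then 1 / 2 else 0 := by
  have h1 : ∀ x : ℝ, Real.cos (m * Real.pi * x) * Real.cos (n * Real.pi * x)
      = 1 / 2 * Real.cos (((m - n : ℤ) : ℝ) * Real.pi * x)
        + 1 / 2 * Real.cos (((m + n : ℤ) : ℝ) * Real.pi * x) := fun x => by
    push_cast
    rw [sub_mul, sub_mul, add_mul, add_mul, Real.cos_sub, Real.cos_add]
    ring
  simp only [h1]
  rw [intervalIntegral.integral_add (by apply Continuous.intervalIntegrable; fun_prop)
    (by apply Continuous.intervalIntegrable; fun_prop), intervalIntegral.integral_const_mul,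
    intervalIntegral.integral_const_mul, integral_cos_int_mul_pi (by omega : (m + n : ℤ) ≠ 0)]
  split_ifs with h
  · subst h
    simp
  · rw [integral_cos_int_mul_pi (by omega : (m - n : ℤ) ≠ 0)]
    simp

/-- Bessel's inequality for the functions `√2 cos(nπx)`, `n ≥ 1`. -/
theorem sum_coeff_sq_le {u₀ : ℝ → ℝ} {M₀ : ℝ} (hM₀ : 0 < M₀)
    (hu₀ : MemLp u₀ 2 (volume.restrict (Set.Ioo (0 : ℝ) 1)))
    (hu₀M₀ : eLpNorm u₀ 2 (volume.restrict (Set.Ioo (0 : ℝ) 1)) ≤ ENNReal.ofReal M₀)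
    {S : Finset ℕ} (hS : 0 ∉ S) : ∑ n ∈ S, coeff u₀ n ^ 2 ≤ 2 * M₀ ^ 2 := by
  set μ := volume.restrict (Set.Ioo (0 : ℝ) 1) with hμ
  have hmem : ∀ n : ℕ, MemLp (fun x : ℝ => Real.sqrt 2 * Real.cos (n * Real.pi * x)) 2 μ := fun n => by
    refine MemLp.of_bound (Continuous.aestronglyMeasurable (by fun_prop)) (Real.sqrt 2)
      (Filter.Eventually.of_forall fun x => ?_)
    rw [norm_mul, Real.norm_of_nonneg (Real.sqrt_nonneg 2)]
    exact mul_le_of_le_one_right (Real.sqrt_nonneg _) (Real.abs_cos_le_one _)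
  let v : {n : ℕ // n ≠ 0} → Lp ℝ 2 μ := fun n => (hmem n).toLp _
  have hint : ∀ f : ℝ → ℝ, ∫ x, f x ∂μ = ∫ x in (0 : ℝ)..1, f x := fun f => by
    rw [intervalIntegral.integral_of_le zero_le_one, integral_Ioc_eq_integral_Ioo]
  have hv : Orthonormal ℝ v := by
    rw [orthonormal_iff_ite]
    intro m n
    rw [L2.inner_def]
    have h1 : ∫ x, inner ℝ (v m x) (v n x) ∂μ
        = ∫ x, 2 * (Real.cos ((m : ℕ) * Real.pi * x) * Real.cos ((n : ℕ) * Real.pi * x)) ∂μ := by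
      refine integral_congr_ae ?_
      filter_upwards [(hmem m).coeFn_toLp, (hmem n).coeFn_toLp] with x hx hy
      simp only [v, hx, hy, RCLike.inner_apply, conj_trivial]
      have := Real.mul_self_sqrt (by norm_num : (0 : ℝ) ≤ 2)
      linear_combination (Real.cos ((m : ℕ) * Real.pi * x) * Real.cos ((n : ℕ) * Real.pi * x)) * this
    rw [h1, hint, intervalIntegral.integral_const_mul, integral_cos_mul_cos m.2]
    by_cases h : m = n
    · simp [h]
    · simp [h, Subtype.coe_injective.ne h]
  let u : Lp ℝ 2 μ := hu₀.toLp u₀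
  have hu : ‖u‖ ≤ M₀ := by
    rw [Lp.norm_toLp]
    exact ENNReal.toReal_le_of_le_ofReal hM₀.le hu₀M₀
  have hcoeff : ∀ n : {n : ℕ // n ≠ 0}, coeff u₀ n ^ 2 = 2 * ‖inner ℝ (v n) u‖ ^ 2 := fun n => by
    have h1 : inner ℝ (v n) u = Real.sqrt 2 * ∫ x in (0 : ℝ)..1, u₀ x * Real.cos ((n : ℕ) * Real.pi * x) := by
      rw [L2.inner_def, ← hint, ← integral_const_mul]
      refine integral_congr_ae ?_
      filter_upwards [(hmem n).coeFn_toLp, hu₀.coeFn_toLp] with x hx hy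
      simp only [v, u, hx, hy, RCLike.inner_apply, conj_trivial]
      ring
    rw [h1, coeff, if_neg n.2, Real.norm_eq_abs, sq_abs, mul_pow, mul_pow,
      Real.sq_sqrt (by norm_num)]
    ring
  have hB := hv.sum_inner_products_le u (s := S.subtype (fun n => n ≠ 0))
  have hsum : ∑ n ∈ S, coeff u₀ n ^ 2
      = ∑ n ∈ S.subtype (fun n => n ≠ 0), coeff u₀ n ^ 2 := by
    rw [Finset.sum_subtype_eq_sum_filter (f := fun n => coeff u₀ n ^ 2), Finset.filter_true_of_mem]
    intro n hn h
    exact hS (h ▸ hn)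
  rw [hsum, Finset.sum_congr rfl fun n _ => hcoeff n, ← Finset.mul_sum]
  have := pow_le_pow_left₀ (norm_nonneg u) hu 2
  linarith

theorem sum_exp_sq_le {τ : ℝ} (hτ : 0 < τ) {M m : ℕ} (hM : 1 ≤ M) (hm : M ≤ m) (S : Finset ℕ) :
    ∑ j ∈ S, Real.exp (-(τ * ((m + j : ℕ) : ℝ) ^ 2)) ^ 2
      ≤ Real.exp (-(τ * (M : ℝ) ^ 2)) ^ 2 * (1 + 1 / (4 * M * τ)) := by
  have hM' : (1 : ℝ) ≤ M := by exact_mod_cast hM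
  have hm' : (M : ℝ) ≤ m := by exact_mod_cast hm
  have hx : 0 < 4 * M * τ := by positivity
  have h1 : ∀ j : ℕ, Real.exp (-(τ * ((m + j : ℕ) : ℝ) ^ 2)) ^ 2
      ≤ Real.exp (-(τ * (M : ℝ) ^ 2)) ^ 2 * Real.exp (-(4 * M * τ)) ^ j := fun j => by
    rw [← Real.exp_nat_mul, ← Real.exp_nat_mul, ← Real.exp_nat_mul, ← Real.exp_add]
    apply Real.exp_le_exp.mpr
    push_cast
    have h2 : (M : ℝ) ^ 2 + 2 * M * j ≤ (m + j) ^ 2 := by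
      have hj : (0 : ℝ) ≤ j := Nat.cast_nonneg j
      nlinarith [mul_nonneg (sub_nonneg.mpr hm') hj, sq_nonneg (j : ℝ)]
    nlinarith
  have hq1 : Real.exp (-(4 * M * τ)) < 1 := Real.exp_lt_one_iff.mpr (by linarith)
  refine (Finset.sum_le_sum fun j _ => h1 j).trans ?_
  rw [← Finset.mul_sum]
  refine mul_le_mul_of_nonneg_left ?_ (sq_nonneg _)
  refine le_trans ?_ (geomSum_le_one_add hx)
  rw [geomSum, ← tsum_geometric_of_lt_one (Real.exp_pos _).le hq1]
  exact (summable_geometric_of_lt_one (Real.exp_pos _).le hq1).sum_le_tsum _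
    fun i _ => pow_nonneg (Real.exp_pos _).le i

/-- The amplitudes at time `T₁` of the modes with index at least `m ≥ M` have a sum strictly below
`tailConst`, by Cauchy–Schwarz and Bessel's inequality. Strictness comes from
`√2 √(1 + v) < √2 + v` with `v = 1 / (4 M τ)`, `τ = α₀ π² T₁`. -/
theorem exists_tail_sum_lt {α α₀ M₀ T₁ : ℝ} {u₀ : ℝ → ℝ} (hα₀ : 0 < α₀) (hα : α₀ ≤ α)
    (hM₀ : 0 < M₀) (hu₀ : MemLp u₀ 2 (volume.restrict (Set.Ioo (0 : ℝ) 1)))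
    (hu₀M₀ : eLpNorm u₀ 2 (volume.restrict (Set.Ioo (0 : ℝ) 1)) ≤ ENNReal.ofReal M₀)
    (hT₁ : 0 < T₁) {M m : ℕ} (hM : 1 ≤ M) (hm : M ≤ m) :
    ∃ t < tailConst α₀ M₀ T₁ M, 0 ≤ t ∧ ∀ S : Finset ℕ,
      ∑ j ∈ S, |coeff u₀ (m + j) * Real.exp (-(eigval α (m + j) * T₁))| ≤ t := by
  have hM' : (1 : ℝ) ≤ M := by exact_mod_cast hM
  set τ := α₀ * Real.pi ^ 2 * T₁ with hτ
  have hτ0 : 0 < τ := by positivity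
  set v := 1 / (4 * M * τ) with hv
  have hv0 : 0 < v := by positivity
  set K := Real.exp (-(τ * (M : ℝ) ^ 2)) with hK
  have hK0 : 0 < K := Real.exp_pos _
  refine ⟨Real.sqrt (2 * (1 + v)) * M₀ * K, ?_, by positivity, fun S => ?_⟩
  · have h1 : Real.sqrt (2 * (1 + v)) < Real.sqrt 2 + v := by
      rw [Real.sqrt_lt' (by positivity)]
      have h2 := Real.sq_sqrt (by norm_num : (0 : ℝ) ≤ 2)
      have h3 : 1 ≤ Real.sqrt 2 := Real.one_le_sqrt.mpr (by norm_num)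
      nlinarith
    have h4 : tailConst α₀ M₀ T₁ M = (Real.sqrt 2 + v) * M₀ * K := by
      rw [tailConst, hv, hK, hτ]
      congr 3
      · ring
      · ring
    rw [h4]
    gcongr
  · have h1 : ∀ j : ℕ, |coeff u₀ (m + j) * Real.exp (-(eigval α (m + j) * T₁))|
        ≤ |coeff u₀ (m + j)| * Real.exp (-(τ * ((m + j : ℕ) : ℝ) ^ 2)) := fun j => by
      rw [abs_mul, Real.abs_exp]
      refine mul_le_mul_of_nonneg_left (Real.exp_le_exp.mpr ?_) (abs_nonneg _)
      rw [eigval, hτ]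
      have : α₀ * (((m + j : ℕ) : ℝ) ^ 2 * Real.pi ^ 2 * T₁)
          ≤ α * (((m + j : ℕ) : ℝ) ^ 2 * Real.pi ^ 2 * T₁) :=
        mul_le_mul_of_nonneg_right hα (by positivity)
      linarith
    refine (Finset.sum_le_sum fun j _ => h1 j).trans ?_
    refine abs_le_of_sq_le_sq' ?_ (by positivity) |>.2
    refine (Finset.sum_mul_sq_le_sq_mul_sq S _ _).trans ?_
    have h2 : ∑ j ∈ S, |coeff u₀ (m + j)| ^ 2 ≤ 2 * M₀ ^ 2 := by
      have h3 := sum_coeff_sq_le hM₀ hu₀ hu₀M₀ (S := S.map (addLeftEmbedding m)) (by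
        simp; omega)
      rw [Finset.sum_map] at h3
      simpa [sq_abs] using h3
    have h4 := sum_exp_sq_le hτ0 hM hm S
    calc _ ≤ (2 * M₀ ^ 2) * (K ^ 2 * (1 + v)) :=
          mul_le_mul h2 h4 (Finset.sum_nonneg fun _ _ => sq_nonneg _) (by positivity)
      _ = _ := by
          rw [mul_pow, mul_pow, Real.sq_sqrt (by positivity)]
          ring

theorem lt_card_of_le_encard {p : ℕ → Prop} {M k : ℕ} (h : (M : ℕ∞) ≤ {n : ℕ | p n}.encard)
    (hk : k < M) (hf : (Set.ofPred p).Finite) : k < hf.toFinset.card := by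
  have h1 : (M : ℕ∞) ≤ (hf.toFinset.card : ℕ∞) := by
    rw [← Set.encard_coe_eq_coe_finsetCard, hf.coe_toFinset]
    exact h
  exact hk.trans_le (by exact_mod_cast h1)

/-- The first `M` indices with `p` exhaust the indices with `p` up to the `M`-th of them. -/
theorem sum_range_nth {p : ℕ → Prop} {M : ℕ} (hM : 1 ≤ M)
    (h : (M : ℕ∞) ≤ {n : ℕ | p n}.encard) {f : ℕ → ℝ} (hf : ∀ n, ¬ p n → f n = 0) :
    ∑ n ∈ Finset.range (Nat.nth p (M - 1) + 1), f n = ∑ k ∈ Finset.range M, f (Nat.nth p k) := by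
  classical
  have hlt : ∀ i j, i < j → j < M → Nat.nth p i < Nat.nth p j := fun i j hij hj =>
    Nat.nth_lt_nth' hij fun hfin => lt_card_of_le_encard h hj hfin
  have hinj : Set.InjOn (Nat.nth p) (Finset.range M) := by
    intro i hi j hj hij
    simp only [Finset.coe_range, Set.mem_Iio] at hi hj
    rcases lt_trichotomy i j with hl | hl | hl
    · exact absurd hij (hlt i j hl hj).ne
    · exact hl
    · exact absurd hij (hlt j i hl hi).ne'
  rw [← Finset.sum_image (f := f) hinj]
  symm
  refine Finset.sum_subset (fun n hn => ?_) fun n hn hn' => hf n fun hp => hn' ?_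
  · obtain ⟨k, hk, rfl⟩ := Finset.mem_image.mp hn
    rw [Finset.mem_range] at hk ⊢
    refine Nat.lt_succ_of_le (Nat.nth_le_nth' (by omega) fun hfin =>
      lt_card_of_le_encard h (by omega) hfin)
  · refine Finset.mem_image.mpr ⟨Nat.count p n, Finset.mem_range.mpr ?_, Nat.nth_count hp⟩
    have h1 : Nat.count p n ≤ M - 1 :=
      Nat.le_nth_of_count_le (Nat.lt_succ_iff.mp (Finset.mem_range.mp hn))
    omega

/-- The ratio `e^{-λ_n T}` of the `n`-th mode between two samples with distance `T`. -/
noncomputable def modeRatio (α T : ℝ) (n : ℕ) : ℝ := Real.exp (-(eigval α n * T))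

theorem modeRatio_anti {α T : ℝ} (hα : 0 ≤ α) (hT : 0 ≤ T) {m n : ℕ} (h : m ≤ n) :
    modeRatio α T n ≤ modeRatio α T m := by
  refine Real.exp_le_exp.mpr (neg_le_neg (mul_le_mul_of_nonneg_right ?_ hT))
  unfold eigval
  gcongr

theorem modeRatio_strictAnti {α T : ℝ} (hα : 0 < α) (hT : 0 < T) {m n : ℕ} (h : m < n) :
    modeRatio α T n < modeRatio α T m := by
  refine Real.exp_lt_exp.mpr (neg_lt_neg (mul_lt_mul_of_pos_right ?_ hT))
  have h' : (m : ℝ) < n := by exact_mod_cast h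
  have := Real.pi_pos
  unfold eigval
  gcongr

theorem exp_eigval_sample (α T₁ Ts : ℝ) (n i : ℕ) :
    Real.exp (-(eigval α n * (T₁ + Ts * i)))
      = Real.exp (-(eigval α n * T₁)) * modeRatio α Ts n ^ i := by
  rw [modeRatio, ← Real.exp_nat_mul, ← Real.exp_add]
  congr 1
  ring

/-- The error `y - x` of the observation is a superposition of decaying modes that start with the
index `m = n_{M-1} + 1 ≥ M`. The rate `θ' = 2 λ_m Ts` separates the ratios of these modes from those
of the exact signal. -/
theorem exists_pencilBounds_obs {α α₀ M₀ T₁ Ts θ : ℝ} {u₀ : ℝ → ℝ} (hα₀ : 0 < α₀) (hα : α₀ ≤ α)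
    (hM₀ : 0 < M₀) (hu₀ : MemLp u₀ 2 (volume.restrict (Set.Ioo (0 : ℝ) 1)))
    (hu₀M₀ : eLpNorm u₀ 2 (volume.restrict (Set.Ioo (0 : ℝ) 1)) ≤ ENNReal.ofReal M₀)
    (hT₁ : 0 < T₁) (hTs : 0 < Ts) {M : ℕ} (hM : 1 ≤ M)
    (hcoeff : (M : ℕ∞) ≤ {n : ℕ | coeff u₀ n ≠ 0}.encard)
    (hθ : θ = 2 * α₀ * (M : ℝ) ^ 2 * Real.pi ^ 2 * Ts) (N L : ℕ) :
    ∃ θ' t : ℝ, θ ≤ θ' ∧ 0 ≤ t ∧ t < tailConst α₀ M₀ T₁ M ∧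
      (∀ k < M, Real.exp (-(θ' / 2)) ≤ modeRatio α Ts (modeIndex u₀ k)) ∧
      PencilBounds
        (pencilMatrix (fun i => obs α u₀ (T₁ + Ts * i)) N L 0
          - pencilMatrix (fun i => signal α u₀ M (T₁ + Ts * i)) N L 0)
        (pencilMatrix (fun i => obs α u₀ (T₁ + Ts * i)) N L 1
          - pencilMatrix (fun i => signal α u₀ M (T₁ + Ts * i)) N L 1) θ θ' t L := by
  have hα0 : 0 < α := hα₀.trans_le hα
  set m := modeIndex u₀ (M - 1) + 1 with hm
  have hcard : ∀ k < M, ∀ hf : (Set.ofPred fun n => coeff u₀ n ≠ 0).Finite,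
      k < hf.toFinset.card := fun k hk hf => lt_card_of_le_encard hcoeff hk hf
  have hMm : M ≤ m := by
    have : M - 1 ≤ modeIndex u₀ (M - 1) := Nat.le_nth (hcard _ (by omega))
    omega
  have hM' : (1 : ℝ) ≤ M := by exact_mod_cast hM
  have hMm' : (M : ℝ) ≤ m := by exact_mod_cast hMm
  obtain ⟨t, ht, ht0, hsum⟩ := exists_tail_sum_lt hα₀ hα hM₀ hu₀ hu₀M₀ hT₁ hM hMm
  have hexp : Real.exp (-(2 * eigval α m * Ts / 2)) = modeRatio α Ts m := by
    rw [modeRatio]; congr 1; ring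
  have hθ0 : 0 < θ := by rw [hθ]; positivity
  have hθθ' : θ ≤ 2 * eigval α m * Ts := by
    rw [hθ, eigval]
    have : α₀ * (M : ℝ) ^ 2 ≤ α * (m : ℝ) ^ 2 := by gcongr
    have h2 := mul_le_mul_of_nonneg_right this (by positivity : 0 ≤ 2 * Real.pi ^ 2 * Ts)
    linarith
  refine ⟨2 * eigval α m * Ts, t, hθθ', ht0, ht, fun k hk => ?_, ?_⟩
  · rw [hexp]
    refine modeRatio_anti hα0.le hTs.le ?_
    have : modeIndex u₀ k ≤ modeIndex u₀ (M - 1) :=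
      Nat.nth_le_nth' (by omega) (hcard _ (by omega))
    omega
  · set a : ℕ → ℝ := fun j => coeff u₀ (m + j) * Real.exp (-(eigval α (m + j) * T₁)) with ha
    set ω : ℕ → ℝ := fun j => modeRatio α Ts (m + j) with hω
    have hω0 : ∀ j, 0 ≤ ω j := fun j => (Real.exp_pos _).le
    have hω1 : ∀ j, ω j ≤ Real.exp (-(2 * eigval α m * Ts / 2)) := fun j => by
      rw [hexp]; exact modeRatio_anti hα0.le hTs.le (by omega)
    have hω2 : ∀ j, ω j ≤ 1 := fun j => (hω1 j).trans (Real.exp_le_one_iff.mpr (by linarith))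
    have hobs : ∀ i : ℕ, obs α u₀ (T₁ + Ts * i) - signal α u₀ M (T₁ + Ts * i) = expSum a ω i := by
      intro i
      have h1 := hasSum_expSum hsum hω0 hω2 i
      set f : ℕ → ℝ := fun n => coeff u₀ n * Real.exp (-(eigval α n * (T₁ + Ts * i))) with hf
      have h2 : ∀ j, f (j + m) = a j * ω j ^ i := fun j => by
        simp only [hf, ha, hω, exp_eigval_sample, add_comm j m]
        ring
      have h3 : HasSum (fun j => f (j + m)) (expSum a ω i) := by
        simp only [h2]; exact h1
      have h4 : HasSum f (expSum a ω i + ∑ n ∈ Finset.range m, f n) := by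
        rw [hasSum_nat_add_iff] at h3; exact h3
      have h5 : ∑ n ∈ Finset.range m, f n = signal α u₀ M (T₁ + Ts * i) :=
        sum_range_nth hM hcoeff fun n hn => by simp only [hf, not_not.mp hn, zero_mul]
      have h6 : obs α u₀ (T₁ + Ts * i) = _ := h4.tsum_eq
      rw [h6, h5]
      ring
    have hE : ∀ s, pencilMatrix (fun i => obs α u₀ (T₁ + Ts * i)) N L s
          - pencilMatrix (fun i => signal α u₀ M (T₁ + Ts * i)) N L s
          = pencilMatrix (expSum a ω) N L s := fun s => by
      ext r k
      exact hobs _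
    rw [hE, hE]
    exact pencilBounds_expSum hsum hθ0 hθθ' hω0 hω1 N L

/-! ### Eigenvalues of the exact pencil -/

theorem eq_of_antitone_of_map_univ_eq {n : ℕ} {f g : Fin n → ℝ} (hf : Antitone f) (hg : Antitone g)
    (h : (Finset.univ : Finset (Fin n)).val.map f = (Finset.univ : Finset (Fin n)).val.map g) :
    f = g := by
  rw [Fin.univ_val_map, Fin.univ_val_map, Multiset.coe_eq_coe] at h
  exact List.ofFn_injective (h.eq_of_sortedGE hf.sortedGE_ofFn hg.sortedGE_ofFn)

theorem exists_left_inverse_of_mulVec {m n : ℕ} {A : Matrix (Fin m) (Fin n) ℝ}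
    (h : ∀ v, A *ᵥ v = 0 → v = 0) : ∃ B : Matrix (Fin n) (Fin m) ℝ, B * A = 1 := by
  obtain ⟨g, hg⟩ := (toLin' A).exists_leftInverse_of_injective
    (LinearMap.ker_eq_bot'.mpr fun v hv => h v hv)
  refine ⟨LinearMap.toMatrix' g, ?_⟩
  have h1 : A = LinearMap.toMatrix' (toLin' A) := (LinearMap.toMatrix'_toLin' A).symm
  rw [h1, ← LinearMap.toMatrix'_comp, hg, LinearMap.toMatrix'_id]

/-- The `m × M` Vandermonde matrix with entries `ζ_k ^ r`. -/
def vanderRows {M : ℕ} (ζ : Fin M → ℝ) (m : ℕ) : Matrix (Fin m) (Fin M) ℝ :=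
  Matrix.of fun r k => ζ k ^ (r : ℕ)

theorem vanderRows_injective {M m : ℕ} {ζ : Fin M → ℝ} (hζ : Function.Injective ζ) (h : M ≤ m)
    (v : Fin M → ℝ) (hv : vanderRows ζ m *ᵥ v = 0) : v = 0 := by
  refine eq_zero_of_forall_pow_sum_mul_pow_eq_zero hζ fun i => ?_
  have := congrFun hv (Fin.castLE h i)
  simpa [mulVec, dotProduct, vanderRows, mul_comm] using this

/-- The factorization of the pencil matrices of `∑_k c_k ζ_kⁱ`. -/
theorem pencilMatrix_eq_mul {M : ℕ} (c ζ : Fin M → ℝ) (N L s : ℕ) :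
    pencilMatrix (fun i => ∑ k, c k * ζ k ^ i) N L s
      = vanderRows ζ (N - L) * (diagonal c * diagonal ζ ^ s)
        * (vanderRows ζ L).transpose.submatrix id Fin.rev := by
  ext r j
  rw [diagonal_pow, diagonal_mul_diagonal, Matrix.mul_apply]
  simp only [pencilMatrix, of_apply, mul_diagonal, submatrix_apply, transpose_apply, vanderRows, id,
    Pi.pow_apply]
  refine Finset.sum_congr rfl fun k _ => ?_
  have : L - 1 - (j : ℕ) + s + (r : ℕ) = (r : ℕ) + s + (Fin.rev j : ℕ) := by
    rw [Fin.val_rev]; omega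
  rw [this, pow_add, pow_add]
  ring

theorem roots_X_pow_mul_prod {K : Type*} [Field K] {M : ℕ} (f : Fin M → K) (j : ℕ) :
    (Polynomial.X ^ j * ∏ i, (Polynomial.X - Polynomial.C (f i))).roots
      = Multiset.replicate j 0 + Finset.univ.val.map f := by
  have h1 : ∏ i, (Polynomial.X - Polynomial.C (f i)) ≠ 0 :=
    Finset.prod_ne_zero_iff.mpr fun i _ => Polynomial.X_sub_C_ne_zero _
  have h2 : (∏ i, (Polynomial.X - Polynomial.C (f i))).roots = Finset.univ.val.map f := by
    rw [← Polynomial.roots_multiset_prod_X_sub_C (Finset.univ.val.map f), Multiset.map_map]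
    rfl
  rw [Polynomial.roots_mul (mul_ne_zero (pow_ne_zero _ Polynomial.X_ne_zero) h1),
    Polynomial.roots_X_pow, h2, Multiset.nsmul_singleton]

/-- The nonzero eigenvalues of `X₀† X₁` are the nodes `ζ_k`, for `X₀ = G R` and
`X₁ = G (diagonal ζ) R` with full rank factors: `R X₀† G = 1`, so that
`X₀† X₁ = (X₀† G) (diagonal ζ R)` has, up to zeros, the spectrum of
`(diagonal ζ R) (X₀† G) = diagonal ζ`. -/
theorem eq_nodes_of_pinv {M m L : ℕ} (hML : M ≤ L) {ζ z : Fin M → ℝ} (hζ : Antitone ζ)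
    (hζ0 : ∀ k, ζ k ≠ 0) (hz : Antitone z) {G : Matrix (Fin m) (Fin M) ℝ}
    {R : Matrix (Fin M) (Fin L) ℝ} (hG : ∃ B : Matrix (Fin M) (Fin m) ℝ, B * G = 1)
    (hR : ∃ B : Matrix (Fin L) (Fin M) ℝ, R * B = 1)
    (hzeig : ((pinv (G * R) * (G * diagonal ζ * R)).charpoly.aroots ℂ).filter (fun w => w ≠ 0) =
      Finset.univ.val.map (fun n : Fin M => (z n : ℂ))) : z = ζ := by
  obtain ⟨G', hG'⟩ := hG
  obtain ⟨R', hR'⟩ := hR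
  have h1 : R * (pinv (G * R) * G) = 1 := by
    have h := (isMoorePenrose_pinv (G * R)).mul_mul_self
    calc R * (pinv (G * R) * G) = G' * G * R * (pinv (G * R) * G) * (R * R') := by
          rw [hG', hR', Matrix.one_mul, Matrix.mul_one]
      _ = G' * (G * R * pinv (G * R) * (G * R)) * R' := by simp only [Matrix.mul_assoc]
      _ = (G' * G) * (R * R') := by rw [h]; simp only [Matrix.mul_assoc]
      _ = 1 := by rw [hG', hR', Matrix.one_mul]
  have h2 : (pinv (G * R) * (G * diagonal ζ * R)).charpoly
      = Polynomial.X ^ (L - M) * ∏ i, (Polynomial.X - Polynomial.C (ζ i)) := by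
    have e : pinv (G * R) * (G * diagonal ζ * R) = (pinv (G * R) * G) * (diagonal ζ * R) := by
      simp only [Matrix.mul_assoc]
    rw [e, charpoly_mul_comm_of_le _ _ (by simpa using hML), Matrix.mul_assoc, h1, Matrix.mul_one,
      charpoly_diagonal]
    simp
  rw [h2, Polynomial.aroots_def, Polynomial.map_mul, Polynomial.map_pow, Polynomial.map_X,
    Polynomial.map_prod] at hzeig
  simp only [Polynomial.map_sub, Polynomial.map_X, Polynomial.map_C] at hzeig
  rw [roots_X_pow_mul_prod, Multiset.filter_add, Multiset.filter_eq_nil.mpr (by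
    intro a ha; simp [Multiset.eq_of_mem_replicate ha]), zero_add, Multiset.filter_eq_self.mpr (by
    intro a ha
    obtain ⟨k, -, rfl⟩ := Multiset.mem_map.mp ha
    simpa using hζ0 k)] at hzeig
  refine eq_of_antitone_of_map_univ_eq hz hζ ?_
  have h3 := congrArg (Multiset.map Complex.re) hzeig
  rw [Multiset.map_map, Multiset.map_map] at h3
  simpa [Function.comp_def] using h3.symm

/-! ### Symmetrization of the computed pencil -/

theorem exists_orthogonal_diagonal {n : ℕ} {A : Matrix (Fin n) (Fin n) ℝ} (hA : Aᵀ = A) :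
    ∃ (O : Matrix (Fin n) (Fin n) ℝ) (d : Fin n → ℝ), Antitone d ∧ Oᵀ * O = 1 ∧ O * Oᵀ = 1 ∧
      A = O * diagonal d * Oᵀ := by
  have hH : A.IsHermitian := by
    rw [Matrix.IsHermitian, conjTranspose_eq_transpose_of_trivial, hA]
  set Q : Matrix (Fin n) (Fin n) ℝ := hH.eigenvectorUnitary.1 with hQ
  set d : Fin n → ℝ := hH.eigenvalues with hd
  have hQQ : Qᵀ * Q = 1 := by
    have := Unitary.coe_star_mul_self hH.eigenvectorUnitary
    rwa [star_eq_conjTranspose, conjTranspose_eq_transpose_of_trivial] at this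
  have hspec : A = Q * diagonal d * Qᵀ := by
    have h := hH.spectral_theorem
    rw [Unitary.conjStarAlgAut_apply, star_eq_conjTranspose,
      conjTranspose_eq_transpose_of_trivial] at h
    simpa using h
  -- sort the eigenvalues
  set σ := Tuple.sort (fun i => -d i) with hσ
  have hmono : Antitone (d ∘ σ) := fun i j hij => by
    have := Tuple.monotone_sort (fun i => -d i) hij
    simp only [Function.comp_apply, ← hσ] at this
    simpa using this
  have hO : (Q.submatrix id σ)ᵀ * Q.submatrix id σ = 1 := by
    have h1 := submatrix_mul_equiv Qᵀ Q σ (Equiv.refl _) σ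
    rw [hQQ, submatrix_one_equiv] at h1
    exact h1
  refine ⟨Q.submatrix id σ, d ∘ σ, hmono, hO, mul_eq_one_comm.mp hO, ?_⟩
  rw [hspec]
  ext i j
  rw [Matrix.mul_apply, Matrix.mul_apply, ← Equiv.sum_comp σ]
  simp [mul_diagonal]

theorem norm_toLp_ofReal {𝕜 : Type*} [RCLike 𝕜] {n : ℕ} (v : Fin n → ℝ) :
    ‖WithLp.toLp 2 (fun i => (v i : 𝕜))‖ = ‖WithLp.toLp 2 v‖ := by
  simp [EuclideanSpace.norm_eq]

theorem norm_toLp_sq {n : ℕ} (v : Fin n → ℝ) : ‖WithLp.toLp 2 v‖ ^ 2 = v ⬝ᵥ v := by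
  rw [EuclideanSpace.norm_sq_eq]
  simp [dotProduct, sq]

theorem dotProduct_mulVec_self {m n : ℕ} (A : Matrix (Fin m) (Fin n) ℝ) (v : Fin n → ℝ) :
    (A *ᵥ v) ⬝ᵥ (A *ᵥ v) = v ⬝ᵥ ((Aᵀ * A) *ᵥ v) := by
  rw [← mulVec_mulVec, dotProduct_mulVec v, vecMul_transpose]

theorem norm_mulVec_of_orthonormal {m n : ℕ} {Q : Matrix (Fin m) (Fin n) ℝ} (hQ : Qᵀ * Q = 1)
    (v : Fin n → ℝ) : ‖WithLp.toLp 2 (Q *ᵥ v)‖ = ‖WithLp.toLp 2 v‖ := by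
  rw [← sq_eq_sq₀ (norm_nonneg _) (norm_nonneg _), norm_toLp_sq, norm_toLp_sq,
    dotProduct_mulVec_self, hQ, Matrix.one_mulVec]

/-- On real vectors the real part of the Gram matrix `Yᴴ Y` has the quadratic form `‖Y u‖²`. -/
theorem dotProduct_re_gram {𝕜 : Type*} [RCLike 𝕜] {n : ℕ} (Y : Matrix (Fin n) (Fin n) 𝕜)
    (u : Fin n → ℝ) : u ⬝ᵥ ((Yᴴ * Y).map RCLike.re *ᵥ u)
      = ‖WithLp.toLp 2 (Y *ᵥ fun i => (u i : 𝕜))‖ ^ 2 := by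
  set uc : Fin n → 𝕜 := fun i => (u i : 𝕜) with huc
  have h1 : u ⬝ᵥ ((Yᴴ * Y).map RCLike.re *ᵥ u) = RCLike.re (star uc ⬝ᵥ ((Yᴴ * Y) *ᵥ uc)) := by
    simp only [dotProduct, mulVec, Finset.mul_sum, map_sum, map_apply, huc, Pi.star_apply,
      RCLike.star_def, RCLike.conj_ofReal]
    refine Finset.sum_congr rfl fun i _ => Finset.sum_congr rfl fun j _ => ?_
    rw [RCLike.re_ofReal_mul, mul_comm ((Yᴴ * Y) i j), RCLike.re_ofReal_mul]
    ring
  have h2 : star uc ⬝ᵥ ((Yᴴ * Y) *ᵥ uc) = star (Y *ᵥ uc) ⬝ᵥ (Y *ᵥ uc) := by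
    rw [← mulVec_mulVec, dotProduct_mulVec, star_mulVec]
  rw [h1, h2, EuclideanSpace.norm_sq_eq]
  simp only [dotProduct, map_sum, Pi.star_apply, RCLike.star_def]
  refine Finset.sum_congr rfl fun i _ => ?_
  rw [RCLike.conj_mul]
  norm_cast

theorem exists_sqrt_factor {n : ℕ} {A : Matrix (Fin n) (Fin n) ℝ} (hA : Aᵀ = A)
    (h : ∀ v, 0 ≤ v ⬝ᵥ (A *ᵥ v)) : ∃ T : Matrix (Fin n) (Fin n) ℝ, Tᵀ * T = A := by
  obtain ⟨O, d, -, hOO, -, hspec⟩ := exists_orthogonal_diagonal hA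
  have hd : ∀ i, 0 ≤ d i := fun i => by
    have h1 := h (O *ᵥ Pi.single i 1)
    have h2 : A *ᵥ (O *ᵥ Pi.single i 1) = d i • (O *ᵥ Pi.single i 1) := by
      rw [mulVec_mulVec, hspec, Matrix.mul_assoc, hOO, Matrix.mul_one, ← mulVec_mulVec,
        diagonal_mulVec_single, mul_one, ← mulVec_smul]
      congr 1
      ext j
      simp [Pi.single_apply]
    have h3 : (O *ᵥ Pi.single i 1) ⬝ᵥ (O *ᵥ Pi.single i 1) = 1 := by
      rw [dotProduct_mulVec, vecMul_mulVec, hOO]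
      simp
    rw [h2, dotProduct_smul, h3] at h1
    simpa using h1
  refine ⟨diagonal (fun i => Real.sqrt (d i)) * Oᵀ, ?_⟩
  rw [transpose_mul, transpose_transpose, diagonal_transpose, Matrix.mul_assoc,
    ← Matrix.mul_assoc (diagonal _) (diagonal _), diagonal_mul_diagonal, hspec, Matrix.mul_assoc]
  congr 3
  ext i
  exact Real.mul_self_sqrt (hd i)

theorem prod_X_sub_C_dite {K : Type*} [CommRing K] {M L : ℕ} (hML : M ≤ L) (f : Fin M → K) :
    ∏ i : Fin L, (Polynomial.X - Polynomial.C (if h : (i : ℕ) < M then f ⟨i, h⟩ else 0))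
      = Polynomial.X ^ (L - M) * ∏ i, (Polynomial.X - Polynomial.C (f i)) := by
  obtain ⟨j, rfl⟩ := Nat.exists_eq_add_of_le hML
  rw [Fin.prod_univ_add, mul_comm]
  simp

/-- If the product `V W` has a real or complex diagonalization `X`, then `W V` is diagonalized
by a real matrix with no larger condition number. It is obtained from the real part of the Gram
matrix of `X⁻¹`, for which `V W` is selfadjoint. -/
theorem exists_real_diagonalization {𝕜 : Type*} [RCLike 𝕜] {M L : ℕ} (hML : M ≤ L)
    {X : Matrix (Fin L) (Fin L) 𝕜} (hX : IsUnit X.det) {zt : Fin M → ℝ} (hzt : Antitone zt)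
    {V : Matrix (Fin L) (Fin M) ℝ} {W : Matrix (Fin M) (Fin L) ℝ} (hV : Vᵀ * V = 1)
    (h : (V * W).map (fun a : ℝ => (a : 𝕜)) = X * diagonal (fun i : Fin L =>
        if h : (i : ℕ) < M then ((zt ⟨i, h⟩ : ℝ) : 𝕜) else 0) * X⁻¹) :
    ∃ S S' : Matrix (Fin M) (Fin M) ℝ, S' * S = 1 ∧ S' * (W * V) * S = diagonal zt ∧
      specNorm S ≤ specNorm X ∧ specNorm S' ≤ specNorm X⁻¹ := by
  set Y := X⁻¹ with hY
  have hXY : X * Y = 1 := mul_nonsing_inv X hX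
  have hYX : Y * X = 1 := nonsing_inv_mul X hX
  set D : Matrix (Fin L) (Fin L) 𝕜 := diagonal (fun i : Fin L =>
        if h : (i : ℕ) < M then ((zt ⟨i, h⟩ : ℝ) : 𝕜) else 0) with hD
  set Ψ : Matrix (Fin L) (Fin L) ℝ := (Yᴴ * Y).map RCLike.re with hΨ
  have hre : ∀ H : Matrix (Fin L) (Fin L) 𝕜, Hᴴ = H → (H.map RCLike.re)ᵀ = H.map RCLike.re := by
    intro H hH
    ext i j
    have := congrFun (congrFun hH i) j
    rw [conjTranspose_apply] at this
    rw [transpose_apply, map_apply, map_apply, ← this, RCLike.star_def, RCLike.conj_re]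
  have hΨt : Ψᵀ = Ψ := hre _ (by rw [conjTranspose_mul, conjTranspose_conjTranspose])
  have hDt : Dᴴ = D := by
    rw [hD, diagonal_conjTranspose]
    congr 1
    ext i
    rw [Pi.star_apply]
    split_ifs <;> simp
  have hΨA : (Ψ * (V * W))ᵀ = Ψ * (V * W) := by
    have h1 : Ψ * (V * W) = (Yᴴ * Y * (V * W).map (fun a : ℝ => (a : 𝕜))).map RCLike.re := by
      ext i j
      rw [Matrix.mul_apply, map_apply, Matrix.mul_apply, map_sum]
      refine Finset.sum_congr rfl fun k _ => ?_
      rw [map_apply (M := V * W), mul_comm ((Yᴴ * Y) i k), RCLike.re_ofReal_mul, hΨ, map_apply,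
        mul_comm]
    have h2 : Yᴴ * Y * (V * W).map (fun a : ℝ => (a : 𝕜)) = Yᴴ * D * Y := by
      rw [h]
      calc Yᴴ * Y * (X * D * Y) = Yᴴ * (Y * X) * D * Y := by simp only [Matrix.mul_assoc]
        _ = _ := by rw [hYX, Matrix.mul_one]
    rw [h1, h2]
    refine hre _ ?_
    rw [conjTranspose_mul, conjTranspose_mul, conjTranspose_conjTranspose, hDt, Matrix.mul_assoc]
  set Φ := Vᵀ * Ψ * V with hΦ
  have hΦt : Φᵀ = Φ := by
    rw [hΦ, transpose_mul, transpose_mul, transpose_transpose, hΨt, Matrix.mul_assoc]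
  have hquad : ∀ v : Fin M → ℝ, v ⬝ᵥ (Φ *ᵥ v)
      = ‖WithLp.toLp 2 (Y *ᵥ fun i => ((V *ᵥ v) i : 𝕜))‖ ^ 2 := fun v => by
    rw [← dotProduct_re_gram, hΦ, ← mulVec_mulVec, ← mulVec_mulVec, dotProduct_mulVec,
      vecMul_transpose]
  obtain ⟨T, hT⟩ := exists_sqrt_factor hΦt fun v => by rw [hquad]; positivity
  have hTn : ∀ v : Fin M → ℝ, ‖WithLp.toLp 2 (T *ᵥ v)‖
      = ‖WithLp.toLp 2 (Y *ᵥ fun i => ((V *ᵥ v) i : 𝕜))‖ := fun v => by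
    rw [← sq_eq_sq₀ (norm_nonneg _) (norm_nonneg _), ← hquad, norm_toLp_sq, ← hT,
      dotProduct_mulVec_self]
  have hVn := norm_mulVec_of_orthonormal hV
  have hup : ∀ v : Fin M → ℝ, ‖WithLp.toLp 2 (T *ᵥ v)‖ ≤ specNorm Y * ‖WithLp.toLp 2 v‖ :=
    fun v => by
      rw [hTn, ← hVn, ← norm_toLp_ofReal (𝕜 := 𝕜)]
      exact norm_mulVec_le_specNorm _ _
  have hlow : ∀ v : Fin M → ℝ, ‖WithLp.toLp 2 v‖ ≤ specNorm X * ‖WithLp.toLp 2 (T *ᵥ v)‖ :=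
    fun v => by
      rw [hTn]
      refine le_trans (le_of_eq ?_) (norm_mulVec_le_specNorm X _)
      rw [mulVec_mulVec, hXY, one_mulVec, norm_toLp_ofReal, hVn]
  have hTdet : IsUnit T.det := by
    rw [isUnit_iff_ne_zero]
    intro h0
    obtain ⟨v, hv, hv0⟩ := exists_mulVec_eq_zero_iff.mpr h0
    have := hlow v
    rw [hv0] at this
    simp only [WithLp.toLp_zero, norm_zero, mul_zero] at this
    have h1 := norm_le_zero_iff.mp this
    exact hv (by simpa using congrArg WithLp.ofLp h1)
  have hTT : T * T⁻¹ = 1 := mul_nonsing_inv T hTdet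
  have hTT' : T⁻¹ * T = 1 := nonsing_inv_mul T hTdet
  -- `T (W V) T⁻¹` is symmetric because `Φ (W V) = Vᵀ (Ψ V W) V` is
  have hsymm : (T * (W * V) * T⁻¹)ᵀ = T * (W * V) * T⁻¹ := by
    have h1 : (Φ * (W * V))ᵀ = Φ * (W * V) := by
      have e : Φ * (W * V) = Vᵀ * (Ψ * (V * W)) * V := by
        simp only [hΦ, Matrix.mul_assoc]
      rw [e, transpose_mul, transpose_mul, transpose_transpose, hΨA, ← Matrix.mul_assoc]
    have h2 : T * (W * V) * T⁻¹ = (T⁻¹)ᵀ * (Φ * (W * V)) * T⁻¹ := by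
      have e : (T⁻¹)ᵀ * Tᵀ = 1 := by rw [← transpose_mul, hTT, transpose_one]
      rw [← hT]
      calc T * (W * V) * T⁻¹ = ((T⁻¹)ᵀ * Tᵀ) * T * (W * V) * T⁻¹ := by rw [e, Matrix.one_mul]
        _ = _ := by simp only [Matrix.mul_assoc]
    rw [h2, transpose_mul, transpose_mul, transpose_transpose, h1, ← Matrix.mul_assoc]
  obtain ⟨O, e, he, hOO, hOO', hspec⟩ := exists_orthogonal_diagonal hsymm
  have hconj : Oᵀ * T * (W * V) * (T⁻¹ * O) = diagonal e := by
    calc Oᵀ * T * (W * V) * (T⁻¹ * O) = Oᵀ * (T * (W * V) * T⁻¹) * O := by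
          simp only [Matrix.mul_assoc]
      _ = (Oᵀ * O) * diagonal e * (Oᵀ * O) := by rw [hspec]; simp only [Matrix.mul_assoc]
      _ = diagonal e := by rw [hOO, Matrix.one_mul, Matrix.mul_one]
  have hinv : Oᵀ * T * (T⁻¹ * O) = 1 := by
    rw [Matrix.mul_assoc, ← Matrix.mul_assoc T, hTT, Matrix.one_mul, hOO]
  -- comparison of the characteristic polynomials of `V W` and `W V`
  have hezt : e = zt := by
    refine eq_of_antitone_of_map_univ_eq he hzt ?_
    have h1 : (W * V).charpoly = ∏ i, (Polynomial.X - Polynomial.C (e i)) := by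
      rw [← charpoly_diagonal, ← hconj, charpoly_mul_comm, ← Matrix.mul_assoc,
        Matrix.mul_assoc T⁻¹, ← Matrix.mul_assoc O, hOO', Matrix.one_mul, hTT', Matrix.one_mul]
    have h2 : ((V * W).map (fun a : ℝ => (a : 𝕜))).charpoly
        = Polynomial.X ^ (L - M) * ∏ i, (Polynomial.X - Polynomial.C ((e i : ℝ) : 𝕜)) := by
      have e1 : (V * W).map (fun a : ℝ => (a : 𝕜)) = (V * W).map (algebraMap ℝ 𝕜) := rfl
      rw [e1, charpoly_map, charpoly_mul_comm_of_le V W (by simpa using hML), h1,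
        Polynomial.map_mul, Polynomial.map_pow, Polynomial.map_X, Polynomial.map_prod]
      simp
    have h3 : ((V * W).map (fun a : ℝ => (a : 𝕜))).charpoly
        = Polynomial.X ^ (L - M) * ∏ i, (Polynomial.X - Polynomial.C ((zt i : ℝ) : 𝕜)) := by
      rw [h, charpoly_mul_comm, ← Matrix.mul_assoc, hYX, Matrix.one_mul, hD, charpoly_diagonal,
        prod_X_sub_C_dite hML (fun i => ((zt i : ℝ) : 𝕜))]
    have h4 := congrArg Polynomial.roots (h2.symm.trans h3)
    rw [roots_X_pow_mul_prod, roots_X_pow_mul_prod] at h4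
    have h5 := congrArg (Multiset.map (RCLike.re : 𝕜 → ℝ)) (add_left_cancel h4)
    rw [Multiset.map_map, Multiset.map_map] at h5
    simpa [Function.comp_def] using h5
  refine ⟨T⁻¹ * O, Oᵀ * T, hinv, by rw [hconj, hezt], ?_, ?_⟩
  · refine specNorm_le_of_forall _ (specNorm_nonneg X) fun v => ?_
    have := hlow ((T⁻¹ * O) *ᵥ v)
    rwa [mulVec_mulVec, ← Matrix.mul_assoc, hTT, Matrix.one_mul, norm_mulVec_of_orthonormal hOO] at this
  · refine specNorm_le_of_forall _ (specNorm_nonneg Y) fun v => ?_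
    rw [← mulVec_mulVec, norm_mulVec_of_orthonormal (by rw [transpose_transpose, hOO'])]
    exact hup v

/-! ### Reduction to the leading singular subspaces -/

/-- The first `M` columns of a square matrix. -/
def leftCols {n M : ℕ} (h : M ≤ n) (Q : Matrix (Fin n) (Fin n) ℝ) : Matrix (Fin n) (Fin M) ℝ :=
  Q.submatrix id (Fin.castLE h)

theorem leftCols_eq_mul {n M : ℕ} (h : M ≤ n) (Q : Matrix (Fin n) (Fin n) ℝ) :
    leftCols h Q = Q * leftCols h 1 := by
  ext i j
  simp [leftCols, Matrix.mul_apply, Matrix.one_apply]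

theorem leftCols_orthonormal {n M : ℕ} (h : M ≤ n) {Q : Matrix (Fin n) (Fin n) ℝ}
    (hQ : Qᵀ * Q = 1) : (leftCols h Q)ᵀ * leftCols h Q = 1 := by
  ext i j
  have := congrFun (congrFun hQ (Fin.castLE h i)) (Fin.castLE h j)
  simpa [leftCols, Matrix.mul_apply, Matrix.one_apply] using this

theorem transpose_mul_self_of_mem {n : ℕ} {Q : Matrix (Fin n) (Fin n) ℝ}
    (hQ : Q ∈ Matrix.orthogonalGroup (Fin n) ℝ) : Qᵀ * Q = 1 :=
  (Matrix.mem_orthogonalGroup_iff' (Fin n) ℝ).mp hQ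

/-- The first `M` rows of `rectDiag m n d`; note that `leftCols h 1` consists of the first `M` unit
vectors. -/
theorem leftCols_one_transpose_mul_rectDiag {m n M : ℕ} (hm : M ≤ m) (hn : M ≤ n) (d : ℕ → ℝ) :
    (leftCols hm 1)ᵀ * rectDiag m n d
      = diagonal (fun i : Fin M => d i) * (leftCols hn (1 : Matrix (Fin n) (Fin n) ℝ))ᵀ := by
  ext i j
  rw [diagonal_mul, Matrix.mul_apply, Finset.sum_eq_single (Fin.castLE hm i)]
  · simp [leftCols, rectDiag, Matrix.one_apply, Fin.ext_iff, eq_comm]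
  · intro k _ hk
    simp [leftCols, hk]
  · simp

theorem rectDiag_truncated {m n M : ℕ} (hm : M ≤ m) (hn : M ≤ n) (d : ℕ → ℝ) :
    rectDiag m n (fun i => if i < M then d i else 0)
      = leftCols hm 1 * (diagonal (fun i : Fin M => d i)
        * (leftCols hn (1 : Matrix (Fin n) (Fin n) ℝ))ᵀ) := by
  ext i j
  rw [Matrix.mul_apply]
  simp only [diagonal_mul, leftCols, rectDiag, of_apply, submatrix_apply, transpose_apply, id,
    Matrix.one_apply]
  by_cases hi : (i : ℕ) < M
  · rw [Finset.sum_eq_single ⟨i, hi⟩]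
    · simp [Fin.ext_iff, hi, eq_comm]
    · intro k _ hk
      rw [if_neg, zero_mul]
      exact fun h => hk (by rw [Fin.ext_iff] at h ⊢; simpa using h.symm)
    · simp
  · rw [Finset.sum_eq_zero]
    · simp [hi]
    · intro k _
      rw [if_neg, zero_mul]
      intro h
      rw [Fin.ext_iff] at h
      simp only [Fin.val_castLE] at h
      have := k.2
      omega

theorem IsSVD.transpose_leftCols_mul {m n M : ℕ} (hm : M ≤ m) (hn : M ≤ n)
    {A : Matrix (Fin m) (Fin n) ℝ} {U : Matrix (Fin m) (Fin m) ℝ} {V : Matrix (Fin n) (Fin n) ℝ}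
    (h : IsSVD A U V) :
    (leftCols hm U)ᵀ * A = diagonal (fun i : Fin M => singVal A i) * (leftCols hn V)ᵀ := by
  have hU := transpose_mul_self_of_mem h.left_orthogonal
  conv_lhs => rw [h.eq_mul]
  rw [leftCols_eq_mul hm U, leftCols_eq_mul hn V, transpose_mul, transpose_mul, Matrix.mul_assoc,
    Matrix.mul_assoc U, ← Matrix.mul_assoc Uᵀ, hU, Matrix.one_mul, ← Matrix.mul_assoc,
    leftCols_one_transpose_mul_rectDiag hm hn, Matrix.mul_assoc]

theorem svdTruncPinv_eq {m n M : ℕ} (hm : M ≤ m) (hn : M ≤ n) (A : Matrix (Fin m) (Fin n) ℝ)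
    (U : Matrix (Fin m) (Fin m) ℝ) (V : Matrix (Fin n) (Fin n) ℝ) :
    svdTruncPinv A U V M = leftCols hn V *
      (diagonal (fun i : Fin M => (singVal A i)⁻¹) * (leftCols hm U)ᵀ) := by
  rw [svdTruncPinv, rectDiag_truncated hn hm, leftCols_eq_mul hm U, leftCols_eq_mul hn V,
    transpose_mul]
  simp only [Matrix.mul_assoc]

theorem singVal_antitone {m n : ℕ} (A : Matrix (Fin m) (Fin n) ℝ) : Antitone (singVal A) :=
  fun _ _ h => (Matrix.toEuclideanLin A).singularValues_antitone h

theorem norm_diagonal_mulVec_ge {n : ℕ} {s v : Fin n → ℝ} {σ : ℝ} (hσ : 0 ≤ σ)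
    (hs : ∀ i, σ ≤ s i) : σ * ‖WithLp.toLp 2 v‖ ≤ ‖WithLp.toLp 2 (diagonal s *ᵥ v)‖ := by
  refine abs_le_of_sq_le_sq' ?_ (norm_nonneg _) |>.2
  rw [mul_pow, norm_toLp_sq, norm_toLp_sq, dotProduct, dotProduct, Finset.mul_sum]
  refine Finset.sum_le_sum fun i _ => ?_
  rw [mulVec_diagonal]
  have := mul_le_mul_of_nonneg_right (pow_le_pow_left₀ hσ (hs i) 2) (mul_self_nonneg (v i))
  linarith

theorem specNorm_diagonal_inv_le {n : ℕ} {s : Fin n → ℝ} {σ : ℝ} (hσ : 0 < σ)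
    (hs : ∀ i, σ ≤ s i) : specNorm (diagonal fun i => (s i)⁻¹) ≤ σ⁻¹ := by
  refine specNorm_le_of_forall _ (inv_nonneg.mpr hσ.le) fun v => ?_
  have h := norm_diagonal_mulVec_ge (v := diagonal (fun i => (s i)⁻¹) *ᵥ v) hσ.le hs
  have h1 : diagonal s *ᵥ (diagonal (fun i => (s i)⁻¹) *ᵥ v) = v := by
    rw [mulVec_mulVec, diagonal_mul_diagonal]
    have : (fun i => s i * (s i)⁻¹) = 1 := by
      ext i
      exact mul_inv_cancel₀ (hσ.trans_le (hs i)).ne'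
    rw [this, diagonal_one', one_mulVec]
  rw [h1] at h
  rw [inv_mul_eq_div, le_div_iff₀ hσ]
  linarith

theorem specNorm_le_one_of_orthonormal {m n : ℕ} {Q : Matrix (Fin m) (Fin n) ℝ}
    (hQ : Qᵀ * Q = 1) : specNorm Q ≤ 1 :=
  specNorm_le_of_forall _ zero_le_one fun v => by rw [norm_mulVec_of_orthonormal hQ, one_mul]

/-- Compression to the ranges of two matrices with orthonormal columns does not increase the
Frobenius norm. -/
theorem frob_compression_le {m n p q : ℕ} {U : Matrix (Fin m) (Fin p) ℝ} {V : Matrix (Fin n) (Fin q) ℝ}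
    (hU : Uᵀ * U = 1) (hV : Vᵀ * V = 1) (E : Matrix (Fin m) (Fin n) ℝ) : ‖Uᵀ * E * V‖ ≤ ‖E‖ := by
  have h1 := frob_mul_le_mul_specNorm (Uᵀ * E) V
  have h2 := frob_mul_le_specNorm_mul Uᵀ E
  rw [specNorm_transpose] at h2
  have h3 := mul_le_mul_of_nonneg_left (specNorm_le_one_of_orthonormal hV) (norm_nonneg (Uᵀ * E))
  have h4 := mul_le_mul_of_nonneg_right (specNorm_le_one_of_orthonormal hU) (norm_nonneg E)
  linarith

theorem isUnit_det_of_norm_ge {n : ℕ} {K : Matrix (Fin n) (Fin n) ℝ} {κ : ℝ} (hκ : 0 < κ)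
    (h : ∀ v, κ * ‖WithLp.toLp 2 v‖ ≤ ‖WithLp.toLp 2 (K *ᵥ v)‖) : IsUnit K.det := by
  rw [isUnit_iff_ne_zero]
  intro h0
  obtain ⟨v, hv, hv0⟩ := exists_mulVec_eq_zero_iff.mpr h0
  have h1 := h v
  rw [hv0, WithLp.toLp_zero, norm_zero] at h1
  have h2 : ‖WithLp.toLp 2 v‖ ≤ 0 := by
    by_contra hcon
    push Not at hcon
    linarith [mul_pos hκ hcon]
  exact hv (by simpa using congrArg WithLp.ofLp (norm_le_zero_iff.mp h2))

theorem specNorm_inv_le_of_norm_ge {n : ℕ} {K : Matrix (Fin n) (Fin n) ℝ} {κ : ℝ} (hκ : 0 < κ)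
    (h : ∀ v, κ * ‖WithLp.toLp 2 v‖ ≤ ‖WithLp.toLp 2 (K *ᵥ v)‖) : specNorm K⁻¹ ≤ κ⁻¹ := by
  refine specNorm_le_of_forall _ (inv_nonneg.mpr hκ.le) fun v => ?_
  have h1 := h (K⁻¹ *ᵥ v)
  rw [mulVec_mulVec, mul_nonsing_inv K (isUnit_det_of_norm_ge hκ h), one_mulVec] at h1
  rw [inv_mul_eq_div, le_div_iff₀ hκ]
  linarith

/-- Compression to the leading singular subspaces of `Y₀` turns both pencils into `M × M` matrices:
with the first `M` columns `u`, `v` of `U`, `V` and `Σ = uᵀ Y₀ v`, the computed one becomes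
`P = Σ⁻¹ uᵀ Y₁ v` and the exact one `K⁻¹ uᵀ X₁ v` with `K = uᵀ X₀ v`.
In a basis that diagonalizes `P` they differ by terms that are linear in `Y₁ - X₁` and
`Y₀ - X₀`. -/
theorem exists_normalized_pencil {𝕜 : Type*} [RCLike 𝕜] {m L M : ℕ} (hMm : M ≤ m) (hML : M ≤ L)
    {Y₀ Y₁ X₀ X₁ : Matrix (Fin m) (Fin L) ℝ} {U : Matrix (Fin m) (Fin m) ℝ}
    {V : Matrix (Fin L) (Fin L) ℝ} (hSVD : IsSVD Y₀ U V) {σ : ℝ} (hσ : 0 < σ)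
    (hσs : σ = singVal Y₀ (M - 1)) {XM : Matrix (Fin L) (Fin L) 𝕜} (hXM : IsUnit XM.det)
    {zt : Fin M → ℝ} (hzt : Antitone zt)
    (hdiag : (svdTruncPinv Y₀ U V M * Y₁).map (fun a : ℝ => (a : 𝕜)) =
      XM * Matrix.diagonal (fun i : Fin L =>
        if h : (i : ℕ) < M then ((zt ⟨i, h⟩ : ℝ) : 𝕜) else 0) * XM⁻¹)
    {ζ : Fin M → ℝ} {G : Matrix (Fin m) (Fin M) ℝ} {R : Matrix (Fin M) (Fin L) ℝ}
    (hX₀ : X₀ = G * R) (hX₁ : X₁ = G * diagonal ζ * R) {ρ : ℝ} (hρ1 : ρ < 1)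
    (hE₀ : ‖Y₀ - X₀‖ ≤ ρ * σ) :
    ∃ (T B : Matrix (Fin M) (Fin M) ℝ) (A₁ : Matrix (Fin M) (Fin m) ℝ)
      (A₂ : Matrix (Fin L) (Fin M) ℝ), IsUnit T.det ∧ B * T = T * diagonal ζ ∧
      diagonal zt - B = A₁ * (Y₁ - X₁) * A₂ - A₁ * (Y₀ - X₀) * A₂ * diagonal zt ∧
      (∀ E : Matrix (Fin m) (Fin L) ℝ, ‖A₁ * E * A₂‖ ≤ condNumber XM / (σ * (1 - ρ)) * ‖E‖) ∧
      ∀ j, |zt j| ≤ specNorm Y₁ / σ := by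
  set s : Fin M → ℝ := fun i => singVal Y₀ i with hs
  have hσle : ∀ i, σ ≤ s i := fun i => by
    rw [hσs]
    exact singVal_antitone Y₀ (by have := i.2; omega)
  set u := leftCols hMm U with hu
  set v := leftCols hML V with hv
  have huu : uᵀ * u = 1 := leftCols_orthonormal hMm (transpose_mul_self_of_mem hSVD.left_orthogonal)
  have hvv : vᵀ * v = 1 := leftCols_orthonormal hML (transpose_mul_self_of_mem hSVD.right_orthogonal)
  have hY₀ : uᵀ * Y₀ * v = diagonal s := by
    rw [hSVD.transpose_leftCols_mul hMm hML, Matrix.mul_assoc, hvv, Matrix.mul_one]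
  set W := diagonal (fun i => (s i)⁻¹) * uᵀ * Y₁ with hW
  have hpW : svdTruncPinv Y₀ U V M * Y₁ = v * W := by
    rw [svdTruncPinv_eq hMm hML, hW, Matrix.mul_assoc]
  rw [hpW] at hdiag
  obtain ⟨S, S', hSS, hP, hSn, hSn'⟩ := exists_real_diagonalization hML hXM hzt hvv hdiag
  have hSS' : S * S' = 1 := mul_eq_one_comm.mp hSS
  set P := W * v with hPdef
  have hsP : diagonal s * P = uᵀ * Y₁ * v := by
    have h1 : diagonal s * diagonal (fun i => (s i)⁻¹) = 1 := by
      rw [diagonal_mul_diagonal, ← diagonal_one]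
      congr 1
      ext i
      exact mul_inv_cancel₀ (hσ.trans_le (hσle i)).ne'
    calc diagonal s * P = (diagonal s * diagonal (fun i => (s i)⁻¹)) * (uᵀ * Y₁ * v) := by
          simp only [hPdef, hW, Matrix.mul_assoc]
      _ = _ := by rw [h1, Matrix.one_mul]
  set K := uᵀ * X₀ * v with hK
  set κ := σ * (1 - ρ) with hκ
  have hκ0 : 0 < κ := mul_pos hσ (by linarith)
  have hKE : K = diagonal s - uᵀ * (Y₀ - X₀) * v := by
    rw [Matrix.mul_sub, Matrix.sub_mul, hY₀, hK, sub_sub_cancel]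
  have hKge : ∀ a, κ * ‖WithLp.toLp 2 a‖ ≤ ‖WithLp.toLp 2 (K *ᵥ a)‖ := fun a => by
    have h1 := norm_diagonal_mulVec_ge (v := a) hσ.le hσle
    have h2 : ‖WithLp.toLp 2 ((uᵀ * (Y₀ - X₀) * v) *ᵥ a)‖ ≤ ρ * σ * ‖WithLp.toLp 2 a‖ :=
      (norm_mulVec_le_frob _ _).trans (mul_le_mul_of_nonneg_right
        ((frob_compression_le huu hvv _).trans hE₀) (norm_nonneg _))
    have h3 := norm_sub_norm_le (WithLp.toLp 2 (diagonal s *ᵥ a))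
      (WithLp.toLp 2 ((uᵀ * (Y₀ - X₀) * v) *ᵥ a))
    rw [← WithLp.toLp_sub, ← sub_mulVec, ← hKE] at h3
    rw [hκ]
    linarith
  have hKdet := isUnit_det_of_norm_ge hκ0 hKge
  have hKinv := specNorm_inv_le_of_norm_ge hκ0 hKge
  have hKK : K⁻¹ * K = 1 := nonsing_inv_mul K hKdet
  have hKfac : K = uᵀ * G * (R * v) := by rw [hK, hX₀]; simp only [Matrix.mul_assoc]
  have hRdet : IsUnit (R * v).det := by
    rw [hKfac, det_mul] at hKdet
    exact (IsUnit.mul_iff.mp hKdet).2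
  have hRR : R * v * (R * v)⁻¹ = 1 := mul_nonsing_inv _ hRdet
  set Phat := K⁻¹ * (uᵀ * X₁ * v) with hPhat
  have hPT : Phat * (R * v)⁻¹ = (R * v)⁻¹ * diagonal ζ := by
    have h1 : K * ((R * v)⁻¹ * diagonal ζ) = uᵀ * G * diagonal ζ := by
      rw [hKfac, Matrix.mul_assoc, ← Matrix.mul_assoc (R * v), hRR, Matrix.one_mul]
    have h2 : uᵀ * X₁ * v * (R * v)⁻¹ = uᵀ * G * diagonal ζ := by
      calc uᵀ * X₁ * v * (R * v)⁻¹ = uᵀ * G * diagonal ζ * (R * v * (R * v)⁻¹) := by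
            rw [hX₁]; simp only [Matrix.mul_assoc]
        _ = _ := by rw [hRR, Matrix.mul_one]
    rw [hPhat, Matrix.mul_assoc, h2, ← h1, ← Matrix.mul_assoc, hKK, Matrix.one_mul]
  have hdiff : P - Phat = K⁻¹ * (uᵀ * (Y₁ - X₁) * v) - K⁻¹ * (uᵀ * (Y₀ - X₀) * v) * P := by
    have h1 : K * P = uᵀ * Y₁ * v - uᵀ * (Y₀ - X₀) * v * P := by
      rw [hKE, Matrix.sub_mul, hsP]
    have h2 : P = K⁻¹ * (uᵀ * Y₁ * v) - K⁻¹ * (uᵀ * (Y₀ - X₀) * v) * P := by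
      calc P = K⁻¹ * (K * P) := by rw [← Matrix.mul_assoc, hKK, Matrix.one_mul]
        _ = _ := by rw [h1, Matrix.mul_sub, Matrix.mul_assoc K⁻¹]
    rw [Matrix.mul_sub uᵀ Y₁, Matrix.sub_mul _ _ v, Matrix.mul_sub K⁻¹, hPhat, sub_right_comm, ← h2]
  refine ⟨S' * (R * v)⁻¹, S' * Phat * S, S' * K⁻¹ * uᵀ, v * S, ?_, ?_, ?_, fun E => ?_,
    fun j => ?_⟩
  · rw [det_mul]
    refine IsUnit.mul ?_ (by rw [det_nonsing_inv]; exact hRdet.ringInverse)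
    exact (isUnit_iff_isUnit_det S').mp (IsUnit.of_mul_eq_one _ hSS)
  · calc S' * Phat * S * (S' * (R * v)⁻¹) = S' * Phat * (S * S') * (R * v)⁻¹ := by
          simp only [Matrix.mul_assoc]
      _ = S' * (Phat * (R * v)⁻¹) := by rw [hSS', Matrix.mul_one, Matrix.mul_assoc]
      _ = _ := by rw [hPT, Matrix.mul_assoc]
  · calc diagonal zt - S' * Phat * S = S' * (P - Phat) * S := by
          rw [Matrix.mul_sub, Matrix.sub_mul, hP]
      _ = S' * K⁻¹ * uᵀ * (Y₁ - X₁) * (v * S)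
          - S' * K⁻¹ * uᵀ * (Y₀ - X₀) * v * (S * S') * P * S := by
          rw [hSS', Matrix.mul_one, hdiff, Matrix.mul_sub, Matrix.sub_mul]
          simp only [Matrix.mul_assoc]
      _ = _ := by
          rw [← hP]
          simp only [Matrix.mul_assoc]
  · have h0 : S' * K⁻¹ * uᵀ * E * (v * S) = S' * (K⁻¹ * (uᵀ * E * v * S)) := by
      simp only [Matrix.mul_assoc]
    have h1 := frob_mul_le_specNorm_mul S' (K⁻¹ * (uᵀ * E * v * S))
    have h2 := frob_mul_le_specNorm_mul K⁻¹ (uᵀ * E * v * S)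
    have h3 := frob_mul_le_mul_specNorm (uᵀ * E * v) S
    have h4 := frob_compression_le huu hvv E
    rw [h0, condNumber]
    calc _ ≤ specNorm S' * (specNorm K⁻¹ * (‖uᵀ * E * v‖ * specNorm S)) :=
          h1.trans (mul_le_mul_of_nonneg_left (h2.trans (mul_le_mul_of_nonneg_left h3
            (specNorm_nonneg _))) (specNorm_nonneg _))
      _ ≤ specNorm XM⁻¹ * (κ⁻¹ * (‖E‖ * specNorm XM)) := by
          have := specNorm_nonneg S
          have := specNorm_nonneg S'
          have := specNorm_nonneg K⁻¹
          have := specNorm_nonneg XM⁻¹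
          gcongr
      _ = _ := by rw [div_eq_mul_inv]; ring
  · -- the column `S e_j` is an eigenvector of `P`
    have hPS : P * S = S * diagonal zt := by
      rw [← hP, ← Matrix.mul_assoc, ← Matrix.mul_assoc, hSS', Matrix.one_mul]
    set a := S *ᵥ Pi.single j 1 with ha
    have hPa : P *ᵥ a = zt j • a := by
      rw [ha, mulVec_mulVec, hPS, ← mulVec_mulVec, ← mulVec_smul]
      congr 1
      ext i
      rw [mulVec_diagonal]
      by_cases h : i = j
      · simp [h]
      · simp [h]
    have ha0 : 0 < ‖WithLp.toLp 2 a‖ := by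
      refine norm_pos_iff.mpr fun h0 => ?_
      have h1 : a = 0 := by simpa using congrArg WithLp.ofLp h0
      have h2 : S' *ᵥ a = Pi.single j 1 := by rw [ha, mulVec_mulVec, hSS, one_mulVec]
      rw [h1, mulVec_zero] at h2
      simpa using congrFun h2 j
    have hPn : specNorm P ≤ specNorm Y₁ / σ := by
      have h0 : P = diagonal (fun i => (s i)⁻¹) * (uᵀ * (Y₁ * v)) := by
        simp only [hPdef, hW, Matrix.mul_assoc]
      have h1 := specNorm_mul_le (diagonal fun i => (s i)⁻¹) (uᵀ * (Y₁ * v))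
      have h2 := specNorm_mul_le uᵀ (Y₁ * v)
      have h3 := specNorm_mul_le Y₁ v
      have h4 := specNorm_le_one_of_orthonormal huu
      have h5 := specNorm_le_one_of_orthonormal hvv
      rw [specNorm_transpose] at h2
      have h6 := mul_le_mul_of_nonneg_left h5 (specNorm_nonneg Y₁)
      have h7 := mul_le_mul_of_nonneg_right h4 (specNorm_nonneg (Y₁ * v))
      rw [h0, div_eq_inv_mul]
      exact h1.trans (mul_le_mul (specNorm_diagonal_inv_le hσ hσle) (by linarith)
        (specNorm_nonneg _) (inv_nonneg.mpr hσ.le))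
    have h1 := norm_mulVec_le_specNorm P a
    rw [hPa, WithLp.toLp_smul, norm_smul, Real.norm_eq_abs] at h1
    exact (le_of_mul_le_mul_right h1 ha0).trans hPn

/-- Two windows that are shifted by one sample share all but one column. If `Y₀` has at least two
singular values `≥ σ`, some vector avoids the column that is missing in `Y₁`. -/
theorem le_specNorm_of_shift {m L M : ℕ} (hM : 2 ≤ M) (hMm : M ≤ m) (hML : M ≤ L)
    {Y₀ Y₁ : Matrix (Fin m) (Fin L) ℝ} {U : Matrix (Fin m) (Fin m) ℝ}
    {V : Matrix (Fin L) (Fin L) ℝ} (hSVD : IsSVD Y₀ U V) {σ : ℝ} (hσ : 0 < σ)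
    (hσs : σ = singVal Y₀ (M - 1))
    (hshift : ∀ (r : Fin m) (k : Fin L) (hk : (k : ℕ) + 1 < L), Y₁ r ⟨k + 1, hk⟩ = Y₀ r k) :
    σ ≤ specNorm Y₁ := by
  set s : Fin M → ℝ := fun i => singVal Y₀ i with hs
  have hσle : ∀ i, σ ≤ s i := fun i => by
    rw [hσs]
    exact singVal_antitone Y₀ (by have := i.2; omega)
  set u := leftCols hMm U with hu
  set v := leftCols hML V with hv
  have huu : uᵀ * u = 1 := leftCols_orthonormal hMm (transpose_mul_self_of_mem hSVD.left_orthogonal)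
  have hvv : vᵀ * v = 1 := leftCols_orthonormal hML (transpose_mul_self_of_mem hSVD.right_orthogonal)
  have hY₀ : uᵀ * Y₀ * v = diagonal s := by
    rw [hSVD.transpose_leftCols_mul hMm hML, Matrix.mul_assoc, hvv, Matrix.mul_one]
  obtain ⟨l, rfl⟩ : ∃ l, L = l + 1 := ⟨L - 1, by omega⟩
  obtain ⟨a, ha, ha0⟩ : ∃ a : Fin M → ℝ, (v *ᵥ a) (Fin.last l) = 0 ∧ a ≠ 0 := by
    obtain ⟨a, ha, ha0⟩ := Submodule.exists_mem_ne_zero_of_ne_bot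
      (LinearMap.ker_ne_bot_of_finrank_lt
        (f := (LinearMap.proj (Fin.last l) : (Fin (l + 1) → ℝ) →ₗ[ℝ] ℝ) ∘ₗ v.mulVecLin)
        (by simp; omega))
    exact ⟨a, ha, ha0⟩
  set b := v *ᵥ a with hb
  have hapos : 0 < ‖WithLp.toLp 2 a‖ := by
    refine norm_pos_iff.mpr fun h0 => ha0 ?_
    simpa using congrArg WithLp.ofLp h0
  -- the shifted vector
  set b' : Fin (l + 1) → ℝ := Fin.cons 0 fun i => b (Fin.castSucc i) with hb'
  have hbb' : ‖WithLp.toLp 2 b'‖ = ‖WithLp.toLp 2 b‖ := by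
    rw [← sq_eq_sq₀ (norm_nonneg _) (norm_nonneg _), norm_toLp_sq, norm_toLp_sq, dotProduct,
      dotProduct, Fin.sum_univ_succ, Fin.sum_univ_castSucc (fun i => b i * b i), ha]
    simp [hb']
  have hYb : Y₁ *ᵥ b' = Y₀ *ᵥ b := by
    ext r
    rw [mulVec, mulVec, dotProduct, dotProduct, Fin.sum_univ_succ,
      Fin.sum_univ_castSucc (fun i => Y₀ r i * b i), ha]
    simp only [hb', Fin.cons_zero, Fin.cons_succ, mul_zero, zero_add, add_zero]
    refine Finset.sum_congr rfl fun i _ => ?_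
    rw [← hshift r (Fin.castSucc i) (by simp)]
    rfl
  have h1 : σ * ‖WithLp.toLp 2 a‖ ≤ specNorm Y₁ * ‖WithLp.toLp 2 a‖ := by
    calc σ * ‖WithLp.toLp 2 a‖ ≤ ‖WithLp.toLp 2 (diagonal s *ᵥ a)‖ :=
          norm_diagonal_mulVec_ge hσ.le hσle
      _ = ‖WithLp.toLp 2 (uᵀ *ᵥ (Y₀ *ᵥ b))‖ := by
          rw [hb, mulVec_mulVec, mulVec_mulVec, hY₀]
      _ ≤ 1 * ‖WithLp.toLp 2 (Y₀ *ᵥ b)‖ := by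
          refine (norm_mulVec_le_specNorm _ _).trans
            (mul_le_mul_of_nonneg_right ?_ (norm_nonneg _))
          rw [specNorm_transpose]
          exact specNorm_le_one_of_orthonormal huu
      _ ≤ specNorm Y₁ * ‖WithLp.toLp 2 b'‖ := by
          rw [one_mul, ← hYb]
          exact norm_mulVec_le_specNorm _ _
      _ = _ := by rw [hbb', hb, norm_mulVec_of_orthonormal hvv]
  exact le_of_mul_le_mul_right h1 hapos

/-! ### The error bound for the sampled heat observation -/

theorem pencilParam_bounds {N : ℕ} (hN : 9 < N) :
    4 ≤ pencilParam N ∧ pencilParam N ≤ N - pencilParam N := by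
  unfold pencilParam
  split_ifs with h <;> omega

theorem one_le_condNumber {𝕜 : Type*} [RCLike 𝕜] {n : ℕ} (hn : 0 < n)
    {X : Matrix (Fin n) (Fin n) 𝕜} (hX : IsUnit X.det) : 1 ≤ condNumber X := by
  set v : Fin n → 𝕜 := Pi.single ⟨0, hn⟩ 1 with hv
  have hv0 : 0 < ‖WithLp.toLp 2 v‖ := by
    refine norm_pos_iff.mpr fun h0 => ?_
    have h1 : v = 0 := by simpa using congrArg WithLp.ofLp h0
    simpa [hv] using congrFun h1 ⟨0, hn⟩
  have h1 := norm_mulVec_le_specNorm X (X⁻¹ *ᵥ v)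
  rw [mulVec_mulVec, mul_nonsing_inv X hX, one_mulVec] at h1
  have h2 := mul_le_mul_of_nonneg_left (norm_mulVec_le_specNorm X⁻¹ v) (specNorm_nonneg X)
  refine le_of_mul_le_mul_right ?_ hv0
  rw [one_mul, condNumber, mul_assoc]
  exact h1.trans h2

theorem vanderRows_reversed_right_inverse {M L : ℕ} {ζ : Fin M → ℝ} (hζ : Function.Injective ζ)
    (h : M ≤ L) : ∃ B : Matrix (Fin L) (Fin M) ℝ,
      (vanderRows ζ L)ᵀ.submatrix id Fin.rev * B = 1 := by
  obtain ⟨B, hB⟩ := exists_left_inverse_of_mulVec (vanderRows_injective hζ h)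
  refine ⟨Bᵀ.submatrix Fin.rev id, ?_⟩
  have h1 := submatrix_mul_equiv (vanderRows ζ L)ᵀ Bᵀ id Fin.revPerm id
  rw [← transpose_mul, hB, transpose_one, submatrix_id_id] at h1
  exact h1

theorem frobBound₀_eq (α₀ M₀ T₁ : ℝ) (M : ℕ) (θ : ℝ) (L : ℕ) :
    frobBound₀ α₀ M₀ T₁ M θ L = tailConst α₀ M₀ T₁ M * bound₀ θ L := rfl

theorem frobBound₁_eq (α₀ M₀ T₁ : ℝ) (M : ℕ) (θ : ℝ) (L : ℕ) :
    frobBound₁ α₀ M₀ T₁ M θ L = tailConst α₀ M₀ T₁ M * bound₁ θ L := rfl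

/-- The first error bound. Of the assumption on the truncated singular value decomposition only
`frobBound₀ ≤ ρ σM` enters: the bound for `‖Y₀ - X₀‖` alone makes the compression of `X₀` to the
leading singular subspaces of `Y₀` invertible. -/
theorem abs_sub_lt_of_obs {𝕜 : Type*} [RCLike 𝕜]
    {α α₀ M₀ : ℝ} {u₀ : ℝ → ℝ} (hα₀ : 0 < α₀) (hα : α₀ ≤ α) (hM₀ : 0 < M₀)
    (hu₀ : MemLp u₀ 2 (volume.restrict (Set.Ioo (0 : ℝ) 1)))
    (hu₀M₀ : eLpNorm u₀ 2 (volume.restrict (Set.Ioo (0 : ℝ) 1)) ≤ ENNReal.ofReal M₀)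
    {T₁ Ts θ : ℝ} (hT₁ : 0 < T₁) (hTs : 0 < Ts) {N L M : ℕ} (hL4 : 4 ≤ L) (hLN : L ≤ N - L)
    (hM : 1 ≤ M) (hML : M ≤ L)
    (hcoeff : (M : ℕ∞) ≤ {n : ℕ | coeff u₀ n ≠ 0}.encard)
    (hθ : θ = 2 * α₀ * (M : ℝ) ^ 2 * Real.pi ^ 2 * Ts)
    {X₀ X₁ Y₀ Y₁ : Matrix (Fin (N - L)) (Fin L) ℝ}
    (hX₀ : X₀ = pencilMatrix (fun i => signal α u₀ M (T₁ + Ts * i)) N L 0)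
    (hX₁ : X₁ = pencilMatrix (fun i => signal α u₀ M (T₁ + Ts * i)) N L 1)
    (hY₀ : Y₀ = pencilMatrix (fun i => obs α u₀ (T₁ + Ts * i)) N L 0)
    (hY₁ : Y₁ = pencilMatrix (fun i => obs α u₀ (T₁ + Ts * i)) N L 1)
    {U : Matrix (Fin (N - L)) (Fin (N - L)) ℝ} {V : Matrix (Fin L) (Fin L) ℝ}
    (hSVD : IsSVD Y₀ U V) {σM : ℝ} (hσM : σM = singVal Y₀ (M - 1)) (hσM_pos : 0 < σM)
    {XM : Matrix (Fin L) (Fin L) 𝕜} (hXM : IsUnit XM.det)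
    {zt : Fin M → ℝ} (hzt : Antitone zt)
    (hdiag : (svdTruncPinv Y₀ U V M * Y₁).map (fun a : ℝ => (a : 𝕜)) =
      XM * Matrix.diagonal (fun i : Fin L =>
        if h : (i : ℕ) < M then ((zt ⟨i, h⟩ : ℝ) : 𝕜) else 0) * XM⁻¹)
    {z : Fin M → ℝ} (hz : Antitone z)
    (hzeig : ((pinv X₀ * X₁).charpoly.aroots ℂ).filter (fun w => w ≠ 0) =
      Finset.univ.val.map (fun n : Fin M => (z n : ℂ)))
    {ρ : ℝ} (hρ : frobBound₀ α₀ M₀ T₁ M θ L ≤ ρ * σM) (hρ1 : ρ < 1) (n : Fin M) :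
    |zt n - z n| < condNumber XM / (σM * (1 - ρ)) *
      ((1 + Real.sqrt 5) / 2 * ρ * specNorm Y₁ + frobBound₁ α₀ M₀ T₁ M θ L) := by
  have hα0 : 0 < α := hα₀.trans_le hα
  have hM' : (1 : ℝ) ≤ M := by exact_mod_cast hM
  have hθ0 : 0 < θ := by rw [hθ]; positivity
  have hcard : ∀ k < M, ∀ hf : (Set.ofPred fun n => coeff u₀ n ≠ 0).Finite,
      k < hf.toFinset.card := fun k hk hf => lt_card_of_le_encard hcoeff hk hf
  -- the nodes and the amplitudes of the exact signal
  set ζ : Fin M → ℝ := fun k => modeRatio α Ts (modeIndex u₀ k) with hζdef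
  set a : Fin M → ℝ := fun k =>
    coeff u₀ (modeIndex u₀ k) * Real.exp (-(eigval α (modeIndex u₀ k) * T₁)) with hadef
  have hζ : StrictAnti ζ := fun i j hij =>
    modeRatio_strictAnti hα0 hTs (Nat.nth_lt_nth' (Fin.lt_def.mp hij) (hcard _ j.2))
  have hζ1 : ∀ k, ζ k ≤ 1 := fun k => Real.exp_le_one_iff.mpr (by
    have : 0 ≤ eigval α (modeIndex u₀ k) * Ts := by unfold eigval; positivity
    linarith)
  have ha0 : ∀ k, a k ≠ 0 := fun k =>
    mul_ne_zero (Nat.nth_mem (k : ℕ) (hcard _ k.2)) (Real.exp_pos _).ne'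
  have hsig : (fun i : ℕ => signal α u₀ M (T₁ + Ts * i)) = fun i => ∑ k, a k * ζ k ^ i := by
    ext i
    rw [signal, Finset.sum_range]
    refine Finset.sum_congr rfl fun k _ => ?_
    rw [exp_eigval_sample, ← mul_assoc]
  set G := vanderRows ζ (N - L) * diagonal a with hG
  set R := (vanderRows ζ L)ᵀ.submatrix id Fin.rev with hR
  have hX₀' : X₀ = G * R := by
    rw [hX₀, hsig, pencilMatrix_eq_mul, pow_zero, Matrix.mul_one]
  have hX₁' : X₁ = G * diagonal ζ * R := by
    rw [hX₁, hsig, pencilMatrix_eq_mul, pow_one, ← Matrix.mul_assoc]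
  have hzζ : z = ζ := by
    refine eq_nodes_of_pinv (G := G) (R := R) hML hζ.antitone (fun k => (Real.exp_pos _).ne') hz ?_
      (vanderRows_reversed_right_inverse hζ.injective hML) (by rw [← hX₀', ← hX₁']; exact hzeig)
    obtain ⟨B, hB⟩ := exists_left_inverse_of_mulVec
      (vanderRows_injective hζ.injective (hML.trans hLN))
    refine ⟨diagonal (fun k => (a k)⁻¹) * B, ?_⟩
    rw [hG, Matrix.mul_assoc, ← Matrix.mul_assoc B, hB, Matrix.one_mul, diagonal_mul_diagonal,
      ← diagonal_one]
    congr 1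
    ext k
    exact inv_mul_cancel₀ (ha0 k)
  obtain ⟨θ', t, hθθ', ht0, htc, hζw, hE⟩ :=
    exists_pencilBounds_obs hα₀ hα hM₀ hu₀ hu₀M₀ hT₁ hTs hM hcoeff hθ N L
  rw [← hX₀, ← hX₁, ← hY₀, ← hY₁] at hE
  set c := tailConst α₀ M₀ T₁ M with hc
  have hE₀ : ‖Y₀ - X₀‖ ≤ ρ * σM := by
    refine hE.zero.trans (le_trans ?_ hρ)
    rw [frobBound₀_eq]
    refine mul_le_mul htc.le ?_ (geomSum_pos (hθ0.trans_le hθθ')).le (ht0.trans htc.le)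
    exact ((geomSum_anti hθ0 hθθ').trans (geomSum_le_one_add hθ0)).trans
      (one_add_inv_le_bound₀ hθ0 (by omega))
  obtain ⟨T, B, A₁, A₂, hT, hB, hBG, hA, hztQ⟩ := exists_normalized_pencil (hML.trans hLN) hML hSVD
    hσM_pos hσM hXM hzt hdiag hX₀' hX₁' hρ1 hE₀
  set r := condNumber XM / (σM * (1 - ρ)) with hr
  have hr0 : 0 < r := div_pos (zero_lt_one.trans_le (one_le_condNumber (by omega) hXM))
    (mul_pos hσM_pos (by linarith))
  have hmul : ∀ {E : Matrix (Fin (N - L)) (Fin L) ℝ} {b : ℝ}, ‖E‖ ≤ t * b →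
      ‖A₁ * E * A₂‖ ≤ r * t * b := fun {E b} h => by
    rw [mul_assoc]
    exact (hA E).trans (mul_le_mul_of_nonneg_left h hr0.le)
  have hQ : 2 ≤ M → 1 ≤ specNorm Y₁ / σM := fun hM2 => by
    rw [le_div_iff₀ hσM_pos, one_mul]
    refine le_specNorm_of_shift hM2 (hML.trans hLN) hML hSVD hσM_pos hσM fun i k hk => ?_
    rw [hY₀, hY₁]
    simp only [pencilMatrix, of_apply]
    have : L - 1 - ((k : ℕ) + 1) + 1 + (i : ℕ) = L - 1 - (k : ℕ) + 0 + (i : ℕ) := by omega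
    rw [this]
  have hsub : ‖A₁ * (Y₁ - X₁) * A₂ - Real.exp (-(θ' / 2)) • (A₁ * (Y₀ - X₀) * A₂)‖ ≤ r * t := by
    have h1 : A₁ * (Y₁ - X₁) * A₂ - Real.exp (-(θ' / 2)) • (A₁ * (Y₀ - X₀) * A₂)
        = A₁ * (Y₁ - X₁ - Real.exp (-(θ' / 2)) • (Y₀ - X₀)) * A₂ := by
      rw [Matrix.mul_sub A₁ (Y₁ - X₁), Matrix.sub_mul, Matrix.mul_smul, Matrix.smul_mul]
    rw [h1]
    exact (hA _).trans (mul_le_mul_of_nonneg_left hE.sub hr0.le)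
  have hmain := abs_sub_lt_of_pencil hzt hζ.antitone hT hB hBG hθ0 hθθ' hL4 (fun k => hζw k k.2)
    hζ1 hQ hztQ (mul_nonneg hr0.le ht0) (mul_lt_mul_of_pos_left htc hr0) (hmul hE.zero)
    (hmul hE.one) hsub (hmul hE.zero_window) (hmul hE.one_window) n
  rw [hzζ]
  refine hmain.trans_le ?_
  rw [mul_assoc r]
  refine mul_le_mul_of_nonneg_left ?_ hr0.le
  have h1 : frobBound₀ α₀ M₀ T₁ M θ L * (specNorm Y₁ / σM) ≤ ρ * specNorm Y₁ := by
    have := mul_le_mul_of_nonneg_right hρ (div_nonneg (specNorm_nonneg Y₁) hσM_pos.le)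
    rwa [mul_assoc ρ, mul_div_cancel₀ _ hσM_pos.ne'] at this
  have h2 := mul_le_mul_of_nonneg_left h1 (by positivity : 0 ≤ (1 + Real.sqrt 5) / 2)
  rw [frobBound₀_eq] at h2
  rw [frobBound₁_eq]
  linarith

end HeatPencil

theorem mainTheorem5 {𝕜 : Type*} [RCLike 𝕜]
    -- the heat equation: diffusivity and initial state, with their a priori bounds
    (α α₀ M₀ : ℝ) (u₀ : ℝ → ℝ) (hα₀ : 0 < α₀) (hα : α₀ ≤ α) (hM₀ : 0 < M₀)
    (hu₀ : MemLp u₀ 2 (volume.restrict (Set.Ioo (0 : ℝ) 1)))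
    (hu₀M₀ : eLpNorm u₀ 2 (volume.restrict (Set.Ioo (0 : ℝ) 1)) ≤ ENNReal.ofReal M₀)
    -- the observation interval, the `N` sample points and the number `M` of retained terms
    (T₁ T₂ : ℝ) (hT₁ : 0 < T₁) (hT₂ : T₁ < T₂)
    (N L M : ℕ) (hN : 9 < N) (hL : L = pencilParam N) (hM : 1 ≤ M) (hML : M ≤ L)
    (hcoeff : (M : ℕ∞) ≤ {n : ℕ | coeff u₀ n ≠ 0}.encard)
    (Ts θ : ℝ) (hTs : Ts = samplingPeriod T₁ T₂ N)
    (hθ : θ = 2 * α₀ * (M : ℝ) ^ 2 * Real.pi ^ 2 * Ts)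
    -- the exact and the perturbed matrices of the pencil method
    (x y : ℕ → ℝ) (hx : ∀ i, x i = signal α u₀ M (T₁ + Ts * i))
    (hy : ∀ i, y i = obs α u₀ (T₁ + Ts * i))
    (X₀ X₁ Y₀ Y₁ : Matrix (Fin (N - L)) (Fin L) ℝ)
    (hX₀ : X₀ = pencilMatrix x N L 0) (hX₁ : X₁ = pencilMatrix x N L 1)
    (hY₀ : Y₀ = pencilMatrix y N L 0) (hY₁ : Y₁ = pencilMatrix y N L 1)
    -- the singular value decomposition of `Y₀`, truncated at its `M`-th singular value
    (U : Matrix (Fin (N - L)) (Fin (N - L)) ℝ) (V : Matrix (Fin L) (Fin L) ℝ)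
    (hSVD : IsSVD Y₀ U V) (σM : ℝ) (hσM : σM = singVal Y₀ (M - 1)) (hσM_pos : 0 < σM)
    -- diagonalization of `Y_{0,M}† Y₁`
    (XM : Matrix (Fin L) (Fin L) 𝕜) (hXM : IsUnit XM.det)
    (zt : Fin M → ℝ) (hzt : Antitone zt)
    (hdiag : (svdTruncPinv Y₀ U V M * Y₁).map (fun a : ℝ => (a : 𝕜)) =
      XM * Matrix.diagonal (fun i : Fin L =>
        if h : (i : ℕ) < M then ((zt ⟨i, h⟩ : ℝ) : 𝕜) else 0) * XM⁻¹)
    -- the nonzero eigenvalues of `X₀† X₁`, with multiplicity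
    (z : Fin M → ℝ) (hz : Antitone z)
    (hzeig : ((pinv X₀ * X₁).charpoly.aroots ℂ).filter (fun w => w ≠ 0) =
      Finset.univ.val.map (fun n : Fin M => (z n : ℂ)))
    -- the normalized perturbation
    (ρ : ℝ)
    (hρ : ρ = (specNorm (svdTrunc Y₀ U V M - Y₀) + frobBound₀ α₀ M₀ T₁ M θ L) / σM)
    (hρ1 : ρ < 1) :
    (∀ n : Fin M, |zt n - z n| <
      condNumber XM / (σM * (1 - ρ)) *
        ((1 + Real.sqrt 5) / 2 * ρ * specNorm Y₁ + frobBound₁ α₀ M₀ T₁ M θ L)) ∧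
    (1 / ((L : ℝ) - 1) < θ → ∀ n : Fin M, |zt n - z n| <
      condNumber XM * ρ / (σM * (1 - ρ)) *
        ((1 + Real.sqrt 5) / 2 * specNorm Y₁ + σM)) := by
  obtain ⟨hL4, hLN⟩ := pencilParam_bounds hN
  rw [← hL] at hL4 hLN
  have hN' : (9 : ℝ) < N := by exact_mod_cast hN
  have hTs0 : 0 < Ts := by
    rw [hTs, samplingPeriod]
    exact div_pos (by linarith) (by linarith)
  have hM' : (1 : ℝ) ≤ M := by exact_mod_cast hM
  have hθ0 : 0 < θ := by rw [hθ]; positivity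
  have hρσ : frobBound₀ α₀ M₀ T₁ M θ L ≤ ρ * σM := by
    rw [hρ, div_mul_cancel₀ _ hσM_pos.ne']
    linarith [specNorm_nonneg (svdTrunc Y₀ U V M - Y₀)]
  have key : ∀ n : Fin M, |zt n - z n| < condNumber XM / (σM * (1 - ρ)) *
      ((1 + Real.sqrt 5) / 2 * ρ * specNorm Y₁ + frobBound₁ α₀ M₀ T₁ M θ L) := by
    rw [funext hx] at hX₀ hX₁
    rw [funext hy] at hY₀ hY₁
    exact abs_sub_lt_of_obs hα₀ hα hM₀ hu₀ hu₀M₀ hT₁ hTs0 hL4 hLN hM hML hcoeff hθ hX₀ hX₁ hY₀ hY₁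
      hSVD hσM hσM_pos hXM hzt hdiag hz hzeig hρσ hρ1
  refine ⟨key, fun hθL n => (key n).trans_le ?_⟩
  have hr0 : 0 ≤ condNumber XM / (σM * (1 - ρ)) :=
    div_nonneg (mul_nonneg (specNorm_nonneg _) (specNorm_nonneg _))
      (mul_nonneg hσM_pos.le (by linarith))
  have hc0 : 0 ≤ tailConst α₀ M₀ T₁ M := by unfold tailConst; positivity
  have h1 : frobBound₁ α₀ M₀ T₁ M θ L ≤ ρ * σM :=
    (mul_le_mul_of_nonneg_left (bound₁_le_bound₀ hθ0 (by omega) hθL) hc0).trans hρσ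
  calc _ ≤ condNumber XM / (σM * (1 - ρ)) *
        ((1 + Real.sqrt 5) / 2 * ρ * specNorm Y₁ + ρ * σM) := by gcongr
    _ = _ := by ring
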